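/- Let $k$ be a field and let $Sm/k$ be the category of smooth separated schemes of finite type over $k$. All products are over $k$. **The categories $\mathcal A(U,X)$.** For $U,X\in Sm/k$ let $\mathrm{Supp}(U\times X/X)$ be the set of finite (possibly empty) unions of closed irreducible subsets of $U\times X$ which are finite over $U$ and surjective over a connected component of $U$. Let $\mathrm{SubSch}(U\times X/X)$ be the set of closed subschemes $A_m=(A,\mathcal O_{U\times X}/I_A^m)$ with $A\in\mathrm{Supp}(U\times X/X)$, $I_A$ the ideal sheaf of the closed set $A$, and $m\ge 0$ ($A_0=\emptyset$). For $Z\in\mathrm{SubSch}(U\times X/X)$ write $p_U:Z\to U$ for the projection. Objects of $\mathcal A(U,X)$ are equivalence classes of triples $(n,Z,\phi)$ with $n\ge 0$, $Z\in\mathrm{SubSch}(U\times X/X)$ and $\phi:p_{U,*}\mathcal O_Z\to M_n(\mathcal O_U)$ a non-unital homomorphism of sheaves of $\mathcal O_U$-algebras; $(n,Z,\phi)$ and $(n',Z',\phi')$ are equivalent if $n=n'$ and $\phi,\phi'$ become equal on $p_{U,*}\mathcal O_{Z''}$ for some $Z''\in\mathrm{SubSch}(U\times X/X)$ containing $Z$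 and $Z'$. Put $p(\phi)=\phi(1)$ and $P(\phi)=\operatorname{im}p(\phi)\subseteq\mathcal O_U^n$, a $p_{U,*}\mathcal O_Z$-module through $\phi$. Morphisms are $\operatorname{Hom}_{p_{U,*}\mathcal O_Z}(P(\phi),P(\phi'))$, where $Z$ is a common support of the two objects. **The pairings.** For $V,U,X\in Sm/k$, the pairing $\circ:\mathcal A(V,U)\times\mathcal A(U,X)\to\mathcal A(V,X)$ sends the classes of $(n_1,Z_1,\phi_1)$ and $(n_2,Z_2,\phi_2)$ to the class of $(n_2n_1,Z_2\circ Z_1,\phi_2\circ\phi_1)$. Here $Z_2\circ Z_1=C_m$, where $C=p_{VX}\bigl((V\times Z_2^{red})\cap(Z_1^{red}\times X)\bigr)$ and $m$ is so large that $Z_1\times_UZ_2\to V\times X$ factors through a morphism $\pi:Z_1\times_UZ_2\to C_m$; and $\phi_2\circ\phi_1$ is the composite $$p_{V,*}\mathcal O_{Z_2\circ Z_1}\xrightarrow{\ \pi^*\ }q_{V,*}\mathcal O_{Z_1\times_UZ_2}\xrightarrow{\ p_{V,*}(\phi_{2,Z_1})\ }M_{n_2}(p_{V,*}\mathcal O_{Z_1})\xrightarrow{\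 M_{n_2}(\phi_1)\ }M_{n_2}(M_{n_1}(\mathcal O_V))\cong M_{n_2n_1}(\mathcal O_V),$$ where $q_V:Z_1\times_UZ_2\to V$ is the projection, $\phi_{2,Z_1}$ is the base change of $\phi_2$ along the projection $r:Z_1\to U$ (given on affine opens by $a\otimes b\mapsto a\cdot r^*(\phi_2(b))$), and the last isomorphism inserts the $(n_1,n_1)$-matrices as blocks into the $(n_2,n_2)$-matrix. With $P(\phi_{2,Z_1})=\operatorname{im}\phi_{2,Z_1}(1)\subseteq\mathcal O_{Z_1}^{n_2}$, let $$\sigma_{12}:p_{V,*}P(\phi_{2,Z_1})\otimes_{p_{V,*}\mathcal O_{Z_1}}P(\phi_1)\to P(\phi_2\circ\phi_1),\qquad m_2\otimes m_1\mapsto p(\phi_2\circ\phi_1)\bigl((\phi_1(m_{2,j})\,m_1)_{1\le j\le n_2}\bigr),$$ using $(\mathcal O_V^{n_1})^{n_2}\cong\mathcal O_V^{n_2n_1}$, $e_{i,j}\mapsto e_{i+(j-1)n_1}$. On morphisms $\alpha_1:\Phi_1\to\Phi_1'$, $\alpha_2:\Phi_2\to\Phi_2'$ (with $\Phi_1,\Phi_1'$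 represented on a common support $Z_1$) the pairing is the morphism $\alpha_2\odot\alpha_1$ with $(\alpha_2\odot\alpha_1)\circ\sigma_{12}=\sigma_{12}'\circ(r^*\alpha_2\otimes\alpha_1)$. Finally $\mathrm{id}_X\in\mathcal A(X,X)$ is the class of $(1,\Delta_X,\mathrm{id}:\mathcal O_X\to\mathcal O_X)$. **Proposition.** (1) For all $V,U,X\in Sm/k$ the above rules are well defined and determine a unique functor $\circ:\mathcal A(V,U)\times\mathcal A(U,X)\to\mathcal A(V,X)$. (2) For all $U,V,W,X\in Sm/k$ the diagram of functors $$\mathcal A(W,V)\times(\mathcal A(V,U)\times\mathcal A(U,X))\cong(\mathcal A(W,V)\times\mathcal A(V,U))\times\mathcal A(U,X)\xrightarrow{\circ\times\mathrm{id}}\mathcal A(W,U)\times\mathcal A(U,X)\xrightarrow{\circ}\mathcal A(W,X),$$ $$\mathcal A(W,V)\times(\mathcal A(V,U)\times\mathcal A(U,X))\xrightarrow{\mathrm{id}\times\circ}\mathcal A(W,V)\times\mathcal A(V,X)\xrightarrow{\circ}\mathcal A(W,X)$$ is strictly commutative: the two composite functors are equal, on objects and on morphisms. (3) The categories $\mathcal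 A(U,X)$ are additive, the pairings are bilinear, and $\{\mathrm{id}_U\}\times\mathcal A(U,X)\xrightarrow{\circ}\mathcal A(U,X)$ and $\mathcal A(U,X)\times\{\mathrm{id}_X\}\xrightarrow{\circ}\mathcal A(U,X)$ are the identity functors. Thus the pairings and the objects $\mathrm{id}_X$ make $\mathcal A$ a category on $Sm/k$ enriched in additive categories. -/

import Mathlib

open CategoryTheory CategoryTheory.Limits AlgebraicGeometry TopologicalSpace

universe u v w

noncomputable section

namespace KMotive

open Scheme (IdealSheafData)
open scoped CategoryTheory.Prod

/-- An object of `Sm/k`: a smooth separated scheme of finite type over the field `k`. -/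
structure Sm (k : Type u) [Field k] where
  scheme : Scheme.{u}
  hom : scheme ⟶ Spec (CommRingCat.of k)
  smooth : Smooth hom
  separated : IsSeparated hom
  locallyOfFiniteType : LocallyOfFiniteType hom
  quasiCompact : QuasiCompact hom

/-! ### Sheaf homomorphisms `p_* 𝒪_Z → M_n(𝒪_U)` -/

section MatHom

variable {Z Z' Z'' U : Scheme.{u}}

/-- For a `U`-morphism `g : Z' ⟶ Z` (with structure maps `p'`, `p`), the pullback of functions
`p_* 𝒪_Z → p'_* 𝒪_{Z'}` on sections over `W`. -/
def pullSec {p : Z ⟶ U} {p' : Z' ⟶ U} (g : Z' ⟶ Z) (w : g ≫ p = p') (W : U.Opens) :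
    Γ(Z, p ⁻¹ᵁ W) →+* Γ(Z', p' ⁻¹ᵁ W) :=
  (g.appLE (p ⁻¹ᵁ W) (p' ⁻¹ᵁ W) (by rw [← w]; rfl)).hom

/-- A non-unital homomorphism `p_* 𝒪_Z → M_n(𝒪_U)` of sheaves of `𝒪_U`-algebras. -/
@[ext]
structure MatHom (p : Z ⟶ U) (n : ℕ) where
  app (W : U.Opens) : Γ(Z, p ⁻¹ᵁ W) →ₙ+* Matrix (Fin n) (Fin n) Γ(U, W)
  map_smul (W : U.Opens) (a : Γ(U, W)) (f : Γ(Z, p ⁻¹ᵁ W)) :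
    app W ((p.app W).hom a * f) = a • app W f
  naturality {W W' : U.Opens} (h : W' ≤ W) (f : Γ(Z, p ⁻¹ᵁ W)) :
    app W' ((Z.presheaf.map (homOfLE ((Opens.map p.base).map (homOfLE h)).le).op).hom f) =
      (app W f).map (U.presheaf.map (homOfLE h).op).hom

end MatHom

section Correspondences

variable {k : Type u} [Field k]

/-! ### Supports -/

/-- The product `U × X` over `k`. -/
abbrev prodScheme (U X : Sm k) : Scheme.{u} := pullback U.hom X.hom

/-- The projection `U × X ⟶ U`. -/
abbrev prodFst (U X : Sm k) : prodScheme U X ⟶ U.scheme := pullback.fst U.hom X.hom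

/-- The projection `U × X ⟶ X`. -/
abbrev prodSnd (U X : Sm k) : prodScheme U X ⟶ X.scheme := pullback.snd U.hom X.hom

/-- The structure map `p_U : Z ⟶ U` of the closed subscheme `Z ⊆ U × X` with ideal sheaf `I`. -/
abbrev src {U X : Sm k} (I : IdealSheafData (prodScheme U X)) : I.subscheme ⟶ U.scheme :=
  I.subschemeι ≫ prodFst U X

/-- The map `Z ⟶ X` of the closed subscheme `Z ⊆ U × X` with ideal sheaf `I`. -/
abbrev tgt {U X : Sm k} (I : IdealSheafData (prodScheme U X)) : I.subscheme ⟶ X.scheme :=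
  I.subschemeι ≫ prodSnd U X

/-- `A` is irreducible, finite over `U` (with its reduced structure), and surjective over a
component of `U`. As `U` is smooth, its irreducible components are its connected components; for
irreducible `U` the last condition says that `A ⟶ U` is surjective. -/
structure IsElementary {U X : Sm k} (A : Closeds (prodScheme U X)) : Prop where
  irreducible : IsIrreducible (A : Set (prodScheme U X))
  finite : IsFinite (src (IdealSheafData.vanishingIdeal A))
  surjective : (prodFst U X) '' (A : Set (prodScheme U X)) ∈ irreducibleComponents U.scheme

/-- `A ∈ Supp(U × X / X)`: `A` is a finite (possibly empty) union of elementary closed subsets. -/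
def IsSupp {U X : Sm k} (A : Closeds (prodScheme U X)) : Prop :=
  ∃ S : Set (Closeds (prodScheme U X)), S.Finite ∧ (∀ B ∈ S, IsElementary B) ∧
    (A : Set (prodScheme U X)) = ⋃ B ∈ S, (B : Set (prodScheme U X))

/-- `I` is the ideal sheaf of a member of `SubSch(U × X / X)`, that is, `I = I_A ^ m` with
`A ∈ Supp(U × X / X)`. For `m = 0` this is the unit ideal (the empty subscheme). -/
def IsSubSch {U X : Sm k} (I : IdealSheafData (prodScheme U X)) : Prop :=
  ∃ A : Closeds (prodScheme U X), IsSupp A ∧ ∃ m : ℕ, I = IdealSheafData.vanishingIdeal A ^ m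

lemma IsSupp.sup {U X : Sm k} {A B : Closeds (prodScheme U X)} (hA : IsSupp A) (hB : IsSupp B) :
    IsSupp (A ⊔ B) := by
  obtain ⟨S, hS, hS', hAS⟩ := hA
  obtain ⟨T, hT, hT', hBT⟩ := hB
  refine ⟨S ∪ T, hS.union hT, fun C hC => hC.elim (hS' C) (hT' C), ?_⟩
  rw [Closeds.coe_sup, hAS, hBT, Set.biUnion_union]

/-- Any two members of `SubSch(U × X / X)` are contained in a third one. -/
lemma IsSubSch.exists_le {U X : Sm k} {I J : IdealSheafData (prodScheme U X)}
    (hI : IsSubSch I) (hJ : IsSubSch J) : ∃ L, IsSubSch L ∧ L ≤ I ∧ L ≤ J := by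
  obtain ⟨A, hA, m, rfl⟩ := hI
  obtain ⟨B, hB, m', rfl⟩ := hJ
  have key : ∀ (C D : Closeds (prodScheme U X)) (a b : ℕ), C ≤ D → a ≤ b →
      IdealSheafData.vanishingIdeal D ^ b ≤ IdealSheafData.vanishingIdeal C ^ a := by
    intro C D a b hCD hab W
    exact (Ideal.pow_le_pow_right hab).trans
      (Ideal.pow_right_mono (IdealSheafData.vanishingIdeal_antimono hCD W) a)
  exact ⟨_, ⟨A ⊔ B, hA.sup hB, max m m', rfl⟩,
    key _ _ _ _ le_sup_left (le_max_left _ _), key _ _ _ _ le_sup_right (le_max_right _ _)⟩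

/-! ### Objects of `𝒜(U, X)` -/

/-- A triple `(n, Z, φ : p_{U,*} 𝒪_Z → M_n(𝒪_U))` with given `n`; `Z ∈ SubSch(U × X / X)` is
recorded through its ideal sheaf. -/
structure Triple (U X : Sm k) (n : ℕ) where
  ideal : IdealSheafData (prodScheme U X)
  isSubSch : IsSubSch ideal
  hom : MatHom (src ideal) n

/-- Restriction of functions `p_{U,*} 𝒪_{Z''} → p_{U,*} 𝒪_Z` along a closed embedding
`Z ⊆ Z''` of closed subschemes of `U × X` (so `J ≤ I` for the ideal sheaves). -/
def can {U X : Sm k} {I J : IdealSheafData (prodScheme U X)} (h : J ≤ I) (W : U.scheme.Opens) :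
    Γ(J.subscheme, src J ⁻¹ᵁ W) →+* Γ(I.subscheme, src I ⁻¹ᵁ W) :=
  pullSec (IdealSheafData.inclusion h) (by simp [src]) W

lemma can_can {U X : Sm k} {I J L : IdealSheafData (prodScheme U X)} (h : J ≤ I) (h' : L ≤ J)
    (W : U.scheme.Opens) (f : Γ(L.subscheme, src L ⁻¹ᵁ W)) :
    can h W (can h' W f) = can (h'.trans h) W f := by
  simp only [can, pullSec, ← CommRingCat.comp_apply, Scheme.Hom.appLE_comp_appLE,
    IdealSheafData.inclusion_comp]

/-- Two triples (with the same `n`) are equivalent if their homomorphisms agree after restriction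
to a common larger `Z'' ∈ SubSch(U × X / X)`. -/
def Triple.Equivalent {U X : Sm k} {n : ℕ} (t t' : Triple U X n) : Prop :=
  ∃ (J : IdealSheafData (prodScheme U X)) (_ : IsSubSch J) (h : J ≤ t.ideal) (h' : J ≤ t'.ideal),
    ∀ (W : U.scheme.Opens) (f : Γ(J.subscheme, src J ⁻¹ᵁ W)),
      t.hom.app W (can h W f) = t'.hom.app W (can h' W f)

instance Triple.setoid (U X : Sm k) (n : ℕ) : Setoid (Triple U X n) where
  r := Triple.Equivalent
  iseqv :=
    { refl := fun t => ⟨t.ideal, t.isSubSch, le_rfl, le_rfl, fun _ _ => rfl⟩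
      symm := fun ⟨J, hJ, h, h', e⟩ => ⟨J, hJ, h', h, fun W f => (e W f).symm⟩
      trans := by
        rintro t₁ t₂ t₃ ⟨J, hJ, h₁, h₂, e⟩ ⟨K, hK, h₂', h₃, e'⟩
        obtain ⟨L, hL, hLJ, hLK⟩ := hJ.exists_le hK
        refine ⟨L, hL, hLJ.trans h₁, hLK.trans h₃, fun W f => ?_⟩
        rw [← can_can h₁ hLJ, e, can_can, ← can_can h₃ hLK, ← e', can_can] }

/-- The objects of `𝒜(U, X)`: equivalence classes of triples `(n, Z, φ)`. -/
structure Corr (U X : Sm k) where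
  n : ℕ
  cls : Quotient (Triple.setoid U X n)

/-- The class of a triple. -/
def Triple.toCorr {U X : Sm k} {n : ℕ} (t : Triple U X n) : Corr U X := ⟨n, Quotient.mk _ t⟩

namespace Corr

variable {U X : Sm k}

/-- The idempotent `p(φ) = φ(1)`, on sections over `W`. -/
def idem (Φ : Corr U X) (W : U.scheme.Opens) : Matrix (Fin Φ.n) (Fin Φ.n) Γ(U.scheme, W) :=
  Quotient.lift (fun t : Triple U X Φ.n => t.hom.app W 1)
    (by
      rintro t t' ⟨J, _, h, h', e⟩
      have := e W 1
      rwa [map_one (can h W), map_one (can h' W)] at this) Φ.cls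

/-- The sheaf `P(φ) = im p(φ) ⊆ 𝒪_U^n`, on sections over `W`. -/
def P (Φ : Corr U X) (W : U.scheme.Opens) : Submodule Γ(U.scheme, W) (Fin Φ.n → Γ(U.scheme, W)) :=
  LinearMap.range (Φ.idem W).mulVecLin

/-- The restriction `𝒪_U(W)^n → 𝒪_U(W')^n`. -/
def resVec {U : Scheme.{u}} {n : ℕ} {W W' : U.Opens} (h : W' ≤ W) (x : Fin n → Γ(U, W)) :
    Fin n → Γ(U, W') :=
  fun i => (U.presheaf.map (homOfLE h).op).hom (x i)

lemma resVec_add {U : Scheme.{u}} {n : ℕ} {W W' : U.Opens} (h : W' ≤ W) (x y : Fin n → Γ(U, W)) :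
    resVec h (x + y) = resVec h x + resVec h y := by
  ext i; simp [resVec]

lemma resVec_neg {U : Scheme.{u}} {n : ℕ} {W W' : U.Opens} (h : W' ≤ W) (x : Fin n → Γ(U, W)) :
    resVec h (-x) = -resVec h x := by
  ext i; simp [resVec]

/-- Families of linear maps `P(φ)(W) → P(φ')(W)`, `W ⊆ U` open. -/
abbrev Family (Φ Ψ : Corr U X) := ∀ W : U.scheme.Opens, Φ.P W →ₗ[Γ(U.scheme, W)] Ψ.P W

/-- A family is a morphism of presheaves on `U`. -/
def IsNatural {Φ Ψ : Corr U X} (α : Family Φ Ψ) : Prop :=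
  ∀ (W W' : U.scheme.Opens) (h : W' ≤ W) (x : Φ.P W) (y : Φ.P W'),
    (y : Fin Φ.n → Γ(U.scheme, W')) = resVec h x →
    (α W' y : Fin Ψ.n → Γ(U.scheme, W')) = resVec h (α W x)

/-- A family is linear over `p_{U,*} 𝒪_Z`, where the closed subscheme `Z` (with ideal sheaf `J`)
contains the supports of the triples `t`, `t'` and acts on `P(φ)`, `P(φ')` through them. -/
def IsLinearOver {Φ Ψ : Corr U X} (t : Triple U X Φ.n) (t' : Triple U X Ψ.n)
    (J : IdealSheafData (prodScheme U X)) (h : J ≤ t.ideal) (h' : J ≤ t'.ideal)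
    (α : Family Φ Ψ) : Prop :=
  ∀ (W : U.scheme.Opens) (f : Γ(J.subscheme, src J ⁻¹ᵁ W)) (x y : Φ.P W),
    (y : Fin Φ.n → Γ(U.scheme, W)) = (t.hom.app W (can h W f)).mulVec x →
    (α W y : Fin Ψ.n → Γ(U.scheme, W)) = (t'.hom.app W (can h' W f)).mulVec (α W x)

/-- A family is linear over `p_{U,*} 𝒪_Z`, where `Z` is a common support of the two objects. -/
def IsActionLinear {Φ Ψ : Corr U X} (α : Family Φ Ψ) : Prop :=
  ∃ (t : Triple U X Φ.n) (t' : Triple U X Ψ.n) (J : IdealSheafData (prodScheme U X))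
    (h : J ≤ t.ideal) (h' : J ≤ t'.ideal),
    Quotient.mk _ t = Φ.cls ∧ Quotient.mk _ t' = Ψ.cls ∧ IsSubSch J ∧ IsLinearOver t t' J h h' α

lemma IsLinearOver.mono {Φ Ψ : Corr U X} {t : Triple U X Φ.n} {t' : Triple U X Ψ.n}
    {J L : IdealSheafData (prodScheme U X)} {h : J ≤ t.ideal} {h' : J ≤ t'.ideal} {α : Family Φ Ψ}
    (H : IsLinearOver t t' J h h' α) (hL : L ≤ J) :
    IsLinearOver t t' L (hL.trans h) (hL.trans h') α := by
  intro W f x y hy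
  rw [← can_can h hL] at hy
  rw [← can_can h' hL]
  exact H W _ x y hy

/-- Change of representatives, after enlarging `Z`. -/
lemma IsLinearOver.change {Φ Ψ : Corr U X} {t s : Triple U X Φ.n} {t' s' : Triple U X Ψ.n}
    {J : IdealSheafData (prodScheme U X)} {h : J ≤ t.ideal} {h' : J ≤ t'.ideal} {α : Family Φ Ψ}
    (H : IsLinearOver t t' J h h' α) (hJ : IsSubSch J)
    (hs : (Quotient.mk _ t : Quotient (Triple.setoid U X Φ.n)) = Quotient.mk _ s)
    (hs' : (Quotient.mk _ t' : Quotient (Triple.setoid U X Ψ.n)) = Quotient.mk _ s') :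
    ∃ (L : IdealSheafData (prodScheme U X)) (g : L ≤ s.ideal) (g' : L ≤ s'.ideal),
      IsSubSch L ∧ IsLinearOver s s' L g g' α := by
  obtain ⟨M, hM, m₁, m₂, em⟩ := Quotient.exact hs
  obtain ⟨N, hN, n₁, n₂, en⟩ := Quotient.exact hs'
  obtain ⟨L₁, hL₁, l₁, l₂⟩ := hM.exists_le hN
  obtain ⟨L, hL, l₃, l₄⟩ := hL₁.exists_le hJ
  refine ⟨L, (l₃.trans l₁).trans m₂, (l₃.trans l₂).trans n₂, hL, fun W f x y hy => ?_⟩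
  rw [← can_can m₂ (l₃.trans l₁), ← em, can_can] at hy
  rw [← can_can n₂ (l₃.trans l₂), ← en, can_can]
  exact H.mono l₄ W f x y hy

/-- The group `Hom_{𝒜(U,X)}(Φ, Φ') = Hom_{p_{U,*} 𝒪_Z}(P(φ), P(φ'))` of morphisms of sheaves of
modules. -/
def homs (Φ Ψ : Corr U X) : AddSubgroup (Family Φ Ψ) where
  carrier := {α | IsNatural α ∧ IsActionLinear α}
  zero_mem' := by
    obtain ⟨t, ht⟩ := Quotient.exists_rep Φ.cls
    obtain ⟨t', ht'⟩ := Quotient.exists_rep Ψ.cls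
    obtain ⟨L, hL, h, h'⟩ := t.isSubSch.exists_le t'.isSubSch
    refine ⟨fun W W' h x y _ => ?_, t, t', L, h, h', ht, ht', hL, fun W f x y _ => ?_⟩
    · ext i; simp [resVec]
    · simp
  add_mem' := by
    rintro α β ⟨hα, t, t', J, h, h', ht, ht', hJ, H⟩ ⟨hβ, s, s', K, g, g', hs, hs', hK, G⟩
    refine ⟨fun W W' h x y e => ?_, ?_⟩
    · have e₁ := hα W W' h x y e
      have e₂ := hβ W W' h x y e
      simp only [Pi.add_apply, LinearMap.add_apply, Submodule.coe_add, resVec_add, e₁, e₂]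
    · obtain ⟨M, m, m', hM, G'⟩ := G.change hK (hs.trans ht.symm) (hs'.trans ht'.symm)
      obtain ⟨L, hL, l, l'⟩ := hJ.exists_le hM
      refine ⟨t, t', L, l.trans h, l.trans h', ht, ht', hL, fun W f x y e => ?_⟩
      have e₁ := H.mono l W f x y e
      have e₂ := G'.mono l' W f x y e
      simp only [Pi.add_apply, LinearMap.add_apply, Submodule.coe_add, e₁, e₂, Matrix.mulVec_add]
  neg_mem' := by
    rintro α ⟨hα, t, t', J, h, h', ht, ht', hJ, H⟩
    refine ⟨fun W W' h x y e => ?_, t, t', J, h, h', ht, ht', hJ, fun W f x y e => ?_⟩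
    · have e₁ := hα W W' h x y e
      simp only [Pi.neg_apply, LinearMap.neg_apply, NegMemClass.coe_neg, resVec_neg, e₁]
    · have e₁ := H W f x y e
      simp only [Pi.neg_apply, LinearMap.neg_apply, NegMemClass.coe_neg, e₁, Matrix.mulVec_neg]

lemma id_mem_homs (Φ : Corr U X) : (fun _ => LinearMap.id : Family Φ Φ) ∈ homs Φ Φ := by
  obtain ⟨t, ht⟩ := Quotient.exists_rep Φ.cls
  exact ⟨fun _ _ _ _ _ e => e, t, t, t.ideal, le_rfl, le_rfl, ht, ht, t.isSubSch,
    fun _ _ _ _ e => e⟩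

lemma comp_mem_homs {Φ Ψ Θ : Corr U X} {α : Family Φ Ψ} {β : Family Ψ Θ}
    (hα : α ∈ homs Φ Ψ) (hβ : β ∈ homs Ψ Θ) :
    (fun W => (β W).comp (α W) : Family Φ Θ) ∈ homs Φ Θ := by
  obtain ⟨hα, t, t', J, h, h', ht, ht', hJ, H⟩ := hα
  obtain ⟨hβ, s, s', K, g, g', hs, hs', hK, G⟩ := hβ
  refine ⟨fun W W' h x y e => hβ _ _ _ _ _ (hα _ _ _ _ _ e), ?_⟩
  obtain ⟨M, m, m', hM, G'⟩ := G.change hK (hs.trans ht'.symm) rfl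
  obtain ⟨L, hL, l, l'⟩ := hJ.exists_le hM
  exact ⟨t, s', L, l.trans h, l'.trans m', ht, hs', hL, fun W f x y e =>
    G'.mono l' W f _ _ (H.mono l W f x y e)⟩

/-- The category `𝒜(U, X)`. -/
instance category (U X : Sm k) : Category (Corr U X) where
  Hom Φ Ψ := homs Φ Ψ
  id Φ := ⟨_, id_mem_homs Φ⟩
  comp α β := ⟨_, comp_mem_homs α.2 β.2⟩

instance preadditive (U X : Sm k) : Preadditive (Corr U X) where
  homGroup Φ Ψ := inferInstanceAs (AddCommGroup (homs Φ Ψ))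
  add_comp _ _ _ α β γ := Subtype.ext <| funext fun W => LinearMap.comp_add (α.1 W) (β.1 W) (γ.1 W)
  comp_add _ _ _ α β γ := Subtype.ext <| funext fun W => LinearMap.add_comp (α.1 W) (γ.1 W) (β.1 W)

/-- The map `P(φ)(W) → P(φ')(W)` given by a morphism. -/
def Hom.app {Φ Ψ : Corr U X} (α : Φ ⟶ Ψ) (W : U.scheme.Opens) :
    Φ.P W →ₗ[Γ(U.scheme, W)] Ψ.P W :=
  Subtype.val α W

/-- The element `p(φ) v` of `P(φ)(W)`. -/
def proj (Φ : Corr U X) (W : U.scheme.Opens) (v : Fin Φ.n → Γ(U.scheme, W)) : Φ.P W :=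
  ⟨(Φ.idem W).mulVec v, v, rfl⟩

/-- The matrix over `Γ(U, 𝒪_U)` of a morphism `α : P(φ) → P(φ')`, more precisely of
`𝒪_U^n → P(φ) → P(φ') ⊆ 𝒪_U^{n'}`: its `j`-th column is `α(p(φ) e_j)`. -/
def Hom.matrix {Φ Ψ : Corr U X} (α : Φ ⟶ Ψ) : Matrix (Fin Ψ.n) (Fin Φ.n) Γ(U.scheme, ⊤) :=
  Matrix.of fun i j => (Hom.app α ⊤ (Φ.proj ⊤ (Pi.single j 1)) : Fin Ψ.n → Γ(U.scheme, ⊤)) i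

end Corr

/-! ### The pairing `𝒜(V, U) × 𝒜(U, X) → 𝒜(V, X)` -/

section Pairing

variable {V U X : Sm k}

/-- `V × U × X`, in the form `(V × U) ×_U (U × X)`. -/
abbrev prod₃ (V U X : Sm k) : Scheme.{u} := pullback (prodSnd V U) (prodFst U X)

/-- The projection `V × U × X ⟶ V × X`. -/
def p₁₃ (V U X : Sm k) : prod₃ V U X ⟶ prodScheme V X :=
  pullback.lift (pullback.fst (prodSnd V U) (prodFst U X) ≫ prodFst V U)
    (pullback.snd (prodSnd V U) (prodFst U X) ≫ prodSnd U X)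
    (by simp only [Category.assoc, ← pullback.condition (f := U.hom) (g := X.hom),
          pullback.condition (f := V.hom) (g := U.hom), pullback.condition_assoc])

/-- `B ∘ A = p_{VX}((V × B) ∩ (A × X))`. -/
def circ (B : Closeds (prodScheme U X)) (A : Closeds (prodScheme V U)) : Set (prodScheme V X) :=
  p₁₃ V U X '' ((pullback.snd (prodSnd V U) (prodFst U X)) ⁻¹' (B : Set (prodScheme U X)) ∩
    (pullback.fst (prodSnd V U) (prodFst U X)) ⁻¹' (A : Set (prodScheme V U)))

/-- `Z₁ ×_U Z₂` for closed subschemes `Z₁ ⊆ V × U`, `Z₂ ⊆ U × X`. -/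
abbrev fib (I₁ : IdealSheafData (prodScheme V U)) (I₂ : IdealSheafData (prodScheme U X)) : Scheme.{u} :=
  pullback (tgt I₁) (src I₂)

/-- The projection `Z₁ ×_U Z₂ ⟶ Z₁`. -/
abbrev fibFst (I₁ : IdealSheafData (prodScheme V U)) (I₂ : IdealSheafData (prodScheme U X)) :
    fib I₁ I₂ ⟶ I₁.subscheme := pullback.fst (tgt I₁) (src I₂)

/-- The projection `Z₁ ×_U Z₂ ⟶ Z₂`. -/
abbrev fibSnd (I₁ : IdealSheafData (prodScheme V U)) (I₂ : IdealSheafData (prodScheme U X)) :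
    fib I₁ I₂ ⟶ I₂.subscheme := pullback.snd (tgt I₁) (src I₂)

lemma fib_le (I₁ : IdealSheafData (prodScheme V U)) (I₂ : IdealSheafData (prodScheme U X))
    {U' : U.scheme.Opens} {Z' : I₁.subscheme.Opens} (h : Z' ≤ tgt I₁ ⁻¹ᵁ U') :
    fibFst I₁ I₂ ⁻¹ᵁ Z' ≤ fibSnd I₁ I₂ ⁻¹ᵁ (src I₂ ⁻¹ᵁ U') := by
  rw [← Scheme.Hom.comp_preimage, ← pullback.condition, Scheme.Hom.comp_preimage]
  exact Scheme.Hom.preimage_mono _ h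

/-- `ψ` is the base change `φ_{2,Z₁} : p_{Z₁,*} 𝒪_{Z₁ ×_U Z₂} → M_{n₂}(𝒪_{Z₁})` of `φ₂`: for
affine opens `U' ⊆ U` and `Z₁' ⊆ Z₁` with `r(Z₁') ⊆ U'` (where `r : Z₁ ⟶ U`) it is given by
`a ⊗ b ↦ a · r^*(φ₂(b))`. -/
def IsBaseChange (I₁ : IdealSheafData (prodScheme V U)) {n₂ : ℕ} (t₂ : Triple U X n₂)
    (ψ : MatHom (fibFst I₁ t₂.ideal) n₂) : Prop :=
  ∀ (U' : U.scheme.Opens) (Z' : I₁.subscheme.Opens) (_ : IsAffineOpen U') (_ : IsAffineOpen Z')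
    (h : Z' ≤ tgt I₁ ⁻¹ᵁ U') (a : Γ(I₁.subscheme, Z'))
    (b : Γ(t₂.ideal.subscheme, src t₂.ideal ⁻¹ᵁ U')),
    ψ.app Z' (((fibFst I₁ t₂.ideal).app Z').hom a *
        ((fibSnd I₁ t₂.ideal).appLE _ _ (fib_le I₁ t₂.ideal h)).hom b) =
      a • (t₂.hom.app U' b).map ((tgt I₁).appLE U' Z' h).hom

/-- The isomorphism `L : M_{n₂}(M_{n₁}(R)) ≃ M_{n₂ n₁}(R)`, inserting the `(n₁, n₁)`-matrices as
blocks into the `(n₂, n₂)`-matrix: row (and column) `i` of block `j` becomes row `i + n₁ j`. -/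
def blockMatrix {R : Type v} {n₂ n₁ : ℕ}
    (M : Matrix (Fin n₂) (Fin n₂) (Matrix (Fin n₁) (Fin n₁) R)) :
    Matrix (Fin (n₂ * n₁)) (Fin (n₂ * n₁)) R :=
  Matrix.reindex finProdFinEquiv finProdFinEquiv (Matrix.comp _ _ _ _ R M)

/-- `t₃` is a composite of `t₁ = (n₁, Z₁, φ₁)` and `t₂ = (n₂, Z₂, φ₂)`, that is, a triple
`(n₂ n₁, Z₂ ∘ Z₁, φ₂ ∘ φ₁)`: the ideal of `Z₂ ∘ Z₁` is a power of the ideal of the closed set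
`Z₂^red ∘ Z₁^red`, the morphism `Z₁ ×_U Z₂ ⟶ V × X` factors as
`π : Z₁ ×_U Z₂ ⟶ Z₂ ∘ Z₁` through it, and `(φ₂ ∘ φ₁)(f) = L(M_{n₂}(φ₁)(φ_{2,Z₁}(π^* f)))`. -/
def IsComposite {n₁ n₂ : ℕ} (t₁ : Triple V U n₁) (t₂ : Triple U X n₂)
    (t₃ : Triple V X (n₂ * n₁)) : Prop :=
  (∃ (C : Closeds (prodScheme V X)) (m : ℕ),
    (C : Set (prodScheme V X)) = circ t₂.ideal.support t₁.ideal.support ∧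
    t₃.ideal = IdealSheafData.vanishingIdeal C ^ m) ∧
  ∃ (π : fib t₁.ideal t₂.ideal ⟶ t₃.ideal.subscheme)
    (hV : π ≫ src t₃.ideal = fibFst t₁.ideal t₂.ideal ≫ src t₁.ideal)
    (_ : π ≫ tgt t₃.ideal = fibSnd t₁.ideal t₂.ideal ≫ tgt t₂.ideal)
    (ψ : MatHom (fibFst t₁.ideal t₂.ideal) n₂),
    IsBaseChange t₁.ideal t₂ ψ ∧
    ∀ (W : V.scheme.Opens) (f : Γ(t₃.ideal.subscheme, src t₃.ideal ⁻¹ᵁ W)),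
      t₃.hom.app W f =
        blockMatrix ((ψ.app (src t₁.ideal ⁻¹ᵁ W) (pullSec π hV W f)).map (t₁.hom.app W))

/-- Pullback of functions along `r : Z₁ ⟶ U`, from global functions on `U` to functions on `Z₁`
over `W ⊆ V`. -/
def rPull (I : IdealSheafData (prodScheme V U)) (W : V.scheme.Opens) :
    Γ(U.scheme, ⊤) →+* Γ(I.subscheme, src I ⁻¹ᵁ W) :=
  ((tgt I).appLE ⊤ (src I ⁻¹ᵁ W) le_top).hom

/-- Sections over `W ⊆ V` of `p_{V,*} P(φ_{2,Z₁})`, the image of the idempotent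
`p(φ_{2,Z₁}) = r^* p(φ₂)` in `p_{V,*} 𝒪_{Z₁}^{n₂}`. -/
def pulledP (I : IdealSheafData (prodScheme V U)) (Φ₂ : Corr U X) (W : V.scheme.Opens) :
    Submodule Γ(I.subscheme, src I ⁻¹ᵁ W) (Fin Φ₂.n → Γ(I.subscheme, src I ⁻¹ᵁ W)) :=
  LinearMap.range ((Φ₂.idem ⊤).map (rPull I W)).mulVecLin

/-- The map `P(φ_{2,Z₁}) → P(φ'_{2,Z₁})` induced by `α₂ : P(φ₂) → P(φ₂')`. -/
def pulledHom (I : IdealSheafData (prodScheme V U)) {Φ₂ Φ₂' : Corr U X} (α₂ : Φ₂ ⟶ Φ₂')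
    (W : V.scheme.Opens) (m₂ : Fin Φ₂.n → Γ(I.subscheme, src I ⁻¹ᵁ W)) :
    Fin Φ₂'.n → Γ(I.subscheme, src I ⁻¹ᵁ W) :=
  ((Corr.Hom.matrix α₂).map (rPull I W)).mulVec m₂

/-- The map `σ₁₂ : p_{V,*} P(φ_{2,Z₁}) ⊗ P(φ₁) → P(φ₂ ∘ φ₁)` evaluated at `m₂ ⊗ m₁`. Here
`(m₂, m₁) ↦ (φ₁(m₂_j) m₁)_j` is a vector in `(𝒪_V^{n₁})^{n₂}`, it is moved to `𝒪_V^{n₂ n₁}` by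
`e_{i,j} ↦ e_{i + n₁ j}`, and `p(φ₂ ∘ φ₁)` is applied. -/
def sigma {Φ₁ : Corr V U} {Φ₂ : Corr U X} (Φ₁₂ : Corr V X) (hn : Φ₁₂.n = Φ₂.n * Φ₁.n)
    (t₁ : Triple V U Φ₁.n) (W : V.scheme.Opens)
    (m₂ : Fin Φ₂.n → Γ(t₁.ideal.subscheme, src t₁.ideal ⁻¹ᵁ W)) (m₁ : Φ₁.P W) : Φ₁₂.P W :=
  Φ₁₂.proj W fun l =>
    let ji := finProdFinEquiv.symm (Fin.cast hn l)
    (t₁.hom.app W (m₂ ji.1)).mulVec m₁ ji.2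

/-- `F` is the pairing `𝒜(V, U) × 𝒜(U, X) ⥤ 𝒜(V, X)`. On objects it sends the classes of
`(n₁, Z₁, φ₁)` and `(n₂, Z₂, φ₂)` to the class of `(n₂ n₁, Z₂ ∘ Z₁, φ₂ ∘ φ₁)`, which exists. On
morphisms `α₁ : Φ₁ ⟶ Φ₁'`, `α₂ : Φ₂ ⟶ Φ₂'` it is `σ₁₂' ∘ (α₂ ⊗ α₁) ∘ σ₁₂⁻¹`, that is, the morphism
`α₂ ⊙ α₁` with `(α₂ ⊙ α₁)(σ₁₂(m₂ ⊗ m₁)) = σ₁₂'(α₂(m₂) ⊗ α₁(m₁))`, where `Φ₁` and `Φ₁'` are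
represented with a common support `Z₁` (with ideal sheaf `J`). -/
structure IsPairing (F : Corr V U × Corr U X ⥤ Corr V X) : Prop where
  exists_composite : ∀ {n₁ n₂ : ℕ} (t₁ : Triple V U n₁) (t₂ : Triple U X n₂),
    ∃ t₃ : Triple V X (n₂ * n₁), IsComposite t₁ t₂ t₃
  obj_eq : ∀ {n₁ n₂ : ℕ} (t₁ : Triple V U n₁) (t₂ : Triple U X n₂) (t₃ : Triple V X (n₂ * n₁)),
    IsComposite t₁ t₂ t₃ → F.obj (t₁.toCorr, t₂.toCorr) = t₃.toCorr
  n_eq : ∀ (Φ₁ : Corr V U) (Φ₂ : Corr U X), (F.obj (Φ₁, Φ₂)).n = Φ₂.n * Φ₁.n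
  map_sigma : ∀ {Φ₁ Φ₁' : Corr V U} {Φ₂ Φ₂' : Corr U X} (α₁ : Φ₁ ⟶ Φ₁') (α₂ : Φ₂ ⟶ Φ₂')
    (J : IdealSheafData (prodScheme V U)) (hJ : IsSubSch J)
    (φ₁ : MatHom (src J) Φ₁.n) (φ₁' : MatHom (src J) Φ₁'.n),
    Quotient.mk _ ⟨J, hJ, φ₁⟩ = Φ₁.cls → Quotient.mk _ ⟨J, hJ, φ₁'⟩ = Φ₁'.cls →
    ∀ (W : V.scheme.Opens), ∀ m₂ ∈ pulledP J Φ₂ W, ∀ m₁ : Φ₁.P W,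
      Corr.Hom.app (F.map (X := (Φ₁, Φ₂)) (Y := (Φ₁', Φ₂')) (α₁ ×ₘ α₂)) W
          (sigma (F.obj (Φ₁, Φ₂)) (n_eq Φ₁ Φ₂) ⟨J, hJ, φ₁⟩ W m₂ m₁) =
        sigma (F.obj (Φ₁', Φ₂')) (n_eq Φ₁' Φ₂') ⟨J, hJ, φ₁'⟩ W
          (pulledHom J α₂ W m₂) (Corr.Hom.app α₁ W m₁)

/-- `Φ` is the object `id_X = (1, Δ_X, id : 𝒪_X → 𝒪_X)` of `𝒜(X, X)`. The closed subscheme is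
`Δ_X` since it is identified by `δ` with `X`, with both projections to `X` being the identity. -/
def IsIdentity (Φ : Corr X X) : Prop :=
  ∃ (t : Triple X X 1) (δ : X.scheme ⟶ t.ideal.subscheme) (hδ : δ ≫ src t.ideal = 𝟙 X.scheme),
    IsIso δ ∧ δ ≫ tgt t.ideal = 𝟙 X.scheme ∧
    (∀ (W : X.scheme.Opens) (f : Γ(t.ideal.subscheme, src t.ideal ⁻¹ᵁ W)),
      t.hom.app W f = Matrix.of fun _ _ => pullSec δ hδ W f) ∧
    Φ = t.toCorr

end Pairing
end Correspondences

/-! ### Categories enriched in additive categories -/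

/-- The structure of a (strict) category enriched in additive categories, with objects `C` and
prescribed categories of morphisms `H a b`: all `H a b` are additive, composition consists of
bilinear functors, is strictly associative (equality of functors), and strictly unital. -/
structure AdditiveEnrichment (C : Type u) (H : C → C → Type v)
    [∀ a b, Category.{w} (H a b)] [∀ a b, Preadditive (H a b)] where
  comp (a b c : C) : H a b × H b c ⥤ H a c
  id (a : C) : H a a
  hasFiniteBiproducts (a b : C) : HasFiniteBiproducts (H a b)
  additive_left (a b c : C) (Φ : H b c) : (Prod.sectL (H a b) Φ ⋙ comp a b c).Additive
  additive_right (a b c : C) (Φ : H a b) : (Prod.sectR Φ (H b c) ⋙ comp a b c).Additive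
  assoc (a b c d : C) :
    prod.inverseAssociator (H a b) (H b c) (H c d) ⋙
        (comp a b c).prod (𝟭 (H c d)) ⋙ comp a c d =
      (𝟭 (H a b)).prod (comp b c d) ⋙ comp a b d
  id_comp (a b : C) : Prod.sectR (id a) (H a b) ⋙ comp a a b = 𝟭 (H a b)
  comp_id (a b : C) : Prod.sectL (H a b) (id b) ⋙ comp a b b = 𝟭 (H a b)

end KMotive

end

/-! Geometry. The substantial point is that `circ` preserves `Supp`. For elementary A ⊆ V × U and B
⊆ U × X with reduced structures, A ×_U B is finite over V. Each of its irreducible components must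
surject onto A, so that its image in V is again a component. This holds because generalizations lift
along every base change of B ⟶ U (`UnivGen`): locally U is étale over an affine space, over which B
becomes quasi-finite and dominant; Zariski's main theorem reduces to an integral extension of a
polynomial ring; and going-down over a normal domain survives arbitrary base change, since every
algebra is a quotient of a polynomial ring (`hasGoingDown_tensorProduct`, `IsElementary.univGen`,
`IsElementary.circ`). Noetherianity then supplies the exponent m (`exists_pow_le_ker`).

Objects. The base change of φ₂ is given by tensor products on affine opens and glued
(`exists_compat`). A class is determined by any homomorphism χ : p_* 𝒪_Y → M_n(𝒪_U) through which φ
factors, where Y is a scheme over U × X and need not be a closed subscheme (`Rep`, `Rep.unique`).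
Since composites can be computed from such χ (`IsComposite.rep`), independence of representatives,
associativity and the unit laws for objects are comparisons of homomorphisms on one fibre product.
Strict associativity also needs the two nested numberings of triples of indices to agree
(`cast_finProdFinEquiv`).

Morphisms. As P(φ) is a direct summand of 𝒪_U^n, a morphism is a matrix of global functions that
absorbs the two idempotents and commutes with the actions (`Corr.Hom.app_eq`, `Corr.Hom.lin`,
`Corr.homOf`). For α₁ with matrix M and α₂ with matrix (a_ij), the composite has blocks φ₁'(r^*
a_ij) M (`compMat`). Only the ring homomorphism c ↦ φ(r^* c) on global functions, `Corr.act`,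
enters, so functoriality, bilinearity, associativity and units reduce to matrix algebra. The pairing
is unique because the generators p(φ₂ ∘ φ₁) e_l lie in the image of σ₁₂ (`proj_eq_sigma`). -/

noncomputable section

namespace KMotive

open Scheme (IdealSheafData)
open scoped CategoryTheory.Prod

/-! ### Pullback and restriction of functions -/

section Functions

variable {X Y Z : Scheme.{u}}

/-- Restriction of functions to a smaller open subset. -/
def res {W W' : X.Opens} (h : W' ≤ W) : Γ(X, W) →+* Γ(X, W') :=
  (X.presheaf.map (homOfLE h).op).hom

/-- Pullback of functions along a morphism. -/
def pb (a : Y ⟶ X) {W : X.Opens} {W' : Y.Opens} (h : W' ≤ a ⁻¹ᵁ W) : Γ(X, W) →+* Γ(Y, W') :=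
  (a.appLE W W' h).hom

lemma res_res {W W' W'' : X.Opens} (h : W' ≤ W) (h' : W'' ≤ W') (x : Γ(X, W)) :
    res h' (res h x) = res (h'.trans h) x := by
  simp only [res, ← CommRingCat.comp_apply, ← Functor.map_comp]
  rfl

@[simp]
lemma res_self {W : X.Opens} (h : W ≤ W) (x : Γ(X, W)) : res h x = x := by
  simp [res]

lemma pb_pb (a : Y ⟶ X) (b : Z ⟶ Y) {W : X.Opens} {W' : Y.Opens} {W'' : Z.Opens}
    (h : W' ≤ a ⁻¹ᵁ W) (h' : W'' ≤ b ⁻¹ᵁ W') (x : Γ(X, W)) :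
    pb b h' (pb a h x) = pb (b ≫ a) (h'.trans (b.preimage_mono h)) x := by
  simp only [pb, ← CommRingCat.comp_apply, Scheme.Hom.appLE_comp_appLE]

lemma res_pb (a : Y ⟶ X) {W : X.Opens} {W' W'' : Y.Opens} (h : W' ≤ a ⁻¹ᵁ W) (h' : W'' ≤ W')
    (x : Γ(X, W)) : res h' (pb a h x) = pb a (h'.trans h) x := by
  simp only [pb, res, ← CommRingCat.comp_apply, Scheme.Hom.appLE_map]

lemma pb_res (a : Y ⟶ X) {V W : X.Opens} {W' : Y.Opens} (h : W' ≤ a ⁻¹ᵁ W) (h' : W ≤ V)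
    (x : Γ(X, V)) : pb a h (res h' x) = pb a (h.trans (a.preimage_mono h')) x := by
  simp only [pb, res, ← CommRingCat.comp_apply, Scheme.Hom.map_appLE]

lemma pb_congr {a b : Y ⟶ X} (e : a = b) {W : X.Opens} {W' : Y.Opens} (h : W' ≤ a ⁻¹ᵁ W)
    (x : Γ(X, W)) : pb a h x = pb b (e ▸ h) x := by
  subst e; rfl

lemma pb_id {W W' : X.Opens} (h : W' ≤ (𝟙 X) ⁻¹ᵁ W) (x : Γ(X, W)) :
    pb (𝟙 X) h x = res (show W' ≤ W from h) x := by
  simp only [pb, res, Scheme.Hom.appLE]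
  congr 2

lemma app_eq_pb (a : Y ⟶ X) (W : X.Opens) (x : Γ(X, W)) :
    (a.app W).hom x = pb a le_rfl x := by
  rw [pb, Scheme.Hom.app_eq_appLE]

/-- Functions that agree locally are equal. -/
lemma eq_of_res {W : X.Opens} (f g : Γ(X, W))
    (H : ∀ x ∈ W, ∃ (V : X.Opens) (h : V ≤ W), x ∈ V ∧ res h f = res h g) : f = g := by
  apply X.IsSheaf.section_ext
  intro x hx
  obtain ⟨V, h, hV, e⟩ := H x hx
  exact ⟨V, h, hV, e⟩

/-- Gluing of matrices of functions. -/
lemma exists_glue_matrix {ι : Type*} {α β : Type*} (W : X.Opens) (V : ι → X.Opens)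
    (hV : ∀ i, V i ≤ W) (hW : ∀ x ∈ W, ∃ i, x ∈ V i) (s : ∀ i, Matrix α β Γ(X, V i))
    (H : ∀ i j, (s i).map (res (inf_le_left : V i ⊓ V j ≤ V i)) =
      (s j).map (res (inf_le_right : V i ⊓ V j ≤ V j))) :
    ∃ t : Matrix α β Γ(X, W), ∀ i, t.map (res (hV i)) = s i := by
  have key : ∀ a b, ∃ t : Γ(X, W), ∀ i, res (hV i) t = s i a b := by
    intro a b
    obtain ⟨t, ht, -⟩ := X.sheaf.existsUnique_gluing' V W (fun i => homOfLE (hV i))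
      (fun x hx => by simpa using hW x hx) (fun i => s i a b)
      (fun i j => congr_fun (congr_fun (H i j) a) b)
    exact ⟨t, ht⟩
  choose t ht using key
  exact ⟨Matrix.of t, fun i => by ext a b; exact ht a b i⟩

lemma matrix_eq_of_res {α β : Type*} {W : X.Opens} (f g : Matrix α β Γ(X, W))
    (H : ∀ x ∈ W, ∃ (V : X.Opens) (h : V ≤ W), x ∈ V ∧ f.map (res h) = g.map (res h)) : f = g := by
  ext a b
  refine eq_of_res _ _ fun x hx => ?_
  obtain ⟨V, h, hV, e⟩ := H x hx
  exact ⟨V, h, hV, congr_fun (congr_fun e a) b⟩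

end Functions

/-! ### Blocks -/

section Block

variable {R S : Type*} {a b c d e f : ℕ}

/-- The matrix with the given blocks. -/
def blockRect (M : Matrix (Fin a) (Fin b) (Matrix (Fin c) (Fin d) R)) :
    Matrix (Fin (a * c)) (Fin (b * d)) R :=
  Matrix.of fun i j => M (finProdFinEquiv.symm i).1 (finProdFinEquiv.symm j).1
    (finProdFinEquiv.symm i).2 (finProdFinEquiv.symm j).2

lemma blockMatrix_eq (M : Matrix (Fin a) (Fin a) (Matrix (Fin c) (Fin c) R)) :
    blockMatrix M = blockRect M := rfl

@[simp]
lemma blockRect_apply (M : Matrix (Fin a) (Fin b) (Matrix (Fin c) (Fin d) R)) (i : Fin a)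
    (j : Fin b) (k : Fin c) (l : Fin d) :
    blockRect M (finProdFinEquiv (i, k)) (finProdFinEquiv (j, l)) = M i j k l := by
  simp [blockRect, -finProdFinEquiv_symm_apply]

lemma blockRect_ext {M N : Matrix (Fin (a * c)) (Fin (b * d)) R}
    (H : ∀ i j k l, M (finProdFinEquiv (i, k)) (finProdFinEquiv (j, l)) =
      N (finProdFinEquiv (i, k)) (finProdFinEquiv (j, l))) : M = N := by
  ext x y
  obtain ⟨⟨i, k⟩, rfl⟩ := finProdFinEquiv.surjective x
  obtain ⟨⟨j, l⟩, rfl⟩ := finProdFinEquiv.surjective y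
  exact H i j k l

lemma blockRect_map (M : Matrix (Fin a) (Fin b) (Matrix (Fin c) (Fin d) R)) (g : R → S) :
    (blockRect M).map g = blockRect (M.map fun N => N.map g) := rfl

lemma blockRect_add [Add R] (M N : Matrix (Fin a) (Fin b) (Matrix (Fin c) (Fin d) R)) :
    blockRect (M + N) = blockRect M + blockRect N := rfl

/-- Multiplication of block matrices with given rectangular blocks. -/
lemma blockRect_mul_of [NonUnitalSemiring R] (M : Matrix (Fin a) (Fin b) (Matrix (Fin c) (Fin d) R))
    (N : Matrix (Fin b) (Fin e) (Matrix (Fin d) (Fin f) R)) :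
    blockRect M * blockRect N = blockRect (Matrix.of fun i k => ∑ j, M i j * N j k) := by
  refine blockRect_ext fun i j k l => ?_
  simp [Matrix.mul_apply, Matrix.sum_apply, ← finProdFinEquiv.sum_comp, Fintype.sum_prod_type]

lemma blockRect_mul [NonUnitalSemiring R]
    (M : Matrix (Fin a) (Fin b) (Matrix (Fin c) (Fin c) R))
    (N : Matrix (Fin b) (Fin e) (Matrix (Fin c) (Fin c) R)) :
    blockRect M * blockRect N = blockRect (M * N) :=
  blockRect_mul_of M N

end Block

/-! ### Base change of matrix homomorphisms: affine case -/

section Tensor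

variable {R A B P : CommRingCat.{u}} {f : R ⟶ A} {g : R ⟶ B} {i : A ⟶ P} {j : B ⟶ P}

lemma exists_tensor_equiv (h : IsPushout f g i j) :
    letI := f.hom.toAlgebra
    letI := g.hom.toAlgebra
    ∃ e : TensorProduct R A B ≃+* P, ∀ a b, e (a ⊗ₜ b) = i a * j b := by
  algebraize [f.hom, g.hom]
  have H : IsPushout f g _ _ := CommRingCat.isPushout_tensorProduct R A B
  let e := (H.isoPushout ≪≫ h.isoPushout.symm).commRingCatIsoToRingEquiv
  refine ⟨e, fun a b => ?_⟩
  have h₁ : e (a ⊗ₜ 1) = i a :=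
    congr_fun (congr_arg (fun t : A ⟶ P => (t : A → P))
      (show CommRingCat.ofHom Algebra.TensorProduct.includeLeftRingHom ≫
        (H.isoPushout ≪≫ h.isoPushout.symm).hom = i by simp)) a
  have h₂ : e (1 ⊗ₜ b) = j b :=
    congr_fun (congr_arg (fun t : B ⟶ P => (t : B → P))
      (show CommRingCat.ofHom Algebra.TensorProduct.includeRight.toRingHom ≫
        (H.isoPushout ≪≫ h.isoPushout.symm).hom = j by simp)) b
  rw [← h₁, ← h₂, ← map_mul]
  simp

/-- The pushout is A ⊗_R B, so each element is a sum of pure tensors. This replaces tensor induction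
when the rings are rings of functions known only to form a pushout. -/
lemma pushout_induction (h : IsPushout f g i j) {C : P → Prop} (mul : ∀ a b, C (i a * j b))
    (add : ∀ x y, C x → C y → C (x + y)) (x : P) : C x := by
  algebraize [f.hom, g.hom]
  obtain ⟨e, he⟩ := exists_tensor_equiv h
  obtain ⟨t, rfl⟩ := e.surjective x
  induction t with
  | zero => simpa using mul 0 0
  | tmul a b => rw [he]; exact mul a b
  | add x y hx hy => rw [map_add]; exact add _ _ hx hy

/-- The R-linear map b ↦ f(φ b) extends A-linearly to A ⊗_R B. The extension is multiplicative
because it is so on pure tensors, where scalars from the commutative ring A move past matrices. -/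
lemma exists_matrix_baseChange (h : IsPushout f g i j) {n : Type*} [Fintype n]
    (φ : B →ₙ+* Matrix n n R) (hφ : ∀ r b, φ (g r * b) = r • φ b) :
    ∃ ψ : P →ₙ+* Matrix n n A, ∀ a b, ψ (i a * j b) = a • (φ b).map f := by
  algebraize [f.hom, g.hom]
  obtain ⟨e, he⟩ := exists_tensor_equiv h
  let l : B →ₗ[R] Matrix n n A :=
    { toFun := fun b => (φ b).map f
      map_add' := fun x y => by ext; simp
      map_smul' := fun r x => by
        ext a b
        change f (φ (g r * x) a b) = f r * f (φ x a b)
        rw [hφ, Matrix.smul_apply, smul_eq_mul, map_mul] }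
  let L := l.liftBaseChange A
  have hL : ∀ a b, L (a ⊗ₜ b) = a • (φ b).map f := fun a b => by
    simp [L, l]
  have hmul : ∀ x y, L (x * y) = L x * L y := by
    intro x y
    induction x with
    | zero => simp
    | add x₁ x₂ h₁ h₂ => rw [add_mul, map_add, h₁, h₂, map_add, add_mul]
    | tmul a b =>
      induction y with
      | zero => simp
      | add x₁ x₂ h₁ h₂ => rw [mul_add, map_add, h₁, h₂, map_add, mul_add]
      | tmul c d =>
        rw [Algebra.TensorProduct.tmul_mul_tmul, hL, hL, hL, map_mul]
        have : (φ b * φ d).map f = (φ b).map f * (φ d).map f :=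
          Matrix.map_mul (f := f.hom)
        rw [this, Matrix.smul_mul, Matrix.mul_smul, smul_smul]
  refine ⟨⟨⟨fun x => L (e.symm x), fun x y => ?_⟩, ?_, fun x y => ?_⟩, fun a b => ?_⟩
  · rw [map_mul, hmul]
  · simp
  · simp
  · change L (e.symm _) = _
    rw [← he, e.symm_apply_apply, hL]

end Tensor

/-! ### Matrix homomorphisms -/

namespace MatHom

variable {Z Y U : Scheme.{u}} {p : Z ⟶ U} {n m : ℕ}

lemma app_pb_mul (φ : MatHom p n) (W : U.Opens) (a : Γ(U, W)) (f : Γ(Z, p ⁻¹ᵁ W)) :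
    φ.app W (pb p le_rfl a * f) = a • φ.app W f := by
  rw [← φ.map_smul, app_eq_pb]

lemma app_res (φ : MatHom p n) {W W' : U.Opens} (h : W' ≤ W) (f : Γ(Z, p ⁻¹ᵁ W)) :
    φ.app W' (res (p.preimage_mono h) f) = (φ.app W f).map (res h) :=
  φ.naturality h f

lemma ext_app {φ ψ : MatHom p n} (h : ∀ W f, φ.app W f = ψ.app W f) : φ = ψ := by
  ext W f
  rw [h]

/-- A homomorphism of sheaves of algebras from its values. -/
def mk' (p : Z ⟶ U) (n : ℕ) (F : ∀ W : U.Opens, Γ(Z, p ⁻¹ᵁ W) → Matrix (Fin n) (Fin n) Γ(U, W))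
    (add : ∀ W f g, F W (f + g) = F W f + F W g) (mul : ∀ W f g, F W (f * g) = F W f * F W g)
    (smul : ∀ W a f, F W (pb p le_rfl a * f) = a • F W f)
    (nat : ∀ (W W' : U.Opens) (h : W' ≤ W) (f : Γ(Z, p ⁻¹ᵁ W)),
      F W' (res (p.preimage_mono h) f) = (F W f).map (res h)) : MatHom p n where
  app W :=
    { toFun := F W
      map_mul' := mul W
      map_zero' := by simpa using add W 0 0
      map_add' := add W }
  map_smul W a f := by
    change F W _ = _ • F W _
    rw [app_eq_pb, smul]
  naturality h f := nat _ _ h f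

/-- Composition of `p_* 𝒪_Z → q_* 𝒪_Y` with a matrix homomorphism. -/
def comap {q : Y ⟶ U} (χ : MatHom q n) (g : Y ⟶ Z) (w : g ≫ p = q) : MatHom p n :=
  mk' p n (fun W f => χ.app W (pullSec g w W f)) (fun W f g => by rw [map_add, map_add])
    (fun W f g => by rw [map_mul, map_mul])
    (fun W a f => by
      rw [map_mul, ← app_pb_mul]
      congr 2
      change pb g _ (pb p _ a) = _
      rw [pb_pb, pb_congr w])
    (fun W W' h f => by
      rw [← app_res]
      congr 1
      change pb g _ (res _ f) = res _ (pb g _ f)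
      rw [pb_res, res_pb])

lemma comap_app {q : Y ⟶ U} (χ : MatHom q n) (g : Y ⟶ Z) (w : g ≫ p = q) (W : U.Opens)
    (f : Γ(Z, p ⁻¹ᵁ W)) : (χ.comap g w).app W f = χ.app W (pullSec g w W f) := rfl

lemma comap_app' {q : Y ⟶ U} (χ : MatHom q n) (g : Y ⟶ Z) (w : g ≫ p = q) (W : U.Opens)
    (f : Γ(Z, p ⁻¹ᵁ W)) :
    (χ.comap g w).app W f = χ.app W (pb g (by subst w; exact le_rfl) f) := rfl

lemma comap_comap {X : Scheme.{u}} {q : Y ⟶ U} {r : X ⟶ U} (χ : MatHom r n) (g : Y ⟶ Z)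
    (w : g ≫ p = q) (g' : X ⟶ Y) (w' : g' ≫ q = r) :
    (χ.comap g' w').comap g w = χ.comap (g' ≫ g) (by rw [Category.assoc, w, w']) := by
  refine ext_app fun W f => ?_
  simp only [comap_app', pb_pb]

section Star

variable {V : Scheme.{u}} {q : Y ⟶ Z} {p : Z ⟶ V} (ψ : MatHom q m) (φ : MatHom p n)

/-- The values of `L ∘ M(φ) ∘ ψ`. -/
def starFun (W : V.Opens) (f : Γ(Y, q ⁻¹ᵁ p ⁻¹ᵁ W)) : Matrix (Fin (m * n)) (Fin (m * n)) Γ(V, W) :=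
  blockRect ((ψ.app (p ⁻¹ᵁ W) f).map (φ.app W))

lemma starFun_add (W : V.Opens) (f g : Γ(Y, q ⁻¹ᵁ p ⁻¹ᵁ W)) :
    starFun ψ φ W (f + g) = starFun ψ φ W f + starFun ψ φ W g := by
  simp only [starFun]
  rw [map_add, ← blockRect_add]
  congr 1
  ext; simp

lemma starFun_mul (W : V.Opens) (f g : Γ(Y, q ⁻¹ᵁ p ⁻¹ᵁ W)) :
    starFun ψ φ W (f * g) = starFun ψ φ W f * starFun ψ φ W g := by
  simp only [starFun]
  rw [map_mul, blockRect_mul]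
  congr 1
  exact Matrix.map_mul

lemma starFun_smul (W : V.Opens) (a : Γ(V, W)) (f : Γ(Y, q ⁻¹ᵁ p ⁻¹ᵁ W)) :
    starFun ψ φ W (pb q le_rfl (pb p le_rfl a) * f) = a • starFun ψ φ W f := by
  simp only [starFun]
  rw [app_pb_mul]
  ext i j
  simp only [blockRect, Matrix.of_apply, Matrix.map_apply, Matrix.smul_apply, smul_eq_mul,
    app_pb_mul]

lemma starFun_res {W W' : V.Opens} (h : W' ≤ W) (f : Γ(Y, q ⁻¹ᵁ p ⁻¹ᵁ W)) :
    starFun ψ φ W' (res (q.preimage_mono (p.preimage_mono h)) f) =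
      (starFun ψ φ W f).map (res h) := by
  simp only [starFun]
  rw [blockRect_map, app_res]
  congr 1
  ext i j k l
  exact congr_fun (congr_fun (app_res φ h _) k) l

/-- The composite `L ∘ M(φ) ∘ ψ` of matrix homomorphisms. -/
def star : MatHom (q ≫ p) (m * n) :=
  mk' _ _ (starFun ψ φ) (starFun_add ψ φ) (starFun_mul ψ φ)
    (fun W a f => by
      rw [show pb (q ≫ p) le_rfl a = pb q (W := p ⁻¹ᵁ W) le_rfl (pb p le_rfl a) from
        (pb_pb p q le_rfl le_rfl a).symm]
      exact starFun_smul ψ φ W a f)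
    (fun W W' h f => starFun_res ψ φ h f)

end Star

lemma star_app {V : Scheme.{u}} {q : Y ⟶ Z} {p : Z ⟶ V} (ψ : MatHom q m) (φ : MatHom p n)
    (W : V.Opens) (f : Γ(Y, (q ≫ p) ⁻¹ᵁ W)) :
    (ψ.star φ).app W f = blockMatrix ((ψ.app (p ⁻¹ᵁ W) f).map (φ.app W)) := rfl

/-- Change of the index of the size. -/
def cast (φ : MatHom p n) (h : n = m) : MatHom p m := h ▸ φ

lemma cast_app (φ : MatHom p n) (h : n = m) (W : U.Opens) (f : Γ(Z, p ⁻¹ᵁ W)) (i j : Fin m) :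
    (φ.cast h).app W f i j = φ.app W f (Fin.cast h.symm i) (Fin.cast h.symm j) := by
  subst h; rfl

end MatHom

/-! ### Base change of matrix homomorphisms -/

section BaseChange

variable {Y T Z U : Scheme.{u}} {q : Y ⟶ T} {p : Z ⟶ U} {a : Y ⟶ Z} {g : T ⟶ U} {n : ℕ}

lemma preimage_le_of_comm (w : q ≫ g = a ≫ p) {W : U.Opens} {T' : T.Opens} (h : T' ≤ g ⁻¹ᵁ W) :
    q ⁻¹ᵁ T' ≤ a ⁻¹ᵁ (p ⁻¹ᵁ W) := by
  rw [← Scheme.Hom.comp_preimage, ← w, Scheme.Hom.comp_preimage]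
  exact Scheme.Hom.preimage_mono _ h

/-- `ψ` is compatible with `φ` along a commutative square. -/
def Compat (w : q ≫ g = a ≫ p) (φ : MatHom p n) (ψ : MatHom q n) : Prop :=
  ∀ (W : U.Opens) (T' : T.Opens) (h : T' ≤ g ⁻¹ᵁ W) (b : Γ(Z, p ⁻¹ᵁ W)),
    ψ.app T' (pb a (preimage_le_of_comm w h) b) = (φ.app W b).map (pb g h)

lemma Compat.comp {Y' T' : Scheme.{u}} {q' : Y' ⟶ T'} {a' : Y' ⟶ Y} {g' : T' ⟶ T}
    {w : q ≫ g = a ≫ p} {w' : q' ≫ g' = a' ≫ q} {φ : MatHom p n} {ψ : MatHom q n}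
    {χ : MatHom q' n} (h : Compat w φ ψ) (h' : Compat w' ψ χ) :
    Compat (a := a' ≫ a) (g := g' ≫ g)
      (by rw [reassoc_of% w', w, Category.assoc] : q' ≫ g' ≫ g = (a' ≫ a) ≫ p) φ χ := by
  intro W S hS b
  have := h' (g ⁻¹ᵁ W) S hS (pb a (preimage_le_of_comm w le_rfl) b)
  rw [pb_pb] at this
  rw [this, h W _ le_rfl b]
  ext i j
  exact pb_pb g g' le_rfl hS _

/-- Base change commutes with composition. In the proof of associativity this identifies the
pullback of φ₃ ∘ φ₂ to the triple fibre product. -/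
lemma Compat.star {Y₂ Z₂ : Scheme.{u}} {q₂ : Y₂ ⟶ Y} {p₂ : Z₂ ⟶ Z} {a₂ : Y₂ ⟶ Z₂} {m : ℕ}
    {w : q ≫ g = a ≫ p} {φ : MatHom p n} {ψ : MatHom q n} (h : Compat w φ ψ)
    {w₂ : q₂ ≫ a = a₂ ≫ p₂} {φ₂ : MatHom p₂ m} {ψ₂ : MatHom q₂ m} (h₂ : Compat w₂ φ₂ ψ₂) :
    Compat (by rw [Category.assoc, w, reassoc_of% w₂] : (q₂ ≫ q) ≫ g = a₂ ≫ p₂ ≫ p)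
      (φ₂.star φ) (ψ₂.star ψ) := by
  intro W S hS x
  change MatHom.starFun ψ₂ ψ S (pb a₂ (preimage_le_of_comm w₂ (preimage_le_of_comm w hS)) x) =
    (MatHom.starFun φ₂ φ W x).map _
  simp only [MatHom.starFun]
  rw [blockRect_map, h₂ (p ⁻¹ᵁ W) (q ⁻¹ᵁ S) (preimage_le_of_comm w hS) x]
  congr 1
  ext i j k l
  simp only [Matrix.map_apply, h W S hS]

lemma exists_affine_pair (g : T ⟶ U) {S : T.Opens} {W : U.Opens} {t : T} (ht : t ∈ S)
    (htW : g t ∈ W) : ∃ (W' : U.Opens) (S' : T.Opens), IsAffineOpen W' ∧ IsAffineOpen S' ∧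
      S' ≤ g ⁻¹ᵁ W' ∧ W' ≤ W ∧ S' ≤ S ∧ t ∈ S' := by
  obtain ⟨_, ⟨W', hW, rfl⟩, htW', hWle⟩ :=
    U.isBasis_affineOpens.exists_subset_of_mem_open htW W.isOpen
  obtain ⟨_, ⟨S', hS', rfl⟩, htS, hle⟩ :=
    T.isBasis_affineOpens.exists_subset_of_mem_open
      (show t ∈ ((S ⊓ g ⁻¹ᵁ W' : T.Opens) : Set T) from ⟨ht, htW'⟩) (S ⊓ g ⁻¹ᵁ W').isOpen
  exact ⟨W', S', hW, hS', fun z hz => (hle hz).2, hWle, fun z hz => (hle hz).1, htS⟩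

/-- Since p is affine, the square over an affine pair is a fibre product of affine schemes, so its
rings of functions form a tensor product. -/
lemma isPushout_pair (H : IsPullback a q p g) [IsAffineHom p] {W : U.Opens} {S : T.Opens}
    (hW : IsAffineOpen W) (hS : IsAffineOpen S) (h : S ≤ g ⁻¹ᵁ W) :
    IsPushout (g.appLE W S h) (p.appLE W (p ⁻¹ᵁ W) le_rfl) (q.appLE S (q ⁻¹ᵁ S) le_rfl)
      (a.appLE (p ⁻¹ᵁ W) (q ⁻¹ᵁ S) (preimage_le_of_comm H.w.symm h)) := by
  have hY : q ⁻¹ᵁ S = a ⁻¹ᵁ (p ⁻¹ᵁ W) ⊓ q ⁻¹ᵁ S :=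
    (inf_eq_right.mpr (preimage_le_of_comm H.w.symm h)).symm
  have := isIso_pushoutSection_of_isAffineOpen H (US := W) (UT := S) (UX := p ⁻¹ᵁ W) h le_rfl
    hY hW hS (hW.preimage p)
  exact ((isIso_pushoutSection_iff ..).mp this).flip

/-- Additive families that are linear and natural are determined by the pulled back functions. -/
lemma baseChange_ext {α β : Type*} (H : IsPullback a q p g) [IsAffineHom p]
    (E E' : ∀ S : T.Opens, Γ(Y, q ⁻¹ᵁ S) → Matrix α β Γ(T, S))
    (addE : ∀ S x y, E S (x + y) = E S x + E S y)
    (addE' : ∀ S x y, E' S (x + y) = E' S x + E' S y)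
    (smulE : ∀ S c x, E S (pb q le_rfl c * x) = c • E S x)
    (smulE' : ∀ S c x, E' S (pb q le_rfl c * x) = c • E' S x)
    (natE : ∀ (S S' : T.Opens) (h : S' ≤ S) (x : Γ(Y, q ⁻¹ᵁ S)),
      E S' (res (q.preimage_mono h) x) = (E S x).map (res h))
    (natE' : ∀ (S S' : T.Opens) (h : S' ≤ S) (x : Γ(Y, q ⁻¹ᵁ S)),
      E' S' (res (q.preimage_mono h) x) = (E' S x).map (res h))
    (agree : ∀ (W : U.Opens) (S : T.Opens) (_ : IsAffineOpen W) (_ : IsAffineOpen S)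
      (h : S ≤ g ⁻¹ᵁ W) (b : Γ(Z, p ⁻¹ᵁ W)),
      E S (pb a (preimage_le_of_comm H.w.symm h) b) = E' S (pb a (preimage_le_of_comm H.w.symm h) b))
    (S : T.Opens) (x : Γ(Y, q ⁻¹ᵁ S)) : E S x = E' S x := by
  -- Both families are sheaf-like, so it suffices to compare them on affine pairs. There additivity
  -- and linearity reduce the claim to functions pulled back from Z.
  refine matrix_eq_of_res _ _ fun t ht => ?_
  obtain ⟨W, S', hW, hS', h₂, -, h₁, htS⟩ := exists_affine_pair g (W := ⊤) ht trivial
  refine ⟨S', h₁, htS, ?_⟩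
  rw [← natE, ← natE']
  generalize res (q.preimage_mono h₁) x = y
  refine pushout_induction (isPushout_pair H hW hS' h₂) (C := fun y => E S' y = E' S' y) (fun c b => ?_)
    (fun y z hy hz => ?_) y
  · have := agree W S' hW hS' h₂ b
    have h₃ := smulE S' c (pb a (preimage_le_of_comm H.w.symm h₂) b)
    rw [this, ← smulE'] at h₃
    exact h₃
  · rw [addE, addE', hy, hz]

lemma exists_local_baseChange (H : IsPullback a q p g) [IsAffineHom p] (φ : MatHom p n)
    {W : U.Opens} {S : T.Opens} (hW : IsAffineOpen W) (hS : IsAffineOpen S) (h : S ≤ g ⁻¹ᵁ W) :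
    ∃ l : Γ(Y, q ⁻¹ᵁ S) →ₙ+* Matrix (Fin n) (Fin n) Γ(T, S), ∀ c b,
      l (pb q le_rfl c * pb a (preimage_le_of_comm H.w.symm h) b) =
        c • (φ.app W b).map (pb g h) :=
  exists_matrix_baseChange (isPushout_pair H hW hS h) (φ.app W) fun r b => φ.app_pb_mul W r b

/-- The base change of a matrix homomorphism along a morphism. -/
theorem exists_compat (H : IsPullback a q p g) [IsAffineHom p] (φ : MatHom p n) :
    ∃ ψ : MatHom q n, Compat H.w.symm φ ψ := by
  -- The index is a pair (W, S), since the tensor description over S depends on the choice of an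
  -- affine W containing g(S).
  let I := {i : U.Opens × T.Opens // IsAffineOpen i.1 ∧ IsAffineOpen i.2 ∧ i.2 ≤ g ⁻¹ᵁ i.1}
  choose l hl using fun i : I => exists_local_baseChange H φ i.2.1 i.2.2.1 i.2.2.2
  have ind : ∀ (i : I) {C : Γ(Y, q ⁻¹ᵁ i.1.2) → Prop}, (∀ c b, C (pb q le_rfl c *
      pb a (preimage_le_of_comm H.w.symm i.2.2.2) b)) → (∀ x y, C x → C y → C (x + y)) → ∀ x, C x :=
    fun i C h₁ h₂ => pushout_induction (isPushout_pair H i.2.1 i.2.2.1 i.2.2.2) h₁ h₂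
  have lsmul : ∀ (i : I) c x, l i (pb q le_rfl c * x) = c • l i x := by
    intro i c
    refine ind i (fun d b => ?_) (fun x y hx hy => ?_)
    · rw [← mul_assoc, ← map_mul, hl, hl, mul_smul]
    · rw [mul_add, map_add, map_add, hx, hy, smul_add]
  have lnat : ∀ (i j : I) (_ : j.1.1 ≤ i.1.1) (h : j.1.2 ≤ i.1.2) x,
      l j (res (q.preimage_mono h) x) = (l i x).map (res h) := by
    intro i j h' h
    refine ind i (fun c b => ?_) (fun x y hx hy => ?_)
    · rw [hl, map_mul, res_pb, res_pb, ← pb_res q le_rfl h,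
        ← pb_res a (preimage_le_of_comm H.w.symm j.2.2.2) (p.preimage_mono h'), hl,
        φ.app_res h']
      ext u v
      simp only [Matrix.smul_apply, Matrix.map_apply, smul_eq_mul, map_mul, pb_res, res_pb]
    · rw [map_add, map_add, hx, hy, map_add]
      ext u v
      simp
  have lcompat : ∀ (S : T.Opens) (x : Γ(Y, q ⁻¹ᵁ S)) (i j : I) (hi : i.1.2 ≤ S) (hj : j.1.2 ≤ S),
      (l i (res (q.preimage_mono hi) x)).map (res (inf_le_left : i.1.2 ⊓ j.1.2 ≤ i.1.2)) =
      (l j (res (q.preimage_mono hj) x)).map (res (inf_le_right : i.1.2 ⊓ j.1.2 ≤ j.1.2)) := by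
    intro S x i j hi hj
    refine matrix_eq_of_res _ _ fun t ht => ?_
    -- Two pairs need not be comparable. Near t both are compared with a third affine pair contained
    -- in each of them.
    obtain ⟨W', S', hW, hS', h₂, h₃, h₁, htS⟩ := exists_affine_pair g (W := i.1.1 ⊓ j.1.1) ht
      ⟨i.2.2.2 ht.1, j.2.2.2 ht.2⟩
    refine ⟨S', h₁, htS, ?_⟩
    have e₁ := lnat i ⟨(W', S'), hW, hS', h₂⟩ (h₃.trans inf_le_left) (h₁.trans inf_le_left)
      (res (q.preimage_mono hi) x)
    have e₂ := lnat j ⟨(W', S'), hW, hS', h₂⟩ (h₃.trans inf_le_right) (h₁.trans inf_le_right)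
      (res (q.preimage_mono hj) x)
    rw [res_res] at e₁ e₂
    have := e₁.symm.trans e₂
    ext u v
    have := congr_fun (congr_fun this u) v
    simp only [Matrix.map_apply, res_res] at this ⊢
    exact this
  have glue : ∀ (S : T.Opens) (x : Γ(Y, q ⁻¹ᵁ S)), ∃ t : Matrix (Fin n) (Fin n) Γ(T, S),
      ∀ (i : I) (hi : i.1.2 ≤ S), t.map (res hi) = l i (res (q.preimage_mono hi) x) := by
    intro S x
    obtain ⟨t, ht⟩ := exists_glue_matrix (ι := {i : I // i.1.2 ≤ S}) S (fun i => i.1.1.2)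
      (fun i => i.2) (fun t ht => by
        obtain ⟨W', S', hW, hS', h₂, -, h₁, htS⟩ := exists_affine_pair g (W := ⊤) ht trivial
        exact ⟨⟨⟨(W', S'), hW, hS', h₂⟩, h₁⟩, htS⟩)
      (fun i => l i.1 (res (q.preimage_mono i.2) x)) (fun i j => lcompat S x i.1 j.1 i.2 j.2)
    exact ⟨t, fun i hi => ht ⟨i, hi⟩⟩
  choose F hF using glue
  -- The extra bound W is needed only for the compatibility with φ, where b is a function over W and
  -- has to be restricted to the affine open of the pair. The ring axioms use W = ⊤.
  have uniq : ∀ (S : T.Opens) (M N : Matrix (Fin n) (Fin n) Γ(T, S)) (W : U.Opens) (_ : S ≤ g ⁻¹ᵁ W),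
      (∀ (i : I) (hi : i.1.2 ≤ S), i.1.1 ≤ W → M.map (res hi) = N.map (res hi)) → M = N := by
    intro S M N W hS h
    refine matrix_eq_of_res _ _ fun t ht => ?_
    obtain ⟨W', S', hW, hS', h₂, h₃, h₁, htS⟩ := exists_affine_pair g (W := W) ht (hS ht)
    exact ⟨S', h₁, htS, h ⟨(W', S'), hW, hS', h₂⟩ h₁ h₃⟩
  refine ⟨MatHom.mk' q n F (fun S x y => ?_) (fun S x y => ?_) (fun S c x => ?_)
    (fun S S' h x => ?_), fun W S hS b => ?_⟩
  · refine uniq _ _ _ ⊤ le_top fun i hi _ => ?_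
    rw [hF, map_add, map_add, ← hF _ _ i hi, ← hF _ _ i hi]
    ext; simp
  · refine uniq _ _ _ ⊤ le_top fun i hi _ => ?_
    rw [hF, map_mul, map_mul, ← hF _ _ i hi, ← hF _ _ i hi]
    exact Matrix.map_mul.symm
  · refine uniq _ _ _ ⊤ le_top fun i hi _ => ?_
    rw [hF, map_mul, res_pb, ← pb_res q le_rfl hi, lsmul, ← hF _ _ i hi]
    ext; simp
  · refine uniq _ _ _ ⊤ le_top fun i hi _ => ?_
    rw [hF, res_res, ← hF _ _ i (hi.trans h)]
    ext; simp [res_res]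
  · refine uniq _ _ _ W hS fun i hi hW => ?_
    change (F S _).map _ = _
    rw [hF, res_pb, ← pb_res a (preimage_le_of_comm H.w.symm i.2.2.2) (p.preimage_mono hW)]
    have := hl i 1 (res (p.preimage_mono hW) b)
    rw [map_one, one_mul, one_smul, φ.app_res hW] at this
    rw [this]
    ext
    simp only [Matrix.map_apply, res_pb, pb_res]

theorem eq_of_agree (H : IsPullback a q p g) [IsAffineHom p] {ψ ψ' : MatHom q n}
    (agree : ∀ (W : U.Opens) (S : T.Opens) (_ : IsAffineOpen W) (_ : IsAffineOpen S)
      (h : S ≤ g ⁻¹ᵁ W) (b : Γ(Z, p ⁻¹ᵁ W)), ψ.app S (pb a (preimage_le_of_comm H.w.symm h) b) =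
        ψ'.app S (pb a (preimage_le_of_comm H.w.symm h) b)) : ψ = ψ' :=
  MatHom.ext_app (baseChange_ext H (fun S x => ψ.app S x) (fun S x => ψ'.app S x)
    (fun _ => map_add _) (fun _ => map_add _) (fun S => ψ.app_pb_mul S) (fun S => ψ'.app_pb_mul S)
    (fun _ _ h => ψ.app_res h) (fun _ _ h => ψ'.app_res h) agree)

theorem Compat.of_affine (H : IsPullback a q p g) [IsAffineHom p]
    {φ : MatHom p n} {ψ : MatHom q n}
    (h : ∀ (W : U.Opens) (S : T.Opens) (_ : IsAffineOpen W) (_ : IsAffineOpen S)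
      (h : S ≤ g ⁻¹ᵁ W) (b : Γ(Z, p ⁻¹ᵁ W)), ψ.app S (pb a (preimage_le_of_comm H.w.symm h) b) =
        (φ.app W b).map (pb g h)) : Compat H.w.symm φ ψ := by
  obtain ⟨ψ', h'⟩ := exists_compat H φ
  obtain rfl : ψ = ψ' := eq_of_agree H fun W S hW hS hle b =>
    (h W S hW hS hle b).trans (h' W S hle b).symm
  exact h'

end BaseChange

/-! ### Universally generalizing morphisms -/

section GoingDown

/-- Going-down passes from A → B to A/I → B/IB: the primes involved correspond to primes upstairs
that contain I and IB, and a prime of B lying over one that contains I contains IB. -/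
lemma hasGoingDown_of_surjective {A B T C : Type*} [CommRing A] [CommRing B] [CommRing T]
    [CommRing C] [Algebra A B] [Algebra T C] [Algebra.HasGoingDown A B] (f : A →+* T) (h : B →+* C)
    (hf : Function.Surjective f) (hh : Function.Surjective h)
    (comm : h.comp (algebraMap A B) = (algebraMap T C).comp f)
    (ker : RingHom.ker h ≤ (RingHom.ker f).map (algebraMap A B)) : Algebra.HasGoingDown T C := by
  constructor
  intro p hp Q hQ hlt
  have e : (Q.comap h).under A = (Q.under T).comap f := by
    rw [Ideal.under, Ideal.under, Ideal.comap_comap, Ideal.comap_comap, comm]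
  have : (Q.comap h).LiesOver ((Q.comap h).under A) := ⟨rfl⟩
  have hle : p.comap f ≤ (Q.comap h).under A := by
    rw [e]
    exact Ideal.comap_mono hlt.le
  obtain ⟨P, hPQ, hP, hPp⟩ := Ideal.exists_ideal_le_liesOver_of_le (Q.comap h) hle
  have hker : RingHom.ker h ≤ P := by
    refine ker.trans (Ideal.map_le_iff_le_comap.mpr ?_)
    have : P.comap (algebraMap A B) = p.comap f := hPp.over.symm
    rw [this]
    exact Ideal.comap_mono bot_le
  have hcm : (P.map h).comap h = P := by
    rw [Ideal.comap_map_of_surjective _ hh, sup_eq_left]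
    exact hker
  refine ⟨P.map h, ?_, Ideal.map_isPrime_of_surjective hh hker, ⟨?_⟩⟩
  · exact Ideal.map_le_iff_le_comap.mpr hPQ
  · apply Ideal.comap_injective_of_surjective f hf
    rw [Ideal.under, Ideal.comap_comap, ← comm, ← Ideal.comap_comap, hcm]
    exact hPp.over

/-- Going-down over a normal domain does not apply to T directly, as T is arbitrary. But T is a
quotient of the polynomial ring R[T] with one variable for each element of T. That ring is a normal
domain by hypothesis, and R[T] ⊗ S = S[T] is a domain integral over it; the result descends to the
quotient. -/
lemma hasGoingDown_tensorProduct {R S T : Type u} [CommRing R] [CommRing S] [CommRing T]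
    [Algebra R S] [Algebra R T] [IsDomain R] [IsDomain S] [Algebra.IsIntegral R S]
    [FaithfulSMul R S] (hR : IsIntegrallyClosed (MvPolynomial T R)) :
    Algebra.HasGoingDown T (TensorProduct R T S) := by
  have e : TensorProduct R (MvPolynomial T R) S ≃+* MvPolynomial T S :=
    ((Algebra.TensorProduct.comm R (MvPolynomial T R) S).toRingEquiv).trans
      (MvPolynomial.algebraTensorAlgEquiv R S).toRingEquiv
  have : IsDomain (TensorProduct R (MvPolynomial T R) S) := e.toMulEquiv.isDomain _
  have : FaithfulSMul (MvPolynomial T R) (TensorProduct R (MvPolynomial T R) S) := by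
    refine (faithfulSMul_iff_algebraMap_injective (MvPolynomial T R)
      (TensorProduct R (MvPolynomial T R) S)).mpr ?_
    exact Algebra.TensorProduct.includeLeft_injective (S := R) (FaithfulSMul.algebraMap_injective R S)
  let f : MvPolynomial T R →ₐ[R] T := MvPolynomial.aeval id
  have hf : Function.Surjective f := fun t => ⟨MvPolynomial.X t, MvPolynomial.aeval_X _ _⟩
  let h : TensorProduct R (MvPolynomial T R) S →ₐ[R] TensorProduct R T S :=
    Algebra.TensorProduct.map f (AlgHom.id R S)
  have hh : Function.Surjective h := TensorProduct.map_surjective hf Function.surjective_id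
  refine hasGoingDown_of_surjective (A := MvPolynomial T R) f.toRingHom h.toRingHom hf hh ?_
    (Algebra.TensorProduct.rTensor_ker f hf).le
  ext x
  · exact Algebra.TensorProduct.map_tmul f (AlgHom.id R S) _ _
  · exact Algebra.TensorProduct.map_tmul f (AlgHom.id R S) _ _

/-- A morphism is universally generalizing if generalizations lift along all its base changes. -/
abbrev UnivGen : MorphismProperty Scheme.{u} :=
  (topologically GeneralizingMap).universally

lemma UnivGen.of_flat {X Y : Scheme.{u}} (f : X ⟶ Y) [Flat f] : UnivGen f :=
  MorphismProperty.universally_mk' _ _ fun _ _ => Flat.generalizingMap _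

instance : (topologically GeneralizingMap).IsStableUnderComposition where
  comp_mem f g hf hg := GeneralizingMap.comp (f := f) (g := g) hf hg

instance : IsZariskiLocalAtTarget UnivGen.{u} :=
  universally_isZariskiLocalAtTarget _ fun _ _ U hU H =>
    (IsZariskiLocalAtTarget.iff_of_iSup_eq_top (P := topologically GeneralizingMap) U hU).mpr H

instance : UnivGen.{u}.IsMultiplicative where
  id_mem _ := UnivGen.of_flat _

/-- The graph of f over Z is a base change of the diagonal of g, which is flat because g is étale.
So f is a flat morphism followed by a base change of f ≫ g. -/
lemma UnivGen.of_comp_etale {X Y Z : Scheme.{u}} (f : X ⟶ Y) (g : Y ⟶ Z) [Etale g]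
    (h : UnivGen (f ≫ g)) : UnivGen f := by
  have : MorphismProperty.HasOfPostcompProperty UnivGen.{u} @Etale :=
    MorphismProperty.hasOfPostcompProperty_iff_le_diagonal.mpr fun _ _ g hg => by
      have : Etale g := hg
      exact UnivGen.of_flat (pullback.diagonal g)
  exact MorphismProperty.of_postcomp UnivGen f g ‹_› h

/-- Lifting of generalizations is local on the target, so only base changes to affine schemes
matter, and those are tensor products. -/
lemma UnivGen.SpecMap {R S : CommRingCat.{u}} (φ : R ⟶ S) [IsDomain R] [IsDomain S]
    (hφ : φ.hom.IsIntegral) (inj : Function.Injective φ)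
    (hR : ∀ T : Type u, IsIntegrallyClosed (MvPolynomial T R)) : UnivGen (Spec.map φ) := by
  have affine : ∀ {T : CommRingCat.{u}} {Y : Scheme.{u}} {a : Y ⟶ Spec S} {b : Y ⟶ Spec T}
      {c : Spec T ⟶ Spec R}, IsPullback b a c (Spec.map φ) → topologically GeneralizingMap b := by
    intro T Y a b c H
    obtain ⟨ψ, rfl⟩ := Spec.map_surjective c
    algebraize [φ.hom, ψ.hom]
    have : FaithfulSMul R S := (faithfulSMul_iff_algebraMap_injective _ _).mpr inj
    have hd := hasGoingDown_tensorProduct (hR T) (S := S)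
    have H' := isPullback_SpecMap_of_isPushout _ _ _ _ (CommRingCat.isPushout_tensorProduct R T S)
    have e := IsPullback.isoIsPullback_hom_fst _ _ H H'
    rw [← e, MorphismProperty.cancel_left_of_respectsIso (topologically GeneralizingMap)]
    exact Algebra.HasGoingDown.iff_generalizingMap_primeSpectrumComap.mp hd
  refine MorphismProperty.universally_mk' _ _ fun {X'} g _ => ?_
  rw [IsZariskiLocalAtTarget.iff_of_openCover (P := topologically GeneralizingMap) X'.affineCover]
  intro i
  exact affine ((IsPullback.of_hasPullback (pullback.fst g (Spec.map φ))
    (X'.affineCover.f i)).flip.paste_vert (IsPullback.of_hasPullback g (Spec.map φ)))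

/-- Quasi-finite dominant morphisms from integral schemes to affine spaces are universally
generalizing. -/
lemma UnivGen.of_isAffineHom {X : Scheme.{u}} {R : CommRingCat.{u}} (h : X ⟶ Spec R) [IsIntegral X]
    [LocallyQuasiFinite h] [LocallyOfFiniteType h] [IsAffineHom h] [IsDominant h] [IsDomain R]
    (hR : ∀ T : Type u, IsIntegrallyClosed (MvPolynomial T R)) : UnivGen h := by
  rw [← h.toNormalization_fromNormalization]
  -- By Zariski's main theorem the map to the relative normalization is an open immersion, hence
  -- flat. What remains is an integral morphism of integral affine schemes.
  refine MorphismProperty.comp_mem _ _ _ (UnivGen.of_flat _) ?_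
  have : IsAffine h.normalization := isAffine_of_isAffineHom h.fromNormalization
  have hd : IsDominant (h.toNormalization ≫ h.fromNormalization) := by
    rw [h.toNormalization_fromNormalization]; infer_instance
  have : IsDominant h.fromNormalization := .of_comp h.toNormalization _
  let e := h.normalization.isoSpec
  rw [← MorphismProperty.cancel_left_of_respectsIso UnivGen e.inv]
  have : IsDominant (e.inv ≫ h.fromNormalization) := inferInstance
  have : IsIntegralHom (e.inv ≫ h.fromNormalization) := inferInstance
  generalize e.inv ≫ h.fromNormalization = f at *
  obtain ⟨φ, rfl⟩ := Spec.map_surjective f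
  refine UnivGen.SpecMap φ ?_ ?_ hR
  · exact (IsIntegralHom.SpecMap_iff).mp ‹_›
  · have h₁ := (PrimeSpectrum.denseRange_comap_iff_ker_le_nilRadical φ.hom).mp
      (Spec.map φ).denseRange
    rw [nilradical_eq_zero, Ideal.zero_eq_bot, le_bot_iff] at h₁
    exact (RingHom.injective_iff_ker_eq_bot φ.hom).mpr h₁

/-- A finite morphism from an integral scheme to a smooth scheme over a field, that is dominant
onto a component, is universally generalizing. -/
theorem UnivGen.of_isFinite {k : Type u} [Field k] {B U : Scheme.{u}} (s : U ⟶ Spec (.of k))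
    [Smooth s] (f : B ⟶ U) [IsFinite f] [IsIntegral B]
    (hf : ∀ y, y ⤳ f (genericPoint B) → y = f (genericPoint B)) : UnivGen f := by
  choose W hW V hV hx e hs using Smooth.exists_isStandardSmooth s
  rw [IsZariskiLocalAtTarget.iff_of_iSup_eq_top (P := UnivGen) V
    (by ext x; simpa using ⟨x, hx x⟩)]
  intro x
  obtain ⟨n, g, hg, het⟩ := (hs x).exists_etale_mvPolynomial
  -- The spectrum of a field has one point, so the chart lies over the whole base and the
  -- coefficient ring is a field.
  have hW : W x = ⊤ := by
    ext y
    have : y = s x := Subsingleton.elim _ _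
    simpa [this] using e x (hx x)
  have hF : IsField Γ(Spec (.of k), W x) := by
    rw [hW]
    exact isField_of_isIntegral_of_subsingleton _
  let c : (V x).toScheme ⟶ Spec (.of (MvPolynomial (Fin n) Γ(Spec (.of k), W x))) :=
    (hV x).isoSpec.hom ≫ Spec.map (CommRingCat.ofHom g)
  have : Etale (Spec.map (CommRingCat.ofHom g)) :=
    (HasRingHomProperty.Spec_iff (P := @Etale)).mpr het
  have : LocallyQuasiFinite (Spec.map (CommRingCat.ofHom g)) := by
    refine (HasRingHomProperty.Spec_iff (P := @LocallyQuasiFinite)).mpr ?_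
    algebraize [g]
    exact inferInstanceAs (Algebra.QuasiFinite _ _)
  have : Etale c := inferInstance
  -- Passing to affine space avoids proving that U is normal: only polynomial rings over a field
  -- have to be integrally closed.
  refine UnivGen.of_comp_etale _ c ?_
  cases isEmpty_or_nonempty (f ⁻¹ᵁ V x).toScheme
  · exact UnivGen.of_flat _
  have : IsIntegral (f ⁻¹ᵁ V x).toScheme := inferInstance
  have : IsDominant (f ∣_ V x ≫ c) := by
    let η := genericPoint (f ⁻¹ᵁ V x).toScheme
    have hη : (f ⁻¹ᵁ V x).ι η = genericPoint B := by
      exact genericPoint_eq_of_isOpenImmersion _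
    have : IsDomain Γ(Spec (.of k), W x) := hF.isDomain
    refine ⟨?_⟩
    -- By flatness of c the generic point of affine space lifts to a generalization t of the image
    -- of the generic point of B. That image has no proper generalization, so it is t itself, and
    -- the composite is dominant.
    obtain ⟨t, ht, hct⟩ := Flat.generalizingMap c
      (genericPoint_specializes (c ((f ∣_ V x) η)))
    have : t = (f ∣_ V x) η := by
      apply (V x).ι.isOpenEmbedding.injective
      have e₁ : (V x).ι ((f ∣_ V x) η) = f (genericPoint B) := by
        rw [← hη, ← Scheme.Hom.comp_apply, morphismRestrict_ι, Scheme.Hom.comp_apply]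
      rw [e₁]
      apply hf
      rw [← e₁]
      exact ht.map (V x).ι.continuous
    subst this
    have h₁ := genericPoint_spec (Spec (CommRingCat.of (MvPolynomial (Fin n) Γ(Spec (.of k), W x))))
    rw [← hct] at h₁
    intro y
    refine closure_mono (s := {c ((f ∣_ V x) η)}) (t := Set.range (f ∣_ V x ≫ c))
      (by rintro _ rfl; exact ⟨η, rfl⟩) ?_
    rw [show closure _ = Set.univ from h₁]
    trivial
  have : LocallyQuasiFinite (f ∣_ V x ≫ c) := inferInstance
  have : LocallyOfFiniteType (f ∣_ V x ≫ c) := inferInstance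
  have : IsAffineHom (f ∣_ V x ≫ c) := inferInstance
  have : IsDomain Γ(Spec (.of k), W x) := hF.isDomain
  refine UnivGen.of_isAffineHom _ fun T => ?_
  let := hF.toField
  exact inferInstance

end GoingDown

/-! ### Smooth schemes over a field are reduced -/

section Reduced

/-- By flatness S embeds into Frac(P) ⊗ S, which is étale over a field and therefore reduced. -/
lemma isReduced_of_etale {P S : Type u} [CommRing P] [CommRing S] [IsDomain P] [Algebra P S]
    [Algebra.Etale P S] : IsReduced S := by
  let K := FractionRing P
  have h : Function.Injective (Algebra.TensorProduct.includeRight : S →ₐ[P] TensorProduct P K S) :=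
    Algebra.TensorProduct.includeRight_injective (IsFractionRing.injective P K)
  have : IsReduced (TensorProduct P K S) := Algebra.FormallyUnramified.isReduced_of_field K _
  exact isReduced_of_injective _ h

theorem isReduced_of_smooth {k : Type u} [Field k] {U : Scheme.{u}} (s : U ⟶ Spec (.of k))
    [Smooth s] : AlgebraicGeometry.IsReduced U := by
  choose W hW V hV hx e hs using Smooth.exists_isStandardSmooth s
  have hr : ∀ x, AlgebraicGeometry.IsReduced (V x).toScheme := by
    intro x
    obtain ⟨n, g, hg, het⟩ := (hs x).exists_etale_mvPolynomial
    have hW : W x = ⊤ := by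
      ext y
      have : y = s x := Subsingleton.elim _ _
      simpa [this] using e x (hx x)
    have hF : IsField Γ(Spec (.of k), W x) := by
      rw [hW]
      exact isField_of_isIntegral_of_subsingleton _
    have : IsDomain Γ(Spec (.of k), W x) := hF.isDomain
    algebraize [g]
    have : _root_.IsReduced Γ(U, V x) := 
      isReduced_of_etale (P := MvPolynomial (Fin n) Γ(Spec (.of k), W x))
    have : AlgebraicGeometry.IsReduced (Spec Γ(U, V x)) := inferInstance
    exact isReduced_of_isOpenImmersion (hV x).isoSpec.hom
  let 𝒰 := U.openCoverOfIsOpenCover V (by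
    rw [IsOpenCover]; ext x; simpa using ⟨x, hx x⟩)
  have : ∀ i, AlgebraicGeometry.IsReduced (𝒰.X i) := hr
  exact IsReduced.of_openCover U 𝒰

end Reduced

/-! ### Finiteness of supports -/

section Supports

variable {k : Type u} [Field k] {U X : Sm k}

attribute [instance] Sm.smooth Sm.separated Sm.locallyOfFiniteType Sm.quasiCompact

/-- Finiteness over U depends only on the support, so every thickening of a support is finite as
well. Indeed Y ×_{U × X} Z is finite over U and surjects onto Z; hence Z ⟶ U is proper with finite
fibres, that is, finite. -/
lemma isFinite_src {I : IdealSheafData (prodScheme U X)} {Y : Scheme.{u}} (y : Y ⟶ prodScheme U X)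
    (hy : IsFinite (y ≫ prodFst U X))
    (h : (I.support : Set (prodScheme U X)) ⊆ Set.range y) : IsFinite (src I) := by
  let f := pullback.snd y I.subschemeι
  have hf : Surjective f := by
    constructor
    rw [← Set.range_eq_univ, Scheme.Pullback.range_snd]
    ext z
    simp only [Set.mem_preimage, Set.mem_univ, iff_true]
    apply h
    rw [← I.range_subschemeι]
    exact ⟨z, rfl⟩
  have hfin : IsFinite (f ≫ src I) := by
    have : f ≫ src I = pullback.fst y I.subschemeι ≫ y ≫ prodFst U X := by
      simp only [f, src, ← Category.assoc, pullback.condition]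
    rw [this]
    infer_instance
  have : UniversallyClosed (src I) := .of_comp_surjective f _
  have : IsProper (src I) := { }
  have : LocallyQuasiFinite (src I) := by
    refine LocallyQuasiFinite.of_finite_preimage_singleton _ fun x => ?_
    refine ((f ≫ src I).finite_preimage_singleton x |>.image f).subset ?_
    intro z hz
    obtain ⟨w, rfl⟩ := f.surjective z
    exact ⟨w, by simpa using hz, rfl⟩
  exact .of_isProper_of_locallyQuasiFinite _

lemma IsSupp.exists_finite {A : Closeds (prodScheme U X)} (hA : IsSupp A) :
    ∃ (Y : Scheme.{u}) (y : Y ⟶ prodScheme U X), IsFinite (y ≫ prodFst U X) ∧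
      Set.range y = A := by
  obtain ⟨S, hS, hel, hAS⟩ := hA
  rw [hAS]
  clear hAS A
  induction S, hS using Set.Finite.induction_on with
  | empty =>
    refine ⟨(⊤ : IdealSheafData (prodScheme U X)).subscheme, IdealSheafData.subschemeι _, ?_, ?_⟩
    · infer_instance
    · simp [IdealSheafData.range_subschemeι]
  | @insert B S _ _ ih =>
    obtain ⟨Y, y, hy, hr⟩ := ih fun C hC => hel C (Set.mem_insert_of_mem _ hC)
    have hB := (hel B (Set.mem_insert _ _)).finite
    refine ⟨(IdealSheafData.vanishingIdeal B).subscheme ⨿ Y,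
      coprod.desc (IdealSheafData.subschemeι _) y, ?_, ?_⟩
    · rw [coprod.desc_comp]
      infer_instance
    · rw [Set.biUnion_insert, ← hr]
      have hc : (B : Set (prodScheme U X)) =
          Set.range (IdealSheafData.vanishingIdeal B).subschemeι := by
        rw [IdealSheafData.range_subschemeι, IdealSheafData.coe_support_vanishingIdeal]
      rw [hc]
      ext x
      constructor
      · rintro ⟨z, rfl⟩
        obtain ⟨z | z, rfl⟩ := (coprodMk _ _).surjective z
        · left
          rw [coprodMk_inl, ← Scheme.Hom.comp_apply, coprod.inl_desc]
          exact ⟨z, rfl⟩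
        · right
          rw [coprodMk_inr, ← Scheme.Hom.comp_apply, coprod.inr_desc]
          exact ⟨z, rfl⟩
      · rintro (⟨z, rfl⟩ | ⟨z, rfl⟩)
        · refine ⟨(coprod.inl : _ ⟶ _ ⨿ Y) z, ?_⟩
          rw [← Scheme.Hom.comp_apply, coprod.inl_desc]
        · refine ⟨(coprod.inr : _ ⟶ (IdealSheafData.vanishingIdeal B).subscheme ⨿ _) z, ?_⟩
          rw [← Scheme.Hom.comp_apply, coprod.inr_desc]

lemma IsSubSch.isSupp {I : IdealSheafData (prodScheme U X)} (h : IsSubSch I) : IsSupp I.support := by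
  obtain ⟨A, hA, m, rfl⟩ := h
  obtain rfl | hm := eq_or_ne m 0
  · exact ⟨∅, Set.finite_empty, by simp, by simp⟩
  · rw [IdealSheafData.support_pow _ _ hm]
    exact hA

lemma IsSupp.isFinite {I : IdealSheafData (prodScheme U X)} (h : IsSupp I.support) :
    IsFinite (src I) := by
  obtain ⟨Y, y, hy, hr⟩ := h.exists_finite
  exact isFinite_src y hy hr.ge

lemma IsSubSch.isFinite {I : IdealSheafData (prodScheme U X)} (h : IsSubSch I) :
    IsFinite (src I) :=
  h.isSupp.isFinite


end Supports

/-! ### Composition of supports -/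

section CompositionOfSupports

variable {k : Type u} [Field k] {V U X : Sm k}

lemma isReduced_subscheme {S : Scheme.{u}} (A : Closeds S) :
    AlgebraicGeometry.IsReduced (IdealSheafData.vanishingIdeal A).subscheme := by
  let I := IdealSheafData.vanishingIdeal A
  have h : I.radical = I := by
    rw [← IdealSheafData.vanishingIdeal_support]
    rfl
  have hr : ∀ W, AlgebraicGeometry.IsReduced (I.subschemeCover.openCover.X W) := by
    intro (W : S.affineOpens)
    have : (I.ideal W).IsRadical := by
      have : I.ideal W = (I.ideal W).radical := congr_fun (congr_arg _ h.symm) W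
      rw [this]
      exact Ideal.radical_isRadical _
    have := (Ideal.isRadical_iff_quotient_reduced _).mp this
    change AlgebraicGeometry.IsReduced (Spec (CommRingCat.of (Γ(S, W.1) ⧸ I.ideal W)))
    infer_instance
  exact IsReduced.of_openCover _ I.subschemeCover.openCover

lemma isIntegral_subscheme {S : Scheme.{u}} {A : Closeds S} (h : IsIrreducible (A : Set S)) :
    IsIntegral (IdealSheafData.vanishingIdeal A).subscheme := by
  have := isReduced_subscheme A
  have : IrreducibleSpace (IdealSheafData.vanishingIdeal A).subscheme :=
    isIrreducible_iff_irreducibleSpace.mp h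
  exact isIntegral_of_irreducibleSpace_of_isReduced _

lemma image_subscheme {S T : Scheme.{u}} (A : Closeds S) (f : S ⟶ T) :
    Set.range ((IdealSheafData.vanishingIdeal A).subschemeι ≫ f) = f '' (A : Set S) := by
  rw [← IdealSheafData.coe_support_vanishingIdeal A, ← IdealSheafData.range_subschemeι,
    ← Set.range_comp]
  rfl

/-- The image of the generic point of B is the generic point of a component of U, so it has no
proper generalization. -/
lemma IsElementary.univGen {B : Closeds (prodScheme U X)} (h : IsElementary B) :
    UnivGen (src (IdealSheafData.vanishingIdeal B)) := by
  have := isIntegral_subscheme h.irreducible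
  have := h.finite
  refine UnivGen.of_isFinite U.hom _ fun y hy => ?_
  let f := src (IdealSheafData.vanishingIdeal B)
  let η := genericPoint (IdealSheafData.vanishingIdeal B).subscheme
  have h₁ : closure {f η} ∈ irreducibleComponents U.scheme := by
    have h₂ := (genericPoint_spec (IdealSheafData.vanishingIdeal B).subscheme).image
      f.continuous
    rw [Set.image_univ, image_subscheme, IsGenericPoint,
      (isClosed_of_mem_irreducibleComponents _ h.surjective).closure_eq] at h₂
    rw [h₂]
    exact h.surjective
  have h₂ : closure {f η} ⊆ closure {y} := hy.closure_subset
  have h₃ := h₁.2 (isIrreducible_singleton.closure) h₂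
  exact (Specializes.antisymm hy (specializes_iff_closure_subset.mpr h₃)).eq

/-- The morphism `Z₁ ×_U Z₂ ⟶ V × X`. -/
def fibMap (I₁ : IdealSheafData (prodScheme V U)) (I₂ : IdealSheafData (prodScheme U X)) :
    fib I₁ I₂ ⟶ prodScheme V X :=
  pullback.map (tgt I₁) (src I₂) (prodSnd V U) (prodFst U X) I₁.subschemeι I₂.subschemeι (𝟙 _)
    (by simp) (by simp) ≫ p₁₃ V U X

@[simp]
lemma fibMap_fst (I₁ : IdealSheafData (prodScheme V U)) (I₂ : IdealSheafData (prodScheme U X)) :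
    fibMap I₁ I₂ ≫ prodFst V X = fibFst I₁ I₂ ≫ src I₁ := by
  rw [fibMap, p₁₃, Category.assoc, pullback.lift_fst, pullback.map, pullback.lift_fst_assoc,
    Category.assoc]

@[simp]
lemma fibMap_snd (I₁ : IdealSheafData (prodScheme V U)) (I₂ : IdealSheafData (prodScheme U X)) :
    fibMap I₁ I₂ ≫ prodSnd V X = fibSnd I₁ I₂ ≫ tgt I₂ := by
  rw [fibMap, p₁₃, Category.assoc, pullback.lift_snd, pullback.map, pullback.lift_snd_assoc,
    Category.assoc]

lemma range_fibMap (I₁ : IdealSheafData (prodScheme V U)) (I₂ : IdealSheafData (prodScheme U X)) :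
    Set.range (fibMap I₁ I₂) = circ I₂.support I₁.support := by
  rw [fibMap, Scheme.Hom.comp_base, TopCat.coe_comp, Set.range_comp, Scheme.Pullback.range_map,
    IdealSheafData.range_subschemeι, IdealSheafData.range_subschemeι, Set.inter_comm]
  rfl

lemma isFinite_fibMap {I₁ : IdealSheafData (prodScheme V U)} {I₂ : IdealSheafData (prodScheme U X)}
    [IsFinite (src I₁)] [IsFinite (src I₂)] : IsFinite (fibMap I₁ I₂) := by
  have : IsFinite (fibMap I₁ I₂ ≫ prodFst V X) := by
    rw [fibMap_fst]
    infer_instance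
  exact IsFinite.of_comp _ (prodFst V X)

instance (W : Sm k) : IsLocallyNoetherian W.scheme :=
  LocallyOfFiniteType.isLocallyNoetherian W.hom

instance (W : Sm k) : CompactSpace W.scheme :=
  QuasiCompact.compactSpace_of_compactSpace W.hom

instance (W W' : Sm k) : IsLocallyNoetherian (prodScheme W W') :=
  LocallyOfFiniteType.isLocallyNoetherian (prodFst W W')

instance (W W' : Sm k) : CompactSpace (prodScheme W W') :=
  QuasiCompact.compactSpace_of_compactSpace (prodFst W W')

/-- The members of the union are the images of the irreducible components of A ×_U B. These images
are finite over V; the point is that each of them has the same image in V as A. -/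
lemma IsElementary.circ {B : Closeds (prodScheme U X)} {A : Closeds (prodScheme V U)}
    (hB : IsElementary B) (hA : IsElementary A) :
    ∃ S : Set (Closeds (prodScheme V X)), S.Finite ∧ (∀ D ∈ S, IsElementary D) ∧
      circ B A = ⋃ D ∈ S, (D : Set (prodScheme V X)) := by
  let I₁ := IdealSheafData.vanishingIdeal A
  let I₂ := IdealSheafData.vanishingIdeal B
  have h₁ : IsFinite (src I₁) := hA.finite
  have h₂ : IsFinite (src I₂) := hB.finite
  have hc : IsFinite (fibMap I₁ I₂) := isFinite_fibMap
  have : IsIntegral I₁.subscheme := isIntegral_subscheme hA.irreducible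
  have : IsLocallyNoetherian (fib I₁ I₂) := LocallyOfFiniteType.isLocallyNoetherian (fibMap I₁ I₂)
  have : CompactSpace (fib I₁ I₂) := QuasiCompact.compactSpace_of_compactSpace (fibMap I₁ I₂)
  have : IsNoetherian (fib I₁ I₂) := { }
  have gen : GeneralizingMap (fibFst I₁ I₂) :=
    hB.univGen _ _ _ (IsPullback.of_hasPullback (tgt I₁) (src I₂))
  -- The generic point of Z₁ lifts to a generalization of the generic point of D, which admits no
  -- proper one. So D dominates Z₁, and its image is closed because the projection is finite.
  have dom : ∀ D ∈ irreducibleComponents (fib I₁ I₂), fibFst I₁ I₂ '' D = Set.univ := by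
    intro D hD
    obtain ⟨y, hy⟩ := QuasiSober.sober hD.1 (isClosed_of_mem_irreducibleComponents D hD)
    obtain ⟨y', hy', e⟩ := gen (genericPoint_specializes (fibFst I₁ I₂ y))
    have hD' : D ⊆ closure {y'} := by
      rw [← hy.def]
      exact hy'.closure_subset
    have : y ⤳ y' := by
      rw [specializes_iff_closure_subset, hy.def]
      exact hD.2 isIrreducible_singleton.closure hD'
    obtain rfl := (this.antisymm hy').eq
    have hcl : IsClosed (fibFst I₁ I₂ '' D) :=
      (fibFst I₁ I₂).isClosedMap _ (isClosed_of_mem_irreducibleComponents D hD)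
    rw [← Set.univ_subset_iff, ← (genericPoint_spec I₁.subscheme).def,
      hcl.closure_subset_iff, Set.singleton_subset_iff, ← e]
    exact ⟨y, hy.mem, rfl⟩
  let E : irreducibleComponents (fib I₁ I₂) → Closeds (prodScheme V X) := fun D =>
    ⟨fibMap I₁ I₂ '' D.1, (fibMap I₁ I₂).isClosedMap _ (isClosed_of_mem_irreducibleComponents _ D.2)⟩
  have : Finite (irreducibleComponents (fib I₁ I₂)) :=
    TopologicalSpace.NoetherianSpace.finite_irreducibleComponents.to_subtype
  refine ⟨Set.range E, Set.finite_range E, ?_, ?_⟩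
  · rintro _ ⟨D, rfl⟩
    refine ⟨D.2.1.image _ (fibMap I₁ I₂).continuous.continuousOn, ?_, ?_⟩
    · refine isFinite_src (fibMap I₁ I₂) ?_ ?_
      · rw [fibMap_fst]
        infer_instance
      · rw [IdealSheafData.coe_support_vanishingIdeal]
        exact Set.image_subset_range _ _
    · have : prodFst V X '' (fibMap I₁ I₂ '' D.1) = prodFst V U '' (A : Set (prodScheme V U)) := by
        rw [← image_subscheme, ← Set.image_comp]
        have : (prodFst V X ∘ fibMap I₁ I₂ : _ → V.scheme) = src I₁ ∘ fibFst I₁ I₂ := by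
          ext x
          simp only [Function.comp_apply, ← Scheme.Hom.comp_apply, fibMap_fst]
        rw [this, Set.image_comp, dom D.1 D.2, Set.image_univ]
      change prodFst V X '' (fibMap I₁ I₂ '' D.1) ∈ _
      rw [this]
      exact hA.surjective
  · have := range_fibMap I₁ I₂
    rw [Set.biUnion_range]
    change KMotive.circ I₂.support I₁.support = _
    rw [← this, ← Set.image_univ, ← sUnion_irreducibleComponents, Set.sUnion_eq_iUnion,
      Set.image_iUnion]
    rfl

/-- Finite unions of elementary closed subsets are members of `Supp`. -/
lemma exists_isSupp {ι : Type*} {s : Set ι} (hs : s.Finite) {A : ι → Set (prodScheme V X)}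
    (h : ∀ i ∈ s, ∃ S : Set (Closeds (prodScheme V X)), S.Finite ∧ (∀ D ∈ S, IsElementary D) ∧
      A i = ⋃ D ∈ S, (D : Set (prodScheme V X))) :
    ∃ S : Set (Closeds (prodScheme V X)), S.Finite ∧ (∀ D ∈ S, IsElementary D) ∧
      ⋃ i ∈ s, A i = ⋃ D ∈ S, (D : Set (prodScheme V X)) := by
  choose! S hS hel hA using h
  refine ⟨⋃ i ∈ s, S i, hs.biUnion hS, ?_, ?_⟩
  · simp only [Set.mem_iUnion]
    rintro D ⟨i, hi, hD⟩
    exact hel i hi D hD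
  · rw [Set.iUnion₂_congr hA]
    ext x
    simp only [Set.mem_iUnion]
    constructor
    · rintro ⟨i, hi, D, hD, hx⟩
      exact ⟨D, ⟨i, hi, hD⟩, hx⟩
    · rintro ⟨D, ⟨i, hi, hD⟩, hx⟩
      exact ⟨i, hi, D, hD, hx⟩

theorem IsSupp.exists_circ {B : Closeds (prodScheme U X)} {A : Closeds (prodScheme V U)}
    (hB : IsSupp B) (hA : IsSupp A) :
    ∃ C : Closeds (prodScheme V X), IsSupp C ∧ (C : Set (prodScheme V X)) = circ B A := by
  obtain ⟨S, hS, hSel, hBS⟩ := hB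
  obtain ⟨T, hT, hTel, hAT⟩ := hA
  have key := exists_isSupp hS (A := fun B' => ⋃ A' ∈ T, circ B' A') fun B' hB' =>
    exists_isSupp hT fun A' hA' => (hSel B' hB').circ (hTel A' hA')
  obtain ⟨R, hR, hRel, e⟩ := key
  have e' : circ B A = ⋃ B' ∈ S, ⋃ A' ∈ T, circ B' A' := by
    simp only [circ, hBS, hAT, Set.preimage_iUnion₂, Set.iUnion₂_inter, Set.inter_iUnion₂,
      Set.image_iUnion₂]
    exact Set.iUnion₂_comm _
  have hcl : IsClosed (circ B A) := by
    rw [e', e]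
    exact hR.isClosed_biUnion fun D _ => D.isClosed
  exact ⟨⟨circ B A, hcl⟩, ⟨R, hR, hRel, e'.trans e⟩, rfl⟩

/-- On a Noetherian affine open the ideal of C is finitely generated and lies in the radical of the
kernel, so some power lies in the kernel. Finitely many affine opens cover S, and the maximum of the
exponents works. -/
lemma exists_pow_le_ker {Y S : Scheme.{u}} [IsLocallyNoetherian S] [CompactSpace S] (c : Y ⟶ S)
    [QuasiCompact c] (C : Closeds S) (h : Set.range c ⊆ C) :
    ∃ m : ℕ, IdealSheafData.vanishingIdeal C ^ m ≤ c.ker := by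
  have hle : IdealSheafData.vanishingIdeal C ≤ c.ker.radical := by
    rw [← IdealSheafData.vanishingIdeal_support]
    refine IdealSheafData.vanishingIdeal_antimono ?_
    rw [← SetLike.coe_subset_coe, Scheme.Hom.support_ker]
    exact closure_minimal h C.isClosed
  have loc : ∀ W : S.affineOpens, ∃ m : ℕ,
      (IdealSheafData.vanishingIdeal C).ideal W ^ m ≤ c.ker.ideal W := by
    intro W
    have : IsNoetherianRing Γ(S, W) := IsLocallyNoetherian.component_noetherian W
    exact Ideal.exists_pow_le_of_le_radical_of_fg (hle W) (IsNoetherian.noetherian _)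
  choose m hm using loc
  obtain ⟨s, hs, hU⟩ := (isCompact_iff_finite_and_eq_biUnion_affineOpens (U := (⊤ : S.Opens))).mp
    isCompact_univ
  refine ⟨hs.toFinset.sup m, IdealSheafData.le_of_iSup_eq_top (fun i : s => i.1) ?_ ?_⟩
  · rw [hU, iSup_subtype']
  · intro W
    exact (Ideal.pow_le_pow_right (Finset.le_sup (hs.mem_toFinset.mpr W.2))).trans (hm W.1)

/-- The composite of the supports of two members of `SubSch`. -/
theorem exists_composite_support {I₁ : IdealSheafData (prodScheme V U)}
    {I₂ : IdealSheafData (prodScheme U X)} (h₁ : IsSubSch I₁) (h₂ : IsSubSch I₂) :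
    ∃ (C : Closeds (prodScheme V X)) (m : ℕ) (π : fib I₁ I₂ ⟶
      (IdealSheafData.vanishingIdeal C ^ m).subscheme), IsSupp C ∧
      (C : Set (prodScheme V X)) = circ I₂.support I₁.support ∧
      π ≫ IdealSheafData.subschemeι _ = fibMap I₁ I₂ := by
  obtain ⟨C, hC, e⟩ := h₂.isSupp.exists_circ h₁.isSupp
  have := h₁.isFinite
  have := h₂.isFinite
  have : IsFinite (fibMap I₁ I₂) := isFinite_fibMap
  obtain ⟨m, hm⟩ := exists_pow_le_ker (fibMap I₁ I₂) C (by rw [range_fibMap, e])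
  rw [← IdealSheafData.ker_subschemeι (IdealSheafData.vanishingIdeal C ^ m)] at hm
  exact ⟨C, m, IsClosedImmersion.lift _ _ hm, hC, e, IsClosedImmersion.lift_fac _ _ hm⟩

end CompositionOfSupports

/-! ### The diagonal -/

section Diagonal

variable {k : Type u} [Field k] (X : Sm k)

lemma radical_ker {Y S : Scheme.{u}} [AlgebraicGeometry.IsReduced Y] (c : Y ⟶ S) [QuasiCompact c] :
    c.ker.radical = c.ker := by
  refine le_antisymm (fun W x hx => ?_) (IdealSheafData.le_radical _)
  obtain ⟨n, hn⟩ := hx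
  rw [Scheme.Hom.ker_apply, RingHom.mem_ker] at hn ⊢
  rw [map_pow] at hn
  exact IsNilpotent.eq_zero ⟨n, hn⟩

instance : AlgebraicGeometry.IsReduced X.scheme := isReduced_of_smooth X.hom

/-- The diagonal `X ⟶ X × X`. -/
abbrev diag : X.scheme ⟶ prodScheme X X := pullback.diagonal X.hom

/-- Smooth schemes over a field are reduced, so the ideal of the diagonal is radical. It is
therefore the vanishing ideal of its support, and m = 1 suffices. -/
lemma isSubSch_ker_diag : IsSubSch (diag X).ker := by
  let C : Closeds (prodScheme X X) := ⟨Set.range (diag X), (diag X).isClosedEmbedding.isClosed_range⟩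
  have : IsNoetherian X.scheme := { }
  refine ⟨C, ?_, 1, ?_⟩
  · let E : irreducibleComponents X.scheme → Closeds (prodScheme X X) := fun D =>
      ⟨diag X '' D.1, (diag X).isClosedMap _ (isClosed_of_mem_irreducibleComponents _ D.2)⟩
    have : Finite (irreducibleComponents X.scheme) :=
      TopologicalSpace.NoetherianSpace.finite_irreducibleComponents.to_subtype
    refine ⟨Set.range E, Set.finite_range E, ?_, ?_⟩
    · rintro _ ⟨D, rfl⟩
      refine ⟨D.2.1.image _ (diag X).continuous.continuousOn, ?_, ?_⟩
      · refine isFinite_src (diag X) ?_ ?_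
        · rw [pullback.diagonal_fst]
          infer_instance
        · rw [IdealSheafData.coe_support_vanishingIdeal]
          exact Set.image_subset_range _ _
      · have : prodFst X X '' (diag X '' D.1) = D.1 := by
          rw [← Set.image_comp]
          convert Set.image_id _
          ext x
          rw [Function.comp_apply, ← Scheme.Hom.comp_apply, pullback.diagonal_fst]
          rfl
        change prodFst X X '' (diag X '' D.1) ∈ _
        rw [this]
        exact D.2
    · rw [Set.biUnion_range]
      change Set.range (diag X) = _
      rw [← Set.image_univ, ← sUnion_irreducibleComponents, Set.sUnion_eq_iUnion, Set.image_iUnion]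
      rfl
  · have : C = (diag X).ker.support := by
      apply SetLike.coe_injective
      rw [Scheme.Hom.support_ker]
      exact C.isClosed.closure_eq.symm
    rw [pow_one, this, IdealSheafData.vanishingIdeal_support, radical_ker]

end Diagonal

/-! ### Composites of triples -/

section Descend

variable {Y T Z U : Scheme.{u}} {q : Y ⟶ T} {p : Z ⟶ U} {a : Y ⟶ Z} {g : T ⟶ U} {n : ℕ}

/-- This is the universal property of the base change ψ. Locally the functions on Y are generated by
those pulled back from Z, where χ is compatible with φ, and those from T, where linearity applies.
-/
lemma Compat.descend (H : IsPullback a q p g) [IsAffineHom p] {φ : MatHom p n} {ψ : MatHom q n}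
    (h : Compat H.w.symm φ ψ) {Y' T' : Scheme.{u}} {q' : Y' ⟶ T'} {c : Y' ⟶ Y} {d : T' ⟶ T}
    {χ : MatHom q' n} (w' : q' ≫ d = c ≫ q) {w : q' ≫ d ≫ g = (c ≫ a) ≫ p}
    (h' : Compat w φ χ) : Compat w' ψ χ := by
  intro S T₁ hT x
  refine matrix_eq_of_res _ _ fun t ht => ?_
  obtain ⟨W, S', hW, hS', h₂, -, h₁, htS⟩ := exists_affine_pair g (W := ⊤) (hT ht) trivial
  let T₂ : T'.Opens := T₁ ⊓ d ⁻¹ᵁ S'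
  have hT₂ : T₂ ≤ d ⁻¹ᵁ S' := inf_le_right
  refine ⟨T₂, inf_le_left, ⟨ht, htS⟩, ?_⟩
  rw [← χ.app_res, res_pb, ← pb_res c (preimage_le_of_comm w' hT₂) (q.preimage_mono h₁)]
  have e : ((ψ.app S x).map (pb d hT)).map (res (inf_le_left : T₂ ≤ T₁)) =
      (ψ.app S' (res (q.preimage_mono h₁) x)).map (pb d hT₂) := by
    rw [ψ.app_res h₁]
    ext i j
    simp only [Matrix.map_apply, res_pb, pb_res]
  rw [e]
  generalize res (q.preimage_mono h₁) x = y
  refine pushout_induction (isPushout_pair H hW hS' h₂)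
    (C := fun y => χ.app T₂ (pb c (preimage_le_of_comm w' hT₂) y) = (ψ.app S' y).map (pb d hT₂))
    (fun r b => ?_) (fun y z hy hz => ?_) y
  · change χ.app T₂ (pb c _ (pb q le_rfl r * pb a (preimage_le_of_comm H.w.symm h₂) b)) =
      (ψ.app S' (pb q le_rfl r * pb a (preimage_le_of_comm H.w.symm h₂) b)).map _
    rw [ψ.app_pb_mul, h W S' h₂, map_mul, pb_pb, pb_pb, pb_congr w'.symm]
    have e₁ : pb (q' ≫ d) (hT₂.trans (d.preimage_mono le_rfl) |> q'.preimage_mono) r =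
        pb q' (W := T₂) le_rfl (pb d hT₂ r) := by
      rw [pb_pb]
    have e₂ := h' W T₂ (hT₂.trans (d.preimage_mono h₂)) b
    have e₃ := χ.app_pb_mul T₂ (pb d hT₂ r) (pb (c ≫ a)
      (preimage_le_of_comm w (hT₂.trans (d.preimage_mono h₂))) b)
    rw [e₂, pb_pb] at e₃
    refine e₃.trans ?_
    ext i j
    simp only [Matrix.map_apply, Matrix.smul_apply, smul_eq_mul, map_mul, pb_pb]
  · rw [map_add, map_add, map_add, hy, hz]
    ext; simp

lemma Compat.comap_left {w : q ≫ g = a ≫ p} {φ : MatHom p n} {ψ : MatHom q n} (h : Compat w φ ψ)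
    {X : Scheme.{u}} {r : X ⟶ U} (c : Z ⟶ X) (hc : c ≫ r = p) :
    Compat (by rw [Category.assoc, hc, w] : q ≫ g = (a ≫ c) ≫ r) (φ.comap c hc) ψ := by
  intro W S hS x
  rw [MatHom.comap_app', ← h W S hS, pb_pb]

/-- If φ₁ factors through functions on a scheme T' over its support T, then the composite can be
formed over T' with the base change to T'. -/
lemma MatHom.star_comap {T' V Y' : Scheme.{u}} {q' : Y' ⟶ T'} {c : Y' ⟶ Y} {d : T' ⟶ T}
    {w : q' ≫ d = c ≫ q} {ψ : MatHom q n} {χ : MatHom q' n} (h : Compat w ψ χ) {m : ℕ}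
    {p : T ⟶ V} {p' : T' ⟶ V} (φ : MatHom p' m) (hp : d ≫ p = p') :
    ψ.star (φ.comap d hp) = (χ.star φ).comap c (by rw [← hp, reassoc_of% w]) := by
  refine ext_app fun W f => ?_
  subst hp
  have e := h (p ⁻¹ᵁ W) (d ⁻¹ᵁ p ⁻¹ᵁ W) le_rfl f
  change blockRect ((ψ.app (p ⁻¹ᵁ W) f).map fun x => φ.app W (pb d le_rfl x)) =
    blockRect ((χ.app (d ⁻¹ᵁ p ⁻¹ᵁ W) (pb c (preimage_le_of_comm w le_rfl) f)).map (φ.app W))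
  rw [e]
  rfl

end Descend

/-! ### Classes represented on arbitrary schemes over the product, and composites of classes. -/

section Composites

variable {k : Type u} [Field k] {W V U X : Sm k}

/-- Homomorphisms induced by the same homomorphism have the same class. -/
lemma Triple.mk_eq_mk {Y : Scheme.{u}} {n : ℕ} {p : Y ⟶ U.scheme} (χ : MatHom p n)
    {t t' : Triple U X n} (g : Y ⟶ t.ideal.subscheme) (g' : Y ⟶ t'.ideal.subscheme)
    (w : g ≫ src t.ideal = p) (w' : g' ≫ src t'.ideal = p)
    (e : g ≫ tgt t.ideal = g' ≫ tgt t'.ideal) (h : t.hom = χ.comap g w)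
    (h' : t'.hom = χ.comap g' w') :
    (Quotient.mk _ t : Quotient (Triple.setoid U X n)) = Quotient.mk _ t' := by
  obtain ⟨J, hJ, hJt, hJt'⟩ := t.isSubSch.exists_le t'.isSubSch
  refine Quotient.sound ⟨J, hJ, hJt, hJt', fun O f => ?_⟩
  have hg : g ≫ IdealSheafData.inclusion hJt = g' ≫ IdealSheafData.inclusion hJt' := by
    rw [← cancel_mono J.subschemeι, Category.assoc, Category.assoc,
      IdealSheafData.inclusion_subschemeι, IdealSheafData.inclusion_subschemeι]
    refine pullback.hom_ext ?_ ?_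
    · simpa using w.trans w'.symm
    · simpa using e
  rw [h, h', MatHom.comap_app, MatHom.comap_app]
  congr 1
  change pb g _ (pb _ _ f) = pb g' _ (pb _ _ f)
  rw [pb_pb, pb_pb, pb_congr hg]

/-- The object `Φ` is represented by `χ`, where `q` is a morphism to `X`. -/
def Rep (Φ : Corr U X) {Y : Scheme.{u}} {n : ℕ} (p : Y ⟶ U.scheme) (q : Y ⟶ X.scheme)
    (χ : MatHom p n) : Prop :=
  ∃ (t : Triple U X n) (g : Y ⟶ t.ideal.subscheme) (w : g ≫ src t.ideal = p),
    g ≫ tgt t.ideal = q ∧ t.hom = χ.comap g w ∧ Φ = t.toCorr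

/-- The maps p and q fix the morphism from Y to U × X. On a common larger support both triples are
therefore pullback of functions to Y followed by χ. -/
lemma Rep.unique {Φ Ψ : Corr U X} {Y : Scheme.{u}} {n : ℕ} {p : Y ⟶ U.scheme} {q : Y ⟶ X.scheme}
    {χ : MatHom p n} (h : Rep Φ p q χ) (h' : Rep Ψ p q χ) : Φ = Ψ := by
  obtain ⟨t, g, w, e, ht, rfl⟩ := h
  obtain ⟨t', g', w', e', ht', rfl⟩ := h'
  exact congr_arg (Corr.mk n) (Triple.mk_eq_mk χ g g' w w' (e.trans e'.symm) ht ht')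

lemma MatHom.comap_id {Z U : Scheme.{u}} {p : Z ⟶ U} {n : ℕ} (χ : MatHom p n)
    (w : 𝟙 Z ≫ p = p) : χ.comap (𝟙 Z) w = χ := by
  refine ext_app fun W f => ?_
  rw [comap_app', pb_id, res_self]

lemma Triple.rep {n : ℕ} (t : Triple U X n) : Rep t.toCorr (src t.ideal) (tgt t.ideal) t.hom :=
  ⟨t, 𝟙 _, Category.id_comp _, Category.id_comp _, (t.hom.comap_id _).symm, rfl⟩

lemma Rep.of_comap {Φ : Corr U X} {Y Z : Scheme.{u}} {n : ℕ} {p : Y ⟶ U.scheme} {q : Y ⟶ X.scheme}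
    {p' : Z ⟶ U.scheme} {q' : Z ⟶ X.scheme} {χ : MatHom p n} (c : Y ⟶ Z) (w : c ≫ p' = p)
    (e : c ≫ q' = q) (h : Rep Φ p' q' (χ.comap c w)) : Rep Φ p q χ := by
  obtain ⟨t, g, w', e', ht, rfl⟩ := h
  refine ⟨t, c ≫ g, by rw [Category.assoc, w', w], by rw [Category.assoc, e', e], ?_, rfl⟩
  rw [ht, MatHom.comap_comap]

/-- The coefficient a is recovered from linearity of ψ. The passage from affine opens to all opens
uses uniqueness of the base change, which needs Z₂ ⟶ U to be affine. -/
lemma isBaseChange_iff {I₁ : IdealSheafData (prodScheme V U)} {n₂ : ℕ} {t₂ : Triple U X n₂}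
    {ψ : MatHom (fibFst I₁ t₂.ideal) n₂} :
    IsBaseChange I₁ t₂ ψ ↔ Compat pullback.condition t₂.hom ψ := by
  have := t₂.isSubSch.isFinite
  constructor
  · intro h
    refine Compat.of_affine (IsPullback.of_hasPullback (tgt I₁) (src t₂.ideal)).flip
      fun U' Z' hU hZ hle b => ?_
    have := h U' Z' hU hZ hle 1 b
    rw [map_one, one_mul, one_smul] at this
    exact this
  · intro h U' Z' hU hZ hle a b
    rw [app_eq_pb]
    exact (ψ.app_pb_mul Z' a _).trans (congr_arg (a • ·) (h U' Z' hle b))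

/-- A composite of triples, in terms of its defining homomorphism. -/
lemma IsComposite.exists_compat {n₁ n₂ : ℕ} {t₁ : Triple V U n₁} {t₂ : Triple U X n₂}
    {t₃ : Triple V X (n₂ * n₁)} (h : IsComposite t₁ t₂ t₃) :
    ∃ ψ : MatHom (fibFst t₁.ideal t₂.ideal) n₂, Compat pullback.condition t₂.hom ψ ∧
      ∃ (π : fib t₁.ideal t₂.ideal ⟶ t₃.ideal.subscheme)
        (w : π ≫ src t₃.ideal = fibFst t₁.ideal t₂.ideal ≫ src t₁.ideal),
        π ≫ tgt t₃.ideal = fibSnd t₁.ideal t₂.ideal ≫ tgt t₂.ideal ∧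
        t₃.hom = (ψ.star t₁.hom).comap π w := by
  obtain ⟨-, π, w, e, ψ, hψ, H⟩ := h
  exact ⟨ψ, isBaseChange_iff.mp hψ, π, w, e, MatHom.ext_app H⟩

theorem exists_isComposite {n₁ n₂ : ℕ} (t₁ : Triple V U n₁) (t₂ : Triple U X n₂) :
    ∃ t₃ : Triple V X (n₂ * n₁), IsComposite t₁ t₂ t₃ := by
  have := t₂.isSubSch.isFinite
  obtain ⟨C, m, π, hC, e, hπ⟩ := exists_composite_support t₁.isSubSch t₂.isSubSch
  obtain ⟨ψ, hψ⟩ := KMotive.exists_compat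
    (IsPullback.of_hasPullback (tgt t₁.ideal) (src t₂.ideal)).flip t₂.hom
  have w : π ≫ src (IdealSheafData.vanishingIdeal C ^ m) =
      fibFst t₁.ideal t₂.ideal ≫ src t₁.ideal := by
    rw [← fibMap_fst, ← hπ, Category.assoc]
  have w' : π ≫ tgt (IdealSheafData.vanishingIdeal C ^ m) =
      fibSnd t₁.ideal t₂.ideal ≫ tgt t₂.ideal := by
    rw [← fibMap_snd, ← hπ, Category.assoc]
  exact ⟨⟨_, ⟨C, hC, m, rfl⟩, (ψ.star t₁.hom).comap π w⟩, ⟨C, m, e, rfl⟩, π, w, w', ψ,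
    isBaseChange_iff.mpr hψ, fun _ _ => rfl⟩

/-- Computation of composites from arbitrary representatives. -/
theorem IsComposite.rep {n₁ n₂ : ℕ} {t₁ : Triple V U n₁} {t₂ : Triple U X n₂}
    {t₃ : Triple V X (n₂ * n₁)} (h : IsComposite t₁ t₂ t₃) {Y Y₁ Y₂ : Scheme.{u}}
    {p₁ : Y₁ ⟶ V.scheme} {r₁ : Y₁ ⟶ U.scheme} {χ₁ : MatHom p₁ n₁} (g₁ : Y₁ ⟶ t₁.ideal.subscheme)
    (w₁ : g₁ ≫ src t₁.ideal = p₁) (e₁ : g₁ ≫ tgt t₁.ideal = r₁) (h₁ : t₁.hom = χ₁.comap g₁ w₁)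
    {p₂ : Y₂ ⟶ U.scheme} {r₂ : Y₂ ⟶ X.scheme} {χ₂ : MatHom p₂ n₂} (g₂ : Y₂ ⟶ t₂.ideal.subscheme)
    (w₂ : g₂ ≫ src t₂.ideal = p₂) (e₂ : g₂ ≫ tgt t₂.ideal = r₂) (h₂ : t₂.hom = χ₂.comap g₂ w₂)
    {q : Y ⟶ Y₁} {a : Y ⟶ Y₂} {w : q ≫ r₁ = a ≫ p₂} {ψ : MatHom q n₂} (hψ : Compat w χ₂ ψ) :
    Rep t₃.toCorr (q ≫ p₁) (a ≫ r₂) (ψ.star χ₁) := by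
  have := t₂.isSubSch.isFinite
  obtain ⟨ψ₀, hψ₀, π, wπ, eπ, h₃⟩ := h.exists_compat
  let c : Y ⟶ fib t₁.ideal t₂.ideal := pullback.lift (q ≫ g₁) (a ≫ g₂)
    (by rw [Category.assoc, Category.assoc, e₁, w₂, w])
  have hc₁ : q ≫ g₁ = c ≫ fibFst t₁.ideal t₂.ideal := (pullback.lift_fst _ _ _).symm
  have hc₂ : c ≫ fibSnd t₁.ideal t₂.ideal = a ≫ g₂ := pullback.lift_snd _ _ _
  -- Both ψ₀ on Z₁ ×_U Z₂ and ψ on Y come from φ₂, so ψ is the pullback of ψ₀ along c.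
  have key : Compat hc₁ ψ₀ ψ := by
    refine hψ₀.descend (IsPullback.of_hasPullback (tgt t₁.ideal) (src t₂.ideal)).flip hc₁
      (w := by rw [hc₂, e₁, Category.assoc, w₂, w]) ?_
    have := hψ.comap_left g₂ w₂
    rw [← h₂] at this
    subst e₁
    convert this
  have e := MatHom.star_comap key χ₁ w₁
  rw [← h₁] at e
  refine ⟨t₃, c ≫ π, ?_, ?_, ?_, rfl⟩
  · rw [Category.assoc, wπ, ← reassoc_of% hc₁, w₁]
  · rw [Category.assoc, eπ, reassoc_of% hc₂, e₂]
  · rw [h₃, e, MatHom.comap_comap]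

lemma IsComposite.rep_self {n₁ n₂ : ℕ} {t₁ : Triple V U n₁} {t₂ : Triple U X n₂}
    {t₃ : Triple V X (n₂ * n₁)} (h : IsComposite t₁ t₂ t₃)
    {ψ : MatHom (fibFst t₁.ideal t₂.ideal) n₂} (hψ : Compat pullback.condition t₂.hom ψ) :
    Rep t₃.toCorr (fibFst t₁.ideal t₂.ideal ≫ src t₁.ideal)
      (fibSnd t₁.ideal t₂.ideal ≫ tgt t₂.ideal) (ψ.star t₁.hom) :=
  h.rep (𝟙 _) (Category.id_comp _) (Category.id_comp _) (t₁.hom.comap_id _).symm (𝟙 _)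
    (Category.id_comp _) (Category.id_comp _) (t₂.hom.comap_id _).symm hψ

/-- Composites only depend on the classes. -/
theorem IsComposite.toCorr_eq {n₁ n₂ : ℕ} {t₁ s₁ : Triple V U n₁} {t₂ s₂ : Triple U X n₂}
    {t₃ s₃ : Triple V X (n₂ * n₁)} (h : IsComposite t₁ t₂ t₃) (h' : IsComposite s₁ s₂ s₃)
    (h₁ : t₁ ≈ s₁) (h₂ : t₂ ≈ s₂) : t₃.toCorr = s₃.toCorr := by
  obtain ⟨J₁, hJ₁, i₁, j₁, e₁⟩ := h₁
  obtain ⟨J₂, hJ₂, i₂, j₂, e₂⟩ := h₂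
  have hw : ∀ {A B : Sm k} {I J : IdealSheafData (prodScheme A B)} (h : J ≤ I),
      IdealSheafData.inclusion h ≫ src J = src I := by simp [src]
  have hw' : ∀ {A B : Sm k} {I J : IdealSheafData (prodScheme A B)} (h : J ≤ I),
      IdealSheafData.inclusion h ≫ tgt J = tgt I := by simp [tgt]
  have E₁ : t₁.hom.comap _ (hw i₁) = s₁.hom.comap _ (hw j₁) := MatHom.ext_app e₁
  have E₂ : t₂.hom.comap _ (hw i₂) = s₂.hom.comap _ (hw j₂) := MatHom.ext_app e₂
  -- On the enlarged supports the two pairs of homomorphisms coincide. The composite u of these is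
  -- represented by the data of either given composite.
  obtain ⟨u, hu⟩ := exists_isComposite ⟨J₁, hJ₁, t₁.hom.comap _ (hw i₁)⟩
    ⟨J₂, hJ₂, t₂.hom.comap _ (hw i₂)⟩
  obtain ⟨ψ, hψ, -⟩ := h.exists_compat
  obtain ⟨ψ', hψ', -⟩ := h'.exists_compat
  have r₁ := hu.rep (χ₁ := t₁.hom) _ (hw i₁) (hw' i₁) rfl (χ₂ := t₂.hom) _ (hw i₂) (hw' i₂) rfl hψ
  have r₂ := hu.rep (χ₁ := s₁.hom) _ (hw j₁) (hw' j₁) E₁ (χ₂ := s₂.hom) _ (hw j₂) (hw' j₂) E₂ hψ'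
  exact ((h.rep_self hψ).unique r₁).trans ((h'.rep_self hψ').unique r₂).symm

end Composites

/-! ### Morphisms as matrices -/

/-- The restriction of a matrix of global functions. -/
abbrev rmap {U : Scheme.{u}} {α β : Type*} (M : Matrix α β Γ(U, ⊤)) (W : U.Opens) :
    Matrix α β Γ(U, W) :=
  M.map (res le_top)

namespace Corr

variable {k : Type u} [Field k] {U X : Sm k}

@[simp]
lemma coe_proj (Φ : Corr U X) (W : U.scheme.Opens) (v : Fin Φ.n → Γ(U.scheme, W)) :
    (Φ.proj W v : Fin Φ.n → Γ(U.scheme, W)) = (Φ.idem W).mulVec v := rfl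

lemma idem_res (Φ : Corr U X) {W W' : U.scheme.Opens} (h : W' ≤ W) :
    (Φ.idem W).map (res h) = Φ.idem W' := by
  obtain ⟨n, c⟩ := Φ
  induction c using Quotient.inductionOn with | h t
  change (t.hom.app W 1).map (res h) = t.hom.app W' 1
  rw [← t.hom.app_res, map_one]

lemma idem_mul_idem (Φ : Corr U X) (W : U.scheme.Opens) : Φ.idem W * Φ.idem W = Φ.idem W := by
  obtain ⟨n, c⟩ := Φ
  induction c using Quotient.inductionOn with | h t
  change t.hom.app W 1 * t.hom.app W 1 = t.hom.app W 1
  rw [← map_mul, one_mul]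

lemma mem_P {Φ : Corr U X} {W : U.scheme.Opens} {x : Fin Φ.n → Γ(U.scheme, W)} :
    x ∈ Φ.P W ↔ (Φ.idem W).mulVec x = x := by
  constructor
  · rintro ⟨y, rfl⟩
    rw [Matrix.mulVecLin_apply, Matrix.mulVec_mulVec, idem_mul_idem]
  · intro h
    exact ⟨x, h⟩

/-- The action of functions on `X`. -/
def act (Φ : Corr U X) (c : Γ(X.scheme, ⊤)) : Matrix (Fin Φ.n) (Fin Φ.n) Γ(U.scheme, ⊤) :=
  Quotient.lift (fun t : Triple U X Φ.n => t.hom.app ⊤ (rPull t.ideal ⊤ c))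
    (by
      rintro t t' ⟨J, _, h, h', e⟩
      have key : ∀ {I : IdealSheafData (prodScheme U X)} (h : J ≤ I),
          can h ⊤ (rPull J ⊤ c) = rPull I ⊤ c := by
        intro I h
        exact (pb_pb (tgt J) (IdealSheafData.inclusion h) _ _ c).trans
          (pb_congr (by simp [tgt]) _ c)
      have := e ⊤ (rPull J ⊤ c)
      rwa [key, key] at this) Φ.cls

lemma act_eq {Φ : Corr U X} {t : Triple U X Φ.n} (h : Quotient.mk _ t = Φ.cls)
    (c : Γ(X.scheme, ⊤)) : Φ.act c = t.hom.app ⊤ (rPull t.ideal ⊤ c) := by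
  rw [act, ← h]
  rfl

lemma idem_eq {Φ : Corr U X} {t : Triple U X Φ.n} (h : Quotient.mk _ t = Φ.cls)
    (W : U.scheme.Opens) : Φ.idem W = t.hom.app W 1 := by
  rw [idem, ← h]
  rfl

lemma act_add (Φ : Corr U X) (c d : Γ(X.scheme, ⊤)) : Φ.act (c + d) = Φ.act c + Φ.act d := by
  obtain ⟨t, ht⟩ := Quotient.exists_rep Φ.cls
  simp only [act_eq ht, map_add]

lemma act_zero (Φ : Corr U X) : Φ.act 0 = 0 := by
  obtain ⟨t, ht⟩ := Quotient.exists_rep Φ.cls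
  simp only [act_eq ht, map_zero]

lemma act_mul (Φ : Corr U X) (c d : Γ(X.scheme, ⊤)) : Φ.act (c * d) = Φ.act c * Φ.act d := by
  obtain ⟨t, ht⟩ := Quotient.exists_rep Φ.cls
  simp only [act_eq ht, map_mul]

lemma act_one (Φ : Corr U X) : Φ.act 1 = Φ.idem ⊤ := by
  obtain ⟨t, ht⟩ := Quotient.exists_rep Φ.cls
  simp only [act_eq ht, idem_eq ht, map_one]

lemma act_mul_idem (Φ : Corr U X) (c : Γ(X.scheme, ⊤)) : Φ.act c * Φ.idem ⊤ = Φ.act c := by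
  rw [← act_one, ← act_mul, mul_one]

lemma act_sum (Φ : Corr U X) {ι : Type*} (s : Finset ι) (c : ι → Γ(X.scheme, ⊤)) :
    Φ.act (∑ i ∈ s, c i) = ∑ i ∈ s, Φ.act (c i) :=
  map_sum (⟨⟨Φ.act, Φ.act_zero⟩, Φ.act_add⟩ : _ →+ _) c s

/-- A morphism is the multiplication by its matrix. -/
lemma Hom.app_eq {Φ Ψ : Corr U X} (α : Φ ⟶ Ψ) (W : U.scheme.Opens) (x : Φ.P W) :
    (Hom.app α W x : Fin Ψ.n → Γ(U.scheme, W)) =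
      (rmap (Hom.matrix α) W).mulVec x := by
  have h₁ : x = ∑ j, (x : Fin Φ.n → Γ(U.scheme, W)) j • Φ.proj W (Pi.single j 1) := by
    ext i
    conv_lhs => rw [← mem_P.mp x.2]
    simp [Matrix.mulVec, dotProduct, mul_comm, Finset.sum_apply]
  conv_lhs => rw [h₁]
  rw [map_sum]
  have h₂ : ∀ j, (Hom.app α W (Φ.proj W (Pi.single j 1)) : Fin Ψ.n → Γ(U.scheme, W)) =
      fun i => res le_top (Hom.matrix α i j) := by
    intro j
    have := α.2.1 ⊤ W le_top (Φ.proj ⊤ (Pi.single j 1)) (Φ.proj W (Pi.single j 1)) (by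
      ext i
      simp only [coe_proj, Matrix.mulVec_single_one]
      rw [← idem_res Φ le_top]
      rfl)
    exact this
  ext i
  simp only [map_smul, Submodule.coe_sum, Submodule.coe_smul, Finset.sum_apply, Pi.smul_apply, h₂,
    smul_eq_mul, Matrix.mulVec, dotProduct, Matrix.map_apply, mul_comm]

lemma Hom.ext_app {Φ Ψ : Corr U X} {α β : Φ ⟶ Ψ}
    (h : ∀ W x, Hom.app α W x = Hom.app β W x) : α = β :=
  Subtype.ext (funext fun W => LinearMap.ext (h W))

lemma Hom.matrix_injective {Φ Ψ : Corr U X} {α β : Φ ⟶ Ψ} (h : Hom.matrix α = Hom.matrix β) :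
    α = β := by
  refine Hom.ext_app fun W x => Subtype.ext ?_
  rw [app_eq, app_eq, h]

lemma Hom.idem_mul_matrix {Φ Ψ : Corr U X} (α : Φ ⟶ Ψ) :
    Ψ.idem ⊤ * Hom.matrix α = Hom.matrix α := by
  ext i j
  exact congr_fun (mem_P.mp (Hom.app α ⊤ (Φ.proj ⊤ (Pi.single j 1))).2) i

lemma map_res_top {U : Scheme.{u}} {α β : Type*} (M : Matrix α β Γ(U, ⊤)) :
    rmap M ⊤ = M := by
  ext i j
  exact res_self _ _

/-- The factor `Φ.idem ⊤` normalizes M: different matrices may induce the same map on P(φ), and only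
the one that absorbs the idempotent is the matrix of the morphism. -/
lemma matrix_eq_of_col {Φ Ψ : Corr U X} {α : Φ ⟶ Ψ} {M : Matrix (Fin Ψ.n) (Fin Φ.n) Γ(U.scheme, ⊤)}
    (h : ∀ x : Φ.P ⊤, (Hom.app α ⊤ x : Fin Ψ.n → Γ(U.scheme, ⊤)) = M.mulVec x) :
    Hom.matrix α = M * Φ.idem ⊤ := by
  ext i j
  change (Hom.app α ⊤ (Φ.proj ⊤ (Pi.single j 1)) : Fin Ψ.n → Γ(U.scheme, ⊤)) i = _
  rw [h]
  simp only [coe_proj, Matrix.mulVec_single_one]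
  rfl

lemma Hom.matrix_mul_idem {Φ Ψ : Corr U X} (α : Φ ⟶ Ψ) :
    Hom.matrix α * Φ.idem ⊤ = Hom.matrix α := by
  refine (matrix_eq_of_col fun x => ?_).symm
  rw [app_eq, map_res_top]

lemma Hom.matrix_id (Φ : Corr U X) : Hom.matrix (𝟙 Φ) = Φ.idem ⊤ := by
  rw [matrix_eq_of_col (α := 𝟙 Φ) (M := 1), one_mul]
  intro x
  rw [Matrix.one_mulVec]
  rfl

lemma Hom.matrix_comp {Φ Ψ Θ : Corr U X} (α : Φ ⟶ Ψ) (β : Ψ ⟶ Θ) :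
    Hom.matrix (α ≫ β) = Hom.matrix β * Hom.matrix α := by
  rw [matrix_eq_of_col (α := α ≫ β) (M := Hom.matrix β * Hom.matrix α), Matrix.mul_assoc, matrix_mul_idem]
  intro x
  change (Hom.app β ⊤ (Hom.app α ⊤ x) : Fin Θ.n → Γ(U.scheme, ⊤)) = _
  rw [app_eq, app_eq, map_res_top, map_res_top, Matrix.mulVec_mulVec]

lemma Hom.matrix_add {Φ Ψ : Corr U X} (α β : Φ ⟶ Ψ) :
    Hom.matrix (α + β) = Hom.matrix α + Hom.matrix β := rfl

lemma Hom.matrix_zero (Φ Ψ : Corr U X) : Hom.matrix (0 : Φ ⟶ Ψ) = 0 := rfl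

end Corr

/-- The multiplication by `M` is linear. -/
def Lin {Y U : Scheme.{u}} {p : Y ⟶ U} {n n' : ℕ} (χ : MatHom p n) (χ' : MatHom p n')
    (M : Matrix (Fin n') (Fin n) Γ(U, ⊤)) : Prop :=
  ∀ (W : U.Opens) (f : Γ(Y, p ⁻¹ᵁ W)),
    rmap M W * χ.app W f = χ'.app W f * rmap M W

lemma Lin.comap {Y Z U : Scheme.{u}} {p : Y ⟶ U} {q : Z ⟶ U} {n n' : ℕ} {χ : MatHom p n}
    {χ' : MatHom p n'} {M : Matrix (Fin n') (Fin n) Γ(U, ⊤)} (h : Lin χ χ' M) (g : Y ⟶ Z)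
    (w : g ≫ q = p) : Lin (χ.comap g w) (χ'.comap g w) M :=
  fun W _ => h W _

/-! ### Linearity over common supports, and morphisms defined by matrices. -/

section Hom

variable {k : Type u} [Field k] {U X : Sm k}

lemma inclusion_src {I J : IdealSheafData (prodScheme U X)} (h : J ≤ I) :
    IdealSheafData.inclusion h ≫ src J = src I := by simp [src]

lemma inclusion_tgt {I J : IdealSheafData (prodScheme U X)} (h : J ≤ I) :
    IdealSheafData.inclusion h ≫ tgt J = tgt I := by simp [tgt]

/-- Enlarging the support of a triple. -/
lemma Triple.enlarge {n : ℕ} (t : Triple U X n) {J : IdealSheafData (prodScheme U X)}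
    (hJ : IsSubSch J) (h : J ≤ t.ideal) :
    (Quotient.mk _ ⟨J, hJ, t.hom.comap _ (inclusion_src h)⟩ : Quotient (Triple.setoid U X n)) =
      Quotient.mk _ t :=
  Triple.mk_eq_mk t.hom (IdealSheafData.inclusion h) (𝟙 _) (inclusion_src h) (Category.id_comp _)
    (by rw [Category.id_comp]; exact inclusion_tgt h) rfl (t.hom.comap_id _).symm

lemma Corr.exists_common (Φ Ψ : Corr U X) : ∃ (J : IdealSheafData (prodScheme U X))
    (hJ : IsSubSch J) (χ : MatHom (src J) Φ.n) (χ' : MatHom (src J) Ψ.n),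
    Quotient.mk _ ⟨J, hJ, χ⟩ = Φ.cls ∧ Quotient.mk _ ⟨J, hJ, χ'⟩ = Ψ.cls := by
  obtain ⟨t, ht⟩ := Quotient.exists_rep Φ.cls
  obtain ⟨t', ht'⟩ := Quotient.exists_rep Ψ.cls
  obtain ⟨J, hJ, h, h'⟩ := t.isSubSch.exists_le t'.isSubSch
  exact ⟨J, hJ, _, _, (t.enlarge hJ h).trans ht, (t'.enlarge hJ h').trans ht'⟩

/-- Since Z'' is finite over U, the preimage of W is affine, and a closed immersion is surjective on
functions over an affine open. -/
lemma can_surjective {I J : IdealSheafData (prodScheme U X)} (h : J ≤ I) (hJ : IsSubSch J)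
    {W : U.scheme.Opens} (hW : IsAffineOpen W) : Function.Surjective (can h W) := by
  have := hJ.isFinite
  have : IsClosedImmersion (IdealSheafData.inclusion h) := by
    have : IsClosedImmersion (IdealSheafData.inclusion h ≫ J.subschemeι) := by
      rw [IdealSheafData.inclusion_subschemeι]
      infer_instance
    exact IsClosedImmersion.of_comp _ J.subschemeι
  intro f
  obtain ⟨f', hf'⟩ := (IdealSheafData.inclusion h).app_surjective (src J ⁻¹ᵁ W)
    (hW.preimage (src J)) (res (by rw [← Scheme.Hom.comp_preimage, inclusion_src]) f)
  refine ⟨f', ?_⟩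
  have e := congr_arg (res (show src I ⁻¹ᵁ W ≤ IdealSheafData.inclusion h ⁻¹ᵁ (src J ⁻¹ᵁ W) by
    rw [← Scheme.Hom.comp_preimage, inclusion_src])) ((app_eq_pb _ _ f').symm.trans hf')
  rw [res_res, res_self, res_pb] at e
  exact e

/-- Morphisms are linear over every common support. -/
theorem Corr.Hom.lin {Φ Ψ : Corr U X} (α : Φ ⟶ Ψ) {J : IdealSheafData (prodScheme U X)}
    {hJ : IsSubSch J} {χ : MatHom (src J) Φ.n} {χ' : MatHom (src J) Ψ.n}
    (h : Quotient.mk _ ⟨J, hJ, χ⟩ = Φ.cls) (h' : Quotient.mk _ ⟨J, hJ, χ'⟩ = Ψ.cls) :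
    Lin χ χ' (Hom.matrix α) := by
  obtain ⟨-, t, t', J', j, j', ht, ht', hJ', H⟩ := α.2
  obtain ⟨L, l, l', hL, G⟩ := H.change hJ' (ht.trans h.symm) (ht'.trans h'.symm)
  -- Linearity is known only on P(φ) and over some larger support L. As φ(f) absorbs p(φ) on both
  -- sides, it yields an identity of matrices for functions that come from L.
  have key : ∀ (W : U.scheme.Opens) (f : Γ(L.subscheme, src L ⁻¹ᵁ W)),
      rmap (Hom.matrix α) W * χ.app W (can l W f) =
        χ'.app W (can l W f) * rmap (Hom.matrix α) W := by
    intro W f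
    refine Matrix.mulVec_injective ?_
    ext v : 1
    have h₁ : (χ.app W (can l W f)).mulVec v ∈ Φ.P W := by
      rw [mem_P, idem_eq h, Matrix.mulVec_mulVec, ← map_mul, one_mul]
    have h₂ : (χ.app W (can l W f)).mulVec v =
        (χ.app W (can l W f)).mulVec (Φ.proj W v : Fin Φ.n → Γ(U.scheme, W)) := by
      rw [coe_proj, idem_eq h, Matrix.mulVec_mulVec, ← map_mul, mul_one]
    have h₃ := G W f (Φ.proj W v) ⟨_, h₁⟩ h₂
    have h₄ := Hom.app_eq α W ⟨_, h₁⟩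
    have h₅ := Hom.app_eq α W (Φ.proj W v)
    rw [← Matrix.mulVec_mulVec, ← Matrix.mulVec_mulVec]
    have h₆ : (rmap (Hom.matrix α) W).mulVec (Φ.proj W v : Fin Φ.n → Γ(U.scheme, W)) =
        (rmap (Hom.matrix α) W).mulVec v := by
      rw [coe_proj, Matrix.mulVec_mulVec, ← idem_res Φ le_top, ← Matrix.map_mul, matrix_mul_idem]
    rw [← h₆, ← h₅, ← h₄]
    exact h₃
  intro W f
  refine matrix_eq_of_res _ _ fun x hx => ?_
  obtain ⟨_, ⟨W', hW, rfl⟩, hxW, hle⟩ :=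
    U.scheme.isBasis_affineOpens.exists_subset_of_mem_open hx W.isOpen
  refine ⟨W', hle, hxW, ?_⟩
  -- Locally on U every function on the given support extends to L.
  obtain ⟨f', hf'⟩ := can_surjective l hL hW (res ((src J).preimage_mono hle) f)
  have := key W' f'
  rw [hf', χ.app_res hle, χ'.app_res hle] at this
  rw [Matrix.map_mul, Matrix.map_mul]
  convert this using 2 <;>
  · ext i j
    exact res_res _ _ _

/-- The morphism with a given matrix. -/
def Corr.homOf {Φ Ψ : Corr U X} (M : Matrix (Fin Ψ.n) (Fin Φ.n) Γ(U.scheme, ⊤))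
    (h : Ψ.idem ⊤ * M = M) (H : ∃ (J : IdealSheafData (prodScheme U X)) (hJ : IsSubSch J)
      (χ : MatHom (src J) Φ.n) (χ' : MatHom (src J) Ψ.n), Quotient.mk _ ⟨J, hJ, χ⟩ = Φ.cls ∧
      Quotient.mk _ ⟨J, hJ, χ'⟩ = Ψ.cls ∧ Lin χ χ' M) : Φ ⟶ Ψ :=
  ⟨fun W => ((rmap M W).mulVecLin.comp (Φ.P W).subtype).codRestrict (Ψ.P W) fun x => by
      rw [mem_P, LinearMap.comp_apply, Matrix.mulVecLin_apply, Matrix.mulVec_mulVec,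
        ← idem_res Ψ le_top, ← Matrix.map_mul, h], by
    refine ⟨fun W W' hW x y e => ?_, ?_⟩
    · ext i
      simp only [LinearMap.codRestrict_apply, LinearMap.comp_apply, Submodule.subtype_apply, e,
        Matrix.mulVecLin_apply, Matrix.mulVec, dotProduct, resVec]
      change _ = res hW _
      rw [map_sum]
      refine Finset.sum_congr rfl fun j _ => ?_
      rw [map_mul]
      exact congr_arg (· * _) (res_res _ hW (M i j)).symm
    · obtain ⟨J, hJ, χ, χ', hχ, hχ', hlin⟩ := H
      refine ⟨⟨J, hJ, χ⟩, ⟨J, hJ, χ'⟩, J, le_rfl, le_rfl, hχ, hχ', hJ, fun W f x y e => ?_⟩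
      simp only [LinearMap.codRestrict_apply, LinearMap.comp_apply, Submodule.subtype_apply, e,
        Matrix.mulVecLin_apply, Matrix.mulVec_mulVec]
      rw [hlin]⟩

lemma Corr.matrix_homOf {Φ Ψ : Corr U X} (M : Matrix (Fin Ψ.n) (Fin Φ.n) Γ(U.scheme, ⊤))
    (h : Ψ.idem ⊤ * M = M) (h' : M * Φ.idem ⊤ = M) (H) : Hom.matrix (homOf M h H) = M := by
  rw [matrix_eq_of_col (M := M), h']
  intro x
  exact congr_arg (Matrix.mulVec · _) (map_res_top M)

lemma Corr.Hom.matrix_mul_act {Φ Ψ : Corr U X} (α : Φ ⟶ Ψ) (c : Γ(X.scheme, ⊤)) :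
    Hom.matrix α * Φ.act c = Ψ.act c * Hom.matrix α := by
  obtain ⟨J, hJ, χ, χ', h, h'⟩ := Corr.exists_common Φ Ψ
  have := Corr.Hom.lin α h h' ⊤ (rPull J ⊤ c)
  rw [map_res_top] at this
  rw [act_eq h, act_eq h']
  exact this

end Hom

/-! ### The composition functors -/

section BlockVec

variable {R : Type*} {a b c d : ℕ}

/-- The vector with the given blocks. -/
def blockVec (v : Fin a → Fin c → R) : Fin (a * c) → R :=
  fun l => v (finProdFinEquiv.symm l).1 (finProdFinEquiv.symm l).2

lemma blockRect_mulVec [NonUnitalNonAssocSemiring R]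
    (M : Matrix (Fin a) (Fin b) (Matrix (Fin c) (Fin d) R)) (v : Fin b → Fin d → R) :
    (blockRect M).mulVec (blockVec v) = blockVec fun i => ∑ j, (M i j).mulVec (v j) := by
  ext l
  obtain ⟨⟨i, k⟩, rfl⟩ := finProdFinEquiv.surjective l
  simp [blockVec, Matrix.mulVec, dotProduct, ← finProdFinEquiv.sum_comp, Fintype.sum_prod_type,
    Finset.sum_apply, -finProdFinEquiv_symm_apply]

end BlockVec

/-! ### Linearity of matrices under base change and composition. -/

section LinStar

variable {Y Z Z₂ U V : Scheme.{u}} {n n' m m' : ℕ}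

/-- Both sides of the identity are additive, linear and natural in the function on Y, so it suffices
to check functions pulled back from Z₂. -/
lemma Lin.baseChange {q : Y ⟶ Z} {p : Z₂ ⟶ U} {a : Y ⟶ Z₂} {g : Z ⟶ U} (H : IsPullback a q p g)
    [IsAffineHom p] {w : q ≫ g = a ≫ p} {φ : MatHom p n} {φ' : MatHom p n'} {ψ : MatHom q n}
    {ψ' : MatHom q n'} (h : Compat w φ ψ) (h' : Compat w φ' ψ')
    {M : Matrix (Fin n') (Fin n) Γ(U, ⊤)} (hM : Lin φ φ' M) :
    Lin ψ ψ' (M.map (pb g (W' := ⊤) le_top)) := by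
  let N := M.map (pb g (W' := ⊤) le_top)
  have hN : ∀ {S S' : Z.Opens} (hS : S' ≤ S), (rmap N S).map (res hS) = rmap N S' := by
    intro S S' hS
    ext i j
    exact res_res _ _ _
  refine baseChange_ext H (fun S x => rmap N S * ψ.app S x) (fun S x => ψ'.app S x * rmap N S)
    (fun S x y => ?_) (fun S x y => ?_) (fun S c x => ?_) (fun S c x => ?_)
    (fun S S' hS x => ?_) (fun S S' hS x => ?_) (fun W S _ _ hS b => ?_)
  · rw [map_add, Matrix.mul_add]
  · rw [map_add, Matrix.add_mul]
  · rw [ψ.app_pb_mul, Matrix.mul_smul]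
  · rw [ψ'.app_pb_mul, Matrix.smul_mul]
  · rw [ψ.app_res hS, ← hN hS, Matrix.map_mul]
  · rw [ψ'.app_res hS, ← hN hS, Matrix.map_mul]
  · have e : rmap N S = (rmap M W).map (pb g hS) := by
      ext i j
      exact (res_pb g (W := ⊤) (W' := ⊤) le_top le_top (M i j)).trans
        (pb_res g hS le_top (M i j)).symm
    have h₁ := h W S hS b
    have h₂ := h' W S hS b
    change rmap N S * ψ.app S (pb a _ b) = ψ'.app S (pb a _ b) * rmap N S
    rw [h₁, h₂, e, ← Matrix.map_mul, ← Matrix.map_mul, hM]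

/-- Blockwise, M moves past χ and turns it into χ'. Multiplicativity of χ' then reduces the claim to
χ' applied to the entries of the identity for N. -/
lemma Lin.star {q : Y ⟶ Z} {p : Z ⟶ V} {ψ : MatHom q m} {ψ' : MatHom q m'} {χ : MatHom p n}
    {χ' : MatHom p n'} {N : Matrix (Fin m') (Fin m) Γ(Z, ⊤)} {M : Matrix (Fin n') (Fin n) Γ(V, ⊤)}
    (hN : Lin ψ ψ' N) (hM : Lin χ χ' M) :
    Lin (ψ.star χ) (ψ'.star χ')
      (blockRect (Matrix.of fun i j => χ'.app ⊤ (N i j) * M)) := by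
  intro W f
  change rmap (blockRect _) W * blockRect ((ψ.app (p ⁻¹ᵁ W) f).map (χ.app W)) =
    blockRect ((ψ'.app (p ⁻¹ᵁ W) f).map (χ'.app W)) * rmap (blockRect _) W
  have e : rmap (blockRect (Matrix.of fun i j => χ'.app ⊤ (N i j) * M)) W =
      blockRect (Matrix.of fun i j => χ'.app W (rmap N (p ⁻¹ᵁ W) i j) * rmap M W) := by
    rw [rmap, blockRect_map]
    congr 1
    refine Matrix.ext fun i j => ?_
    change (χ'.app ⊤ (N i j) * M).map (res le_top) = _
    rw [Matrix.map_mul]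
    exact congr_arg (· * rmap M W) (χ'.app_res le_top (N i j)).symm
  rw [e, blockRect_mul_of, blockRect_mul_of]
  congr 1
  refine Matrix.ext fun i k => ?_
  have h := congr_fun (congr_fun (hN (p ⁻¹ᵁ W) f) i) k
  rw [Matrix.mul_apply, Matrix.mul_apply] at h
  calc ∑ j, (χ'.app W (rmap N (p ⁻¹ᵁ W) i j) * rmap M W) * χ.app W (ψ.app (p ⁻¹ᵁ W) f j k)
      = χ'.app W (∑ j, rmap N (p ⁻¹ᵁ W) i j * ψ.app (p ⁻¹ᵁ W) f j k) * rmap M W := by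
        rw [map_sum, Matrix.sum_mul]
        refine Finset.sum_congr rfl fun j _ => ?_
        rw [map_mul, Matrix.mul_assoc, hM, Matrix.mul_assoc]
    _ = χ'.app W (∑ j, ψ'.app (p ⁻¹ᵁ W) f i j * rmap N (p ⁻¹ᵁ W) j k) * rmap M W := by
        rw [h]
    _ = ∑ j, χ'.app W (ψ'.app (p ⁻¹ᵁ W) f i j) *
          (χ'.app W (rmap N (p ⁻¹ᵁ W) j k) * rmap M W) := by
        rw [map_sum, Matrix.sum_mul]
        refine Finset.sum_congr rfl fun j _ => ?_
        rw [map_mul, Matrix.mul_assoc]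

end LinStar

/-! ### The pairing on objects and on morphisms. -/

section Composition

variable {k : Type u} [Field k] {V U X : Sm k}

/-- The composite of two objects. -/
def compObj (Φ₁ : Corr V U) (Φ₂ : Corr U X) : Corr V X :=
  (exists_isComposite (Quotient.out Φ₁.cls) (Quotient.out Φ₂.cls)).choose.toCorr

lemma Corr.eq_toCorr (Φ : Corr U X) : Φ = Triple.toCorr (Quotient.out Φ.cls) := by
  obtain ⟨n, c⟩ := Φ
  exact congr_arg (Corr.mk n) (Quotient.out_eq c).symm

theorem IsComposite.compObj_eq {n₁ n₂ : ℕ} {t₁ : Triple V U n₁} {t₂ : Triple U X n₂}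
    {t₃ : Triple V X (n₂ * n₁)} (h : IsComposite t₁ t₂ t₃) :
    compObj t₁.toCorr t₂.toCorr = t₃.toCorr :=
  (exists_isComposite _ _).choose_spec.toCorr_eq h (Quotient.mk_out _) (Quotient.mk_out _)

/-- A global function on X pulls back to Z₁ ×_U Z₂ through Z₂. There compatibility turns ψ into the
pullback of a matrix of global functions on U, to which φ₁ applies. -/
lemma IsComposite.act_eq {n₁ n₂ : ℕ} {t₁ : Triple V U n₁} {t₂ : Triple U X n₂}
    {t₃ : Triple V X (n₂ * n₁)} (h : IsComposite t₁ t₂ t₃) (c : Γ(X.scheme, ⊤)) :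
    t₃.toCorr.act c = blockRect ((t₂.toCorr.act c).map t₁.toCorr.act) := by
  obtain ⟨ψ, hψ, π, w, e, h₃⟩ := h.exists_compat
  change t₃.hom.app ⊤ (rPull t₃.ideal ⊤ c) = blockRect ((t₂.hom.app ⊤ (rPull t₂.ideal ⊤ c)).map
    fun x => t₁.hom.app ⊤ (rPull t₁.ideal ⊤ x))
  rw [h₃]
  have e₁ : pullSec π w ⊤ (rPull t₃.ideal ⊤ c) =
      pb (W' := (fibFst t₁.ideal t₂.ideal ≫ src t₁.ideal) ⁻¹ᵁ ⊤) (fibSnd t₁.ideal t₂.ideal)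
        (preimage_le_of_comm (T' := src t₁.ideal ⁻¹ᵁ ⊤) pullback.condition le_top)
        (rPull t₂.ideal ⊤ c) :=
    (pb_pb (tgt t₃.ideal) π _ _ c).trans ((pb_congr e _ c).trans
      (pb_pb (tgt t₂.ideal) (fibSnd t₁.ideal t₂.ideal) _ _ c).symm)
  have e₂ := hψ ⊤ (src t₁.ideal ⁻¹ᵁ ⊤) le_top (rPull t₂.ideal ⊤ c)
  exact (congr_arg (fun x => blockRect ((ψ.app (src t₁.ideal ⁻¹ᵁ ⊤) x).map (t₁.hom.app ⊤))) e₁).trans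
    (congr_arg (fun N => blockRect (N.map (t₁.hom.app ⊤))) e₂)

lemma act_compObj (Φ₁ : Corr V U) (Φ₂ : Corr U X) (c : Γ(X.scheme, ⊤)) :
    (compObj Φ₁ Φ₂).act c = blockRect ((Φ₂.act c).map Φ₁.act) := by
  have := (exists_isComposite (Quotient.out Φ₁.cls) (Quotient.out Φ₂.cls)).choose_spec.act_eq c
  refine this.trans ?_
  congr 1
  refine Matrix.ext fun i j => ?_
  change Corr.act (Triple.toCorr (Quotient.out Φ₁.cls))
    (Corr.act (Triple.toCorr (Quotient.out Φ₂.cls)) c i j) = Φ₁.act (Φ₂.act c i j)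
  rw [Corr.act_eq (Quotient.out_eq Φ₁.cls), Corr.act_eq (Quotient.out_eq Φ₂.cls)]
  rfl

/-- The matrix with blocks `A i j` acting on the target of `M`. -/
def blockAct (Φ : Corr V U) {a b n : ℕ} (A : Matrix (Fin a) (Fin b) Γ(U.scheme, ⊤))
    (M : Matrix (Fin Φ.n) (Fin n) Γ(V.scheme, ⊤)) : Matrix (Fin (a * Φ.n)) (Fin (b * n)) Γ(V.scheme, ⊤) :=
  blockRect (Matrix.of fun i j => Φ.act (A i j) * M)

open Corr

/-- The matrix of α intertwines the two actions, so the blocks of B move to the left and `Ψ.act`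
becomes a common multiplicative factor. Functoriality of the pairing, and its behaviour with
idempotents, follow from this identity. -/
lemma blockAct_mul {Φ Ψ : Corr V U} {a b c n : ℕ} (α : Φ ⟶ Ψ)
    (A : Matrix (Fin a) (Fin b) Γ(U.scheme, ⊤)) (B : Matrix (Fin b) (Fin c) Γ(U.scheme, ⊤))
    (M : Matrix (Fin Φ.n) (Fin n) Γ(V.scheme, ⊤)) :
    blockAct Ψ A (Hom.matrix α) * blockAct Φ B M = blockAct Ψ (A * B) (Hom.matrix α * M) := by
  rw [blockAct, blockAct, blockAct, blockRect_mul_of]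
  congr 1
  refine Matrix.ext fun i k => ?_
  change ∑ j, (Ψ.act (A i j) * Hom.matrix α) * (Φ.act (B j k) * M) =
    Ψ.act (∑ j, A i j * B j k) * (Hom.matrix α * M)
  rw [act_sum, Matrix.sum_mul]
  refine Finset.sum_congr rfl fun j _ => ?_
  rw [act_mul, Matrix.mul_assoc, ← Matrix.mul_assoc (Hom.matrix α), Hom.matrix_mul_act,
    Matrix.mul_assoc, Matrix.mul_assoc]

lemma blockAct_add_left (Φ : Corr V U) {a b n : ℕ} (A B : Matrix (Fin a) (Fin b) Γ(U.scheme, ⊤))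
    (M : Matrix (Fin Φ.n) (Fin n) Γ(V.scheme, ⊤)) :
    blockAct Φ (A + B) M = blockAct Φ A M + blockAct Φ B M := by
  rw [blockAct, blockAct, blockAct, ← blockRect_add]
  congr 1
  refine Matrix.ext fun i j => ?_
  simp only [Matrix.of_apply, Matrix.add_apply, act_add, Matrix.add_mul]

lemma blockAct_add_right (Φ : Corr V U) {a b n : ℕ} (A : Matrix (Fin a) (Fin b) Γ(U.scheme, ⊤))
    (M N : Matrix (Fin Φ.n) (Fin n) Γ(V.scheme, ⊤)) :
    blockAct Φ A (M + N) = blockAct Φ A M + blockAct Φ A N := by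
  rw [blockAct, blockAct, blockAct, ← blockRect_add]
  congr 1
  refine Matrix.ext fun i j => ?_
  simp only [Matrix.of_apply, Matrix.add_apply, Matrix.mul_add]

lemma act_compObj' (Φ₁ : Corr V U) (Φ₂ : Corr U X) (c : Γ(X.scheme, ⊤)) :
    (compObj Φ₁ Φ₂).act c = blockAct Φ₁ (Φ₂.act c) (Hom.matrix (𝟙 Φ₁)) := by
  rw [act_compObj, blockAct, Hom.matrix_id]
  congr 1
  refine Matrix.ext fun i j => ?_
  simp only [Matrix.map_apply, Matrix.of_apply, act_mul_idem]

lemma idem_compObj (Φ₁ : Corr V U) (Φ₂ : Corr U X) :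
    (compObj Φ₁ Φ₂).idem ⊤ = blockAct Φ₁ (Hom.matrix (𝟙 Φ₂)) (Hom.matrix (𝟙 Φ₁)) := by
  rw [← act_one, act_compObj', act_one, Hom.matrix_id Φ₂]

variable {Φ₁ Φ₁' Φ₁'' : Corr V U} {Φ₂ Φ₂' Φ₂'' : Corr U X}

/-- Both composites are formed on one support, with the same π. The matrix is then linear because
linearity is preserved by base change and by composition. -/
lemma exists_lin_comp (α₁ : Φ₁ ⟶ Φ₁') (α₂ : Φ₂ ⟶ Φ₂') :
    ∃ (J : IdealSheafData (prodScheme V X)) (hJ : IsSubSch J)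
      (χ : MatHom (src J) (compObj Φ₁ Φ₂).n) (χ' : MatHom (src J) (compObj Φ₁' Φ₂').n),
      Quotient.mk _ ⟨J, hJ, χ⟩ = (compObj Φ₁ Φ₂).cls ∧
      Quotient.mk _ ⟨J, hJ, χ'⟩ = (compObj Φ₁' Φ₂').cls ∧
      Lin χ χ' (blockAct Φ₁' (Hom.matrix α₂) (Hom.matrix α₁)) := by
  obtain ⟨J₁, hJ₁, χ₁, χ₁', h₁, h₁'⟩ := exists_common Φ₁ Φ₁'
  obtain ⟨J₂, hJ₂, χ₂, χ₂', h₂, h₂'⟩ := exists_common Φ₂ Φ₂'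
  have := hJ₂.isFinite
  have H := (IsPullback.of_hasPullback (tgt J₁) (src J₂)).flip
  obtain ⟨ψ, hψ⟩ := exists_compat H χ₂
  obtain ⟨ψ', hψ'⟩ := exists_compat H χ₂'
  have hlin := ((Corr.Hom.lin α₂ h₂ h₂').baseChange H hψ hψ').star (Corr.Hom.lin α₁ h₁ h₁')
  obtain ⟨C, m, π, hC, e, hπ⟩ := exists_composite_support hJ₁ hJ₂
  have w : π ≫ src (IdealSheafData.vanishingIdeal C ^ m) = fibFst J₁ J₂ ≫ src J₁ := by
    rw [← fibMap_fst, ← hπ, Category.assoc]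
  have w' : π ≫ tgt (IdealSheafData.vanishingIdeal C ^ m) = fibSnd J₁ J₂ ≫ tgt J₂ := by
    rw [← fibMap_snd, ← hπ, Category.assoc]
  have cls : ∀ {Ψ₁ : Corr V U} {Ψ₂ : Corr U X} (ω₁ : MatHom (src J₁) Ψ₁.n)
      (ω₂ : MatHom (src J₂) Ψ₂.n) (θ : MatHom (fibFst J₁ J₂) Ψ₂.n),
      Quotient.mk _ ⟨J₁, hJ₁, ω₁⟩ = Ψ₁.cls → Quotient.mk _ ⟨J₂, hJ₂, ω₂⟩ = Ψ₂.cls →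
      Compat pullback.condition ω₂ θ →
      (Quotient.mk _ (⟨_, ⟨C, hC, m, rfl⟩, (θ.star ω₁).comap π w⟩ : Triple V X (Ψ₂.n * Ψ₁.n)) :
        Quotient (Triple.setoid V X (Ψ₂.n * Ψ₁.n))) = (compObj Ψ₁ Ψ₂).cls := by
    intro Ψ₁ Ψ₂ ω₁ ω₂ θ g₁ g₂ hθ
    have hc : IsComposite ⟨J₁, hJ₁, ω₁⟩ ⟨J₂, hJ₂, ω₂⟩
        ⟨_, ⟨C, hC, m, rfl⟩, (θ.star ω₁).comap π w⟩ :=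
      ⟨⟨C, m, e, rfl⟩, π, w, w', θ, isBaseChange_iff.mpr hθ, fun _ _ => rfl⟩
    have := hc.toCorr_eq (exists_isComposite (Quotient.out Ψ₁.cls) (Quotient.out Ψ₂.cls)).choose_spec
      (Quotient.exact (g₁.trans (Quotient.out_eq _).symm))
      (Quotient.exact (g₂.trans (Quotient.out_eq _).symm))
    injection this
  refine ⟨_, ⟨C, hC, m, rfl⟩, (ψ.star χ₁).comap π w, (ψ'.star χ₁').comap π w,
    cls χ₁ χ₂ ψ h₁ h₂ hψ, cls χ₁' χ₂' ψ' h₁' h₂' hψ', ?_⟩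
  have := hlin.comap π w
  refine (congr_arg (Lin _ _) ?_).mp this
  rw [blockAct]
  congr 1
  refine Matrix.ext fun i j => ?_
  exact congr_arg (· * Hom.matrix α₁) (act_eq h₁' (Hom.matrix α₂ i j)).symm

lemma blockAct_matrix_comp (α₁ : Φ₁ ⟶ Φ₁') (β₁ : Φ₁' ⟶ Φ₁'') (α₂ : Φ₂ ⟶ Φ₂') (β₂ : Φ₂' ⟶ Φ₂'') :
    blockAct Φ₁'' (Hom.matrix β₂) (Hom.matrix β₁) * blockAct Φ₁' (Hom.matrix α₂) (Hom.matrix α₁) =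
      blockAct Φ₁'' (Hom.matrix (α₂ ≫ β₂)) (Hom.matrix (α₁ ≫ β₁)) := by
  rw [blockAct_mul, Hom.matrix_comp, Hom.matrix_comp]

/-- The matrix of the composite of two morphisms. -/
def compMat (α₁ : Φ₁ ⟶ Φ₁') (α₂ : Φ₂ ⟶ Φ₂') :
    Matrix (Fin (compObj Φ₁' Φ₂').n) (Fin (compObj Φ₁ Φ₂).n) Γ(V.scheme, ⊤) :=
  blockAct Φ₁' (Hom.matrix α₂) (Hom.matrix α₁)

lemma compMat_mul (α₁ : Φ₁ ⟶ Φ₁') (β₁ : Φ₁' ⟶ Φ₁'') (α₂ : Φ₂ ⟶ Φ₂') (β₂ : Φ₂' ⟶ Φ₂'') :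
    compMat β₁ β₂ * compMat α₁ α₂ = compMat (α₁ ≫ β₁) (α₂ ≫ β₂) :=
  blockAct_matrix_comp α₁ β₁ α₂ β₂

lemma idem_mul_compMat (α₁ : Φ₁ ⟶ Φ₁') (α₂ : Φ₂ ⟶ Φ₂') :
    (compObj Φ₁' Φ₂').idem ⊤ * compMat α₁ α₂ = compMat α₁ α₂ := by
  have e := compMat_mul α₁ (𝟙 _) α₂ (𝟙 _)
  rw [Category.comp_id, Category.comp_id] at e
  rw [idem_compObj]
  exact e

lemma compMat_mul_idem (α₁ : Φ₁ ⟶ Φ₁') (α₂ : Φ₂ ⟶ Φ₂') :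
    compMat α₁ α₂ * (compObj Φ₁ Φ₂).idem ⊤ = compMat α₁ α₂ := by
  have e := compMat_mul (𝟙 _) α₁ (𝟙 _) α₂
  rw [Category.id_comp, Category.id_comp] at e
  rw [idem_compObj]
  exact e

/-- The composite of two morphisms. -/
def compHom (α₁ : Φ₁ ⟶ Φ₁') (α₂ : Φ₂ ⟶ Φ₂') : compObj Φ₁ Φ₂ ⟶ compObj Φ₁' Φ₂' :=
  homOf (compMat α₁ α₂) (idem_mul_compMat α₁ α₂) (exists_lin_comp α₁ α₂)

lemma matrix_compHom (α₁ : Φ₁ ⟶ Φ₁') (α₂ : Φ₂ ⟶ Φ₂') :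
    Hom.matrix (compHom α₁ α₂) = compMat α₁ α₂ :=
  matrix_homOf _ _ (compMat_mul_idem α₁ α₂) _

variable (V U X) in
/-- The composition functor. -/
def compFunctor : Corr V U × Corr U X ⥤ Corr V X where
  obj Φ := compObj Φ.1 Φ.2
  map α := compHom α.1 α.2
  map_id Φ := by
    apply Hom.matrix_injective
    rw [matrix_compHom, Hom.matrix_id, idem_compObj]
    rfl
  map_comp α β := by
    apply Hom.matrix_injective
    rw [matrix_compHom, Hom.matrix_comp, matrix_compHom, matrix_compHom]
    exact (compMat_mul α.1 β.1 α.2 β.2).symm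

end Composition

/-! ### The pairing property -/

section Pairing

variable {k : Type u} [Field k] {V U X : Sm k}

open Corr

lemma rmap_act {Φ : Corr V U} {J : IdealSheafData (prodScheme V U)} {hJ : IsSubSch J}
    {χ : MatHom (src J) Φ.n} (h : Quotient.mk _ ⟨J, hJ, χ⟩ = Φ.cls) (c : Γ(U.scheme, ⊤))
    (W : V.scheme.Opens) : rmap (Φ.act c) W = χ.app W (rPull J W c) := by
  rw [act_eq h]
  refine (χ.app_res (W := ⊤) le_top (rPull J ⊤ c)).symm.trans ?_
  exact congr_arg (χ.app W) (res_pb (tgt J) _ _ c)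

/-- The vector `(φ₁(m₂_j) m₁)_j` in the definition of `σ₁₂`. -/
def sigmaVec {Φ₁ : Corr V U} {Φ₂ : Corr U X} (t₁ : Triple V U Φ₁.n) (W : V.scheme.Opens)
    (m₂ : Fin Φ₂.n → Γ(t₁.ideal.subscheme, src t₁.ideal ⁻¹ᵁ W)) (m₁ : Φ₁.P W) :
    Fin (compObj Φ₁ Φ₂).n → Γ(V.scheme, W) :=
  blockVec fun j => (t₁.hom.app W (m₂ j)).mulVec m₁

lemma coe_sigma {Φ₁ : Corr V U} {Φ₂ : Corr U X} (t₁ : Triple V U Φ₁.n) (W : V.scheme.Opens)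
    (m₂ : Fin Φ₂.n → Γ(t₁.ideal.subscheme, src t₁.ideal ⁻¹ᵁ W)) (m₁ : Φ₁.P W) :
    (sigma (compObj Φ₁ Φ₂) rfl t₁ W m₂ m₁ : Fin (compObj Φ₁ Φ₂).n → Γ(V.scheme, W)) =
      ((compObj Φ₁ Φ₂).idem W).mulVec (sigmaVec t₁ W m₂ m₁) := rfl

lemma rmap_mul {U : Scheme.{u}} {a b c : ℕ} (M : Matrix (Fin a) (Fin b) Γ(U, ⊤))
    (N : Matrix (Fin b) (Fin c) Γ(U, ⊤)) (W : U.Opens) :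
    rmap M W * rmap N W = rmap (M * N) W :=
  Matrix.map_mul.symm

/-- The composite matrix absorbs the idempotents, so the projections in both σ can be moved away.
What is left is the blockwise identity Σ_j φ₁'(r^* a_ij) M φ₁(m₂_j) m₁ = φ₁'(Σ_j r^* a_ij m₂_j) M
m₁, which is linearity of α₁. -/
lemma compHom_sigma {Φ₁ Φ₁' : Corr V U} {Φ₂ Φ₂' : Corr U X} (α₁ : Φ₁ ⟶ Φ₁') (α₂ : Φ₂ ⟶ Φ₂')
    (J : IdealSheafData (prodScheme V U)) (hJ : IsSubSch J)
    (φ₁ : MatHom (src J) Φ₁.n) (φ₁' : MatHom (src J) Φ₁'.n)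
    (h : Quotient.mk _ ⟨J, hJ, φ₁⟩ = Φ₁.cls) (h' : Quotient.mk _ ⟨J, hJ, φ₁'⟩ = Φ₁'.cls)
    (W : V.scheme.Opens) (m₂ : Fin Φ₂.n → Γ(J.subscheme, src J ⁻¹ᵁ W)) (m₁ : Φ₁.P W) :
    Hom.app (compHom α₁ α₂) W (sigma (compObj Φ₁ Φ₂) rfl ⟨J, hJ, φ₁⟩ W m₂ m₁) =
      sigma (compObj Φ₁' Φ₂') rfl ⟨J, hJ, φ₁'⟩ W (pulledHom J α₂ W m₂) (Hom.app α₁ W m₁) := by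
  apply Subtype.ext
  rw [Hom.app_eq, matrix_compHom, coe_sigma, coe_sigma, ← idem_res (compObj Φ₁ Φ₂) (le_top : W ≤ ⊤),
    ← idem_res (compObj Φ₁' Φ₂') (le_top : W ≤ ⊤), Matrix.mulVec_mulVec, rmap_mul, compMat_mul_idem, ← idem_mul_compMat, ← rmap_mul,
    ← Matrix.mulVec_mulVec]
  refine congr_arg _ ?_
  have e : rmap (compMat α₁ α₂) W = blockRect (Matrix.of fun i j =>
      rmap (Φ₁'.act (Hom.matrix α₂ i j)) W * rmap (Hom.matrix α₁) W) := by
    simp only [rmap_mul]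
    rfl
  rw [e]
  refine (blockRect_mulVec _ _).trans (congr_arg blockVec (funext fun i => ?_))
  have lin := Corr.Hom.lin α₁ h h' W
  simp only [Matrix.of_apply, Matrix.mulVec_mulVec, rmap_act h', Matrix.mul_assoc, lin]
  simp only [← Matrix.mul_assoc, ← map_mul]
  simp only [← Matrix.mulVec_mulVec, ← Hom.app_eq, ← Matrix.sum_mulVec, ← map_sum]
  rfl

/-- For l = (j, i) take m₂ = r^* p(φ₂) e_j and m₁ = p(φ₁) e_i: the vector of blocks built from them
is p(φ₂ ∘ φ₁) e_l, and the further projection in σ₁₂ does not change it. -/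
lemma proj_eq_sigma {Φ₁ : Corr V U} {Φ₂ : Corr U X} (J : IdealSheafData (prodScheme V U))
    (hJ : IsSubSch J) (φ₁ : MatHom (src J) Φ₁.n) (h : Quotient.mk _ ⟨J, hJ, φ₁⟩ = Φ₁.cls)
    (l : Fin (compObj Φ₁ Φ₂).n) :
    ∃ m₂ ∈ pulledP J Φ₂ ⊤, ∃ m₁ : Φ₁.P ⊤,
      (compObj Φ₁ Φ₂).proj ⊤ (Pi.single l 1) = sigma (compObj Φ₁ Φ₂) rfl ⟨J, hJ, φ₁⟩ ⊤ m₂ m₁ := by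
  obtain ⟨⟨j, i⟩, rfl⟩ := (finProdFinEquiv (m := Φ₂.n) (n := Φ₁.n)).surjective l
  refine ⟨((Φ₂.idem ⊤).map (rPull J ⊤)).mulVec (Pi.single j 1), ⟨_, rfl⟩,
    Φ₁.proj ⊤ (Pi.single i 1), Subtype.ext ?_⟩
  rw [coe_sigma, coe_proj]
  have e : sigmaVec (Φ₂ := Φ₂) ⟨J, hJ, φ₁⟩ ⊤ (((Φ₂.idem ⊤).map (rPull J ⊤)).mulVec (Pi.single j 1))
        (Φ₁.proj ⊤ (Pi.single i 1)) =
      ((compObj Φ₁ Φ₂).idem ⊤).mulVec (Pi.single (finProdFinEquiv (j, i)) 1) := by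
    rw [idem_compObj]
    refine Eq.trans ?_ (Matrix.mulVec_single_one
      (blockAct Φ₁ (Hom.matrix (𝟙 Φ₂)) (Hom.matrix (𝟙 Φ₁))) (finProdFinEquiv (j, i))).symm
    ext l
    obtain ⟨⟨j', i'⟩, rfl⟩ := (finProdFinEquiv (m := Φ₂.n) (n := Φ₁.n)).surjective l
    have e₁ : ∀ c, φ₁.app ⊤ (rPull J ⊤ c) = Φ₁.act c := fun c => (act_eq h c).symm
    simp only [Matrix.mulVec_single_one, coe_proj, Matrix.col_apply, sigmaVec, blockVec,
      Equiv.symm_apply_apply, Matrix.map_apply, e₁, blockAct, blockRect_apply, Matrix.of_apply,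
      Hom.matrix_id]
    rfl
  exact (by rw [Matrix.mulVec_mulVec, idem_mul_idem] : _ = ((compObj Φ₁ Φ₂).idem ⊤).mulVec
    (((compObj Φ₁ Φ₂).idem ⊤).mulVec (Pi.single (finProdFinEquiv (j, i)) 1))).trans
    (congr_arg _ e.symm)

theorem isPairing_compFunctor : IsPairing (compFunctor V U X) where
  exists_composite := exists_isComposite
  obj_eq _ _ _ h := h.compObj_eq
  n_eq _ _ := rfl
  map_sigma α₁ α₂ J hJ φ₁ φ₁' h h' W m₂ _ m₁ := compHom_sigma α₁ α₂ J hJ φ₁ φ₁' h h' W m₂ m₁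

lemma IsPairing.obj_eq_compObj {F : Corr V U × Corr U X ⥤ Corr V X} (hF : IsPairing F)
    (Φ : Corr V U × Corr U X) : F.obj Φ = compObj Φ.1 Φ.2 := by
  obtain ⟨Φ₁, Φ₂⟩ := Φ
  rw [Φ₁.eq_toCorr, Φ₂.eq_toCorr]
  obtain ⟨t₃, h⟩ := exists_isComposite (Quotient.out Φ₁.cls) (Quotient.out Φ₂.cls)
  rw [hF.obj_eq _ _ _ h]
  exact h.compObj_eq.symm

lemma Corr.Hom.ext_proj {Φ Ψ : Corr U X} {α β : Φ ⟶ Ψ}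
    (h : ∀ l, Hom.app α ⊤ (Φ.proj ⊤ (Pi.single l 1)) = Hom.app β ⊤ (Φ.proj ⊤ (Pi.single l 1))) :
    α = β := by
  apply Hom.matrix_injective
  ext i l
  exact congr_fun (congr_arg Subtype.val (h l)) i

theorem IsPairing.eq_compFunctor {F : Corr V U × Corr U X ⥤ Corr V X} (hF : IsPairing F) :
    F = compFunctor V U X := by
  have hobj : F.obj = fun Φ => compObj Φ.1 Φ.2 := funext hF.obj_eq_compObj
  obtain ⟨obj, map, map_id, map_comp⟩ := F
  change obj = _ at hobj
  -- With the object maps identified, the two maps on morphisms have the same type, and it suffices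
  -- to compare them on the generators p e_l.
  subst hobj
  have : @map = fun _ _ α => compHom α.1 α.2 := by
    funext ⟨Φ₁, Φ₂⟩ ⟨Φ₁', Φ₂'⟩ ⟨α₁, α₂⟩
    refine Hom.ext_proj fun l => ?_
    obtain ⟨J, hJ, χ, χ', h, h'⟩ := exists_common Φ₁ Φ₁'
    obtain ⟨m₂, hm₂, m₁, e⟩ := proj_eq_sigma (Φ₂ := Φ₂) J hJ χ h l
    have e₁ := hF.map_sigma α₁ α₂ J hJ χ χ' h h' ⊤ m₂ hm₂ m₁
    have e₂ := compHom_sigma α₁ α₂ J hJ χ χ' h h' ⊤ m₂ m₁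
    change Hom.app (map (X := (Φ₁, Φ₂)) (Y := (Φ₁', Φ₂')) (α₁ ×ₘ α₂)) ⊤
      ((compObj Φ₁ Φ₂).proj ⊤ (Pi.single l 1)) =
      Hom.app (compHom α₁ α₂) ⊤ ((compObj Φ₁ Φ₂).proj ⊤ (Pi.single l 1))
    rw [e]
    exact e₁.trans e₂.symm
  subst this
  rfl

end Pairing

/-! ### Associativity and units on objects -/

section Objects

variable {k : Type u} [Field k] {W V U X : Sm k}

open Corr

lemma Rep.of_cast {Φ : Corr U X} {Y : Scheme.{u}} {n m : ℕ} {p : Y ⟶ U.scheme} {q : Y ⟶ X.scheme}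
    {χ : MatHom p n} (e : n = m) (h : Rep Φ p q (χ.cast e)) : Rep Φ p q χ := by
  subst e
  exact h

/-- Both nested numberings send (i, j, l) to l + a (j + b i). Strict associativity rests on this
choice of block order. -/
lemma cast_finProdFinEquiv {a b c : ℕ} (i : Fin c) (j : Fin b) (l : Fin a) :
    Fin.cast (mul_assoc c b a).symm (finProdFinEquiv (i, finProdFinEquiv (j, l))) =
      finProdFinEquiv (finProdFinEquiv (i, j), l) := by
  ext
  simp only [Fin.val_cast, finProdFinEquiv_apply_val]
  ring

lemma MatHom.star_assoc {Y Y₁ Z V : Scheme.{u}} {q' : Y ⟶ Y₁} {q : Y₁ ⟶ Z} {p : Z ⟶ V} {a b c : ℕ}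
    (ψ' : MatHom q' c) (ψ : MatHom q b) (χ : MatHom p a) :
    ψ'.star (ψ.star χ) = (((ψ'.star ψ).star χ).comap (𝟙 Y) (by simp)).cast (mul_assoc c b a) := by
  refine ext_app fun W f => ?_
  refine Matrix.ext fun i j => ?_
  obtain ⟨⟨i₃, i⟩, rfl⟩ := finProdFinEquiv.surjective i
  obtain ⟨⟨i₂, i₁⟩, rfl⟩ := finProdFinEquiv.surjective i
  obtain ⟨⟨j₃, j⟩, rfl⟩ := finProdFinEquiv.surjective j
  obtain ⟨⟨j₂, j₁⟩, rfl⟩ := finProdFinEquiv.surjective j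
  rw [cast_app, cast_finProdFinEquiv, cast_finProdFinEquiv, comap_app', pb_id, star_app, star_app,
    blockMatrix_eq, blockMatrix_eq, blockRect_apply, blockRect_apply, Matrix.map_apply,
    Matrix.map_apply]
  have e₁ := blockRect_apply ((ψ'.app (q ⁻¹ᵁ p ⁻¹ᵁ W) f).map (ψ.app (p ⁻¹ᵁ W))) i₃ j₃ i₂ j₂
  have e₂ := blockRect_apply ((ψ.app (p ⁻¹ᵁ W) (ψ'.app (q ⁻¹ᵁ p ⁻¹ᵁ W) f i₃ j₃)).map (χ.app W))
    i₂ j₂ i₁ j₁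
  refine e₂.trans ?_
  refine Eq.symm (Eq.trans ?_ (congr_arg (fun x => χ.app W x i₁ j₁) e₁))
  exact congr_arg (fun x => χ.app W ((ψ'.star ψ).app (p ⁻¹ᵁ W) x _ _) i₁ j₁)
    (res_self (W := ((q' ≫ q) ≫ p) ⁻¹ᵁ W) le_rfl f)

theorem compObj_assoc (Φ₁ : Corr W V) (Φ₂ : Corr V U) (Φ₃ : Corr U X) :
    compObj (compObj Φ₁ Φ₂) Φ₃ = compObj Φ₁ (compObj Φ₂ Φ₃) := by
  rw [Φ₁.eq_toCorr, Φ₂.eq_toCorr, Φ₃.eq_toCorr]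
  generalize Quotient.out Φ₁.cls = t₁
  generalize Quotient.out Φ₂.cls = t₂
  generalize Quotient.out Φ₃.cls = t₃
  obtain ⟨t₁₂, h₁₂⟩ := exists_isComposite t₁ t₂
  obtain ⟨t₂₃, h₂₃⟩ := exists_isComposite t₂ t₃
  obtain ⟨u, hu⟩ := exists_isComposite t₁₂ t₃
  obtain ⟨v, hv⟩ := exists_isComposite t₁ t₂₃
  rw [h₁₂.compObj_eq, h₂₃.compObj_eq, hu.compObj_eq, hv.compObj_eq]
  obtain ⟨ψ₂, hψ₂, π₁₂, w₁₂, e₁₂, H₁₂⟩ := h₁₂.exists_compat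
  obtain ⟨ψ₃, hψ₃, π₂₃, w₂₃, e₂₃, H₂₃⟩ := h₂₃.exists_compat
  have := t₃.isSubSch.isFinite
  -- Here ψ lives on (Z₁ ×_V Z₂) ×_{Z₂} (Z₂ ×_U Z₃). The two bracketings are represented by ψ ⋆ (ψ₂
  -- ⋆ φ₁) and (ψ ⋆ ψ₂) ⋆ φ₁ on this scheme.
  obtain ⟨ψ, hψ⟩ := exists_compat (IsPullback.of_hasPullback (fibSnd t₁.ideal t₂.ideal)
    (fibFst t₂.ideal t₃.ideal)).flip ψ₃
  have r₁ := hu.rep π₁₂ w₁₂ e₁₂ H₁₂ (𝟙 _) (Category.id_comp _) (Category.id_comp _)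
    (t₃.hom.comap_id _).symm (hψ₃.comp hψ)
  have r₂ := hv.rep (𝟙 _) (Category.id_comp _) (Category.id_comp _) (t₁.hom.comap_id _).symm
    π₂₃ w₂₃ e₂₃ H₂₃ (hψ₂.star hψ)
  rw [MatHom.star_assoc] at r₁
  exact (r₁.of_cast.of_comap _ _ (by simp)).unique r₂

/-- The homomorphism `𝒪 → M_1(𝒪)`. -/
def idHom (S : Scheme.{u}) : MatHom (𝟙 S) 1 :=
  MatHom.mk' _ _ (fun W f => Matrix.of fun _ _ => res (show W ≤ (𝟙 S) ⁻¹ᵁ W from le_rfl) f)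
    (fun W f g => by ext; exact map_add (res (show W ≤ (𝟙 S) ⁻¹ᵁ W from le_rfl)) f g)
    (fun W f g => by
      ext
      simp only [Matrix.mul_apply, Finset.univ_unique, Finset.sum_singleton]
      exact map_mul (res (show W ≤ (𝟙 S) ⁻¹ᵁ W from le_rfl)) f g)
    (fun W a f => by
      ext
      simp only [Matrix.of_apply, Matrix.smul_apply, map_mul, smul_eq_mul, pb_id, res_res, res_self])
    (fun W W' h f => by
      ext
      simp only [Matrix.of_apply, Matrix.map_apply, res_res])

lemma idHom_app (S : Scheme.{u}) (W : S.Opens) (f : Γ(S, (𝟙 S) ⁻¹ᵁ W)) (i j : Fin 1) :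
    (idHom S).app W f i j = res (show W ≤ (𝟙 S) ⁻¹ᵁ W from le_rfl) f := rfl

/-- The diagonal as a closed subscheme. -/
abbrev diagMap (X : Sm k) : X.scheme ⟶ (diag X).ker.subscheme := (diag X).toImage

lemma diagMap_src (X : Sm k) : diagMap X ≫ src (diag X).ker = 𝟙 X.scheme :=
  (Category.assoc _ _ _).symm.trans
    ((congr_arg (· ≫ prodFst X X) (diag X).toImage_imageι).trans (pullback.diagonal_fst _))

lemma diagMap_tgt (X : Sm k) : diagMap X ≫ tgt (diag X).ker = 𝟙 X.scheme :=
  (Category.assoc _ _ _).symm.trans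
    ((congr_arg (· ≫ prodSnd X X) (diag X).toImage_imageι).trans (pullback.diagonal_snd _))

/-- The triple `(1, Δ_X, id)`. -/
def idTriple (X : Sm k) : Triple X X 1 where
  ideal := (diag X).ker
  isSubSch := isSubSch_ker_diag X
  hom := (idHom X.scheme).comap (diagMap X) (diagMap_src X)

/-- The object `id_X`. -/
def idCorr (X : Sm k) : Corr X X := (idTriple X).toCorr

theorem isIdentity_idCorr (X : Sm k) : IsIdentity (idCorr X) := by
  refine ⟨idTriple X, diagMap X, diagMap_src X, ?_, diagMap_tgt X, fun W f => ?_, rfl⟩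
  · change IsIso (diag X).toImage
    infer_instance
  · ext i j
    exact res_self (W := W) le_rfl _

lemma MatHom.star_idHom {Y Z : Scheme.{u}} {p : Y ⟶ Z} {n : ℕ} (ψ : MatHom p n) :
    ψ.star (idHom Z) = (ψ.comap (𝟙 Y) (by simp)).cast (mul_one n).symm := by
  refine ext_app fun W f => ?_
  refine Matrix.ext fun i j => ?_
  obtain ⟨⟨i, i'⟩, rfl⟩ := finProdFinEquiv.surjective i
  obtain ⟨⟨j, j'⟩, rfl⟩ := finProdFinEquiv.surjective j
  have e : ∀ (i : Fin n) (i' : Fin 1), Fin.cast (mul_one n) (finProdFinEquiv (i, i')) = i := by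
    intro i i'
    ext
    simp
  rw [cast_app, e, e, comap_app', pb_id, star_app, blockMatrix_eq, blockRect_apply]
  refine (res_self (W := W) le_rfl _).trans ?_
  exact congr_arg (fun x => ψ.app W x i j) (res_self (W := p ⁻¹ᵁ W) le_rfl f).symm

lemma MatHom.idHom_star {Y Z : Scheme.{u}} {p : Y ⟶ Z} {n : ℕ} (χ : MatHom p n) :
    (idHom Y).star χ = (χ.comap (𝟙 Y) (by simp)).cast (one_mul n).symm := by
  refine ext_app fun W f => ?_
  refine Matrix.ext fun i j => ?_
  obtain ⟨⟨i', i⟩, rfl⟩ := finProdFinEquiv.surjective i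
  obtain ⟨⟨j', j⟩, rfl⟩ := finProdFinEquiv.surjective j
  have e : ∀ (i : Fin n) (i' : Fin 1), Fin.cast (one_mul n) (finProdFinEquiv (i', i)) = i := by
    intro i i'
    ext
    simp
  rw [cast_app, e, e, comap_app', pb_id, star_app, blockMatrix_eq, blockRect_apply]
  rfl

theorem idCorr_compObj (Φ : Corr U X) : compObj (idCorr U) Φ = Φ := by
  rw [Φ.eq_toCorr]
  generalize Quotient.out Φ.cls = t
  obtain ⟨u, hu⟩ := exists_isComposite (idTriple U) t
  rw [idCorr, hu.compObj_eq]
  have w : src t.ideal ≫ 𝟙 U.scheme = 𝟙 _ ≫ src t.ideal := by simp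
  have hc : Compat w t.hom t.hom := by
    intro O S hS b
    rw [pb_id]
    refine (t.hom.app_res (show S ≤ O from hS) b).trans ?_
    ext i j
    exact (pb_id hS _).symm
  have r := hu.rep (χ₁ := idHom U.scheme) (diagMap U) (diagMap_src U) (diagMap_tgt U) rfl (𝟙 _)
    (Category.id_comp _) (Category.id_comp _) (t.hom.comap_id _).symm hc
  rw [MatHom.star_idHom] at r
  exact (r.of_cast.of_comap _ _ (by simp)).unique t.rep

theorem compObj_idCorr (Φ : Corr U X) : compObj Φ (idCorr X) = Φ := by
  rw [Φ.eq_toCorr]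
  generalize Quotient.out Φ.cls = t
  obtain ⟨u, hu⟩ := exists_isComposite t (idTriple X)
  rw [idCorr, hu.compObj_eq]
  have w : 𝟙 _ ≫ tgt t.ideal = tgt t.ideal ≫ 𝟙 X.scheme := by simp
  have hc : Compat w (idHom X.scheme) (idHom t.ideal.subscheme) := by
    intro O S hS b
    ext i j
    rw [Matrix.map_apply, idHom_app, idHom_app, pb_res]
    exact res_pb _ _ _ _
  have r := hu.rep (𝟙 _) (Category.id_comp _) (Category.id_comp _) (t.hom.comap_id _).symm
    (χ₂ := idHom X.scheme) (diagMap X) (diagMap_src X) (diagMap_tgt X) rfl hc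
  rw [MatHom.idHom_star] at r
  exact (r.of_cast.of_comap _ _ (by simp)).unique t.rep

end Objects

/-! ### Associativity and units -/

section Functors

variable {k : Type u} [Field k] {W V U X : Sm k}

open Corr

/-- The object maps agree only propositionally, so matrix indices are matched by their numerical
values. This avoids transporting morphisms along equalities of objects. -/
lemma Corr.functor_ext {C : Type*} [Category* C] {F G : C ⥤ Corr U X} (hobj : ∀ c, F.obj c = G.obj c)
    (hmap : ∀ {c d : C} (f : c ⟶ d) (i : Fin (F.obj d).n) (j : Fin (F.obj c).n)
      (i' : Fin (G.obj d).n) (j' : Fin (G.obj c).n), (i : ℕ) = i' → (j : ℕ) = j' →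
      Hom.matrix (F.map f) i j = Hom.matrix (G.map f) i' j') : F = G := by
  obtain ⟨obj, map, map_id, map_comp⟩ := F
  obtain ⟨obj', map', map_id', map_comp'⟩ := G
  obtain rfl : obj = obj' := funext hobj
  obtain rfl : @map = @map' := by
    funext c d f
    exact Hom.matrix_injective (Matrix.ext fun i j => hmap f i j i j rfl rfl)
  rfl

variable {Φ₁ Φ₁' : Corr W V} {Φ₂ Φ₂' : Corr V U} {Φ₃ Φ₃' : Corr U X}

lemma compMat_apply (α₁ : Φ₁ ⟶ Φ₁') (α₂ : Φ₂ ⟶ Φ₂') (i₂ : Fin Φ₂'.n) (i₁ : Fin Φ₁'.n)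
    (j₂ : Fin Φ₂.n) (j₁ : Fin Φ₁.n) :
    compMat α₁ α₂ (finProdFinEquiv (i₂, i₁)) (finProdFinEquiv (j₂, j₁)) =
      (Φ₁'.act (Hom.matrix α₂ i₂ j₂) * Hom.matrix α₁) i₁ j₁ :=
  blockRect_apply _ _ _ _ _

lemma act_mul_compMat (α₁ : Φ₁ ⟶ Φ₁') (α₂ : Φ₂ ⟶ Φ₂') (c : Γ(U.scheme, ⊤)) :
    (compObj Φ₁' Φ₂').act c * compMat α₁ α₂ =
      blockAct Φ₁' (Φ₂'.act c * Hom.matrix α₂) (Hom.matrix α₁) := by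
  rw [act_compObj']
  refine (blockAct_mul (𝟙 Φ₁') _ _ _).trans ?_
  rw [Hom.matrix_id, Hom.idem_mul_matrix]

/-- With A₁, A₂, A₃ the matrices of the α's, both sides equal the (i₁, j₁) entry of φ₁'(x) A₁, where
x is the (i₂, j₂) entry of φ₂'((A₃)_{i₃ j₃}) A₂. -/
lemma compMat_assoc (α₁ : Φ₁ ⟶ Φ₁') (α₂ : Φ₂ ⟶ Φ₂') (α₃ : Φ₃ ⟶ Φ₃')
    (i : Fin (compObj (compObj Φ₁' Φ₂') Φ₃').n) (j : Fin (compObj (compObj Φ₁ Φ₂) Φ₃).n)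
    (i' : Fin (compObj Φ₁' (compObj Φ₂' Φ₃')).n) (j' : Fin (compObj Φ₁ (compObj Φ₂ Φ₃)).n)
    (hi : (i : ℕ) = i') (hj : (j : ℕ) = j') :
    compMat (compHom α₁ α₂) α₃ i j = compMat α₁ (compHom α₂ α₃) i' j' := by
  obtain ⟨⟨i₃, i⟩, rfl⟩ := (finProdFinEquiv (m := Φ₃'.n) (n := Φ₂'.n * Φ₁'.n)).surjective i
  obtain ⟨⟨i₂, i₁⟩, rfl⟩ := finProdFinEquiv.surjective i
  obtain ⟨⟨j₃, j⟩, rfl⟩ := (finProdFinEquiv (m := Φ₃.n) (n := Φ₂.n * Φ₁.n)).surjective j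
  obtain ⟨⟨j₂, j₁⟩, rfl⟩ := finProdFinEquiv.surjective j
  obtain rfl : i' = finProdFinEquiv (m := Φ₃'.n * Φ₂'.n) (finProdFinEquiv (i₃, i₂), i₁) := by
    rw [← cast_finProdFinEquiv]
    exact Fin.ext hi.symm
  obtain rfl : j' = finProdFinEquiv (m := Φ₃.n * Φ₂.n) (finProdFinEquiv (j₃, j₂), j₁) := by
    rw [← cast_finProdFinEquiv]
    exact Fin.ext hj.symm
  refine (compMat_apply (compHom α₁ α₂) α₃ i₃ (finProdFinEquiv (i₂, i₁)) j₃
    (finProdFinEquiv (j₂, j₁))).trans ?_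
  refine Eq.trans ?_ (compMat_apply α₁ (compHom α₂ α₃) (finProdFinEquiv (i₃, i₂)) i₁
    (finProdFinEquiv (j₃, j₂)) j₁).symm
  rw [matrix_compHom, matrix_compHom, act_mul_compMat]
  refine (blockRect_apply _ i₂ j₂ i₁ j₁).trans ?_
  exact congr_arg (fun c => (Φ₁'.act c * Hom.matrix α₁) i₁ j₁) (compMat_apply α₂ α₃ i₃ i₂ j₃ j₂).symm

theorem compFunctor_assoc : prod.inverseAssociator (Corr W V) (Corr V U) (Corr U X) ⋙
    (compFunctor W V U).prod (𝟭 (Corr U X)) ⋙ compFunctor W U X =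
      (𝟭 (Corr W V)).prod (compFunctor V U X) ⋙ compFunctor W V X := by
  refine Corr.functor_ext (fun Φ => compObj_assoc Φ.1 Φ.2.1 Φ.2.2) fun α i j i' j' hi hj => ?_
  change Hom.matrix (compHom (compHom α.1 α.2.1) α.2.2) i j =
    Hom.matrix (compHom α.1 (compHom α.2.1 α.2.2)) i' j'
  rw [matrix_compHom, matrix_compHom]
  exact compMat_assoc α.1 α.2.1 α.2.2 i j i' j' hi hj

lemma idCorr_act (c : Γ(U.scheme, ⊤)) : (idCorr U).act c = Matrix.of fun _ _ => c := by
  change (idTriple U).hom.app ⊤ (rPull (idTriple U).ideal ⊤ c) = _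
  refine Matrix.ext fun i j => ?_
  refine (res_self (W := ⊤) le_rfl _).trans ?_
  refine (pb_pb (tgt (diag U).ker) (diagMap U) _ _ c).trans ?_
  refine (pb_congr (diagMap_tgt U) _ c).trans ?_
  rw [pb_id]
  exact res_self (W := ⊤) _ _

theorem idCorr_compFunctor : Prod.sectR (idCorr U) (Corr U X) ⋙ compFunctor U U X = 𝟭 (Corr U X) := by
  refine Corr.functor_ext idCorr_compObj fun {Φ Ψ} α i j i' j' hi hj => ?_
  change Hom.matrix (compHom (𝟙 (idCorr U)) α) i j = Hom.matrix α i' j'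
  obtain ⟨⟨i, i₀⟩, rfl⟩ := (finProdFinEquiv (m := Ψ.n) (n := 1)).surjective i
  obtain ⟨⟨j, j₀⟩, rfl⟩ := (finProdFinEquiv (m := Φ.n) (n := 1)).surjective j
  obtain rfl : i' = i := Fin.ext (hi.symm.trans (by simp))
  obtain rfl : j' = j := Fin.ext (hj.symm.trans (by simp))
  rw [matrix_compHom]
  refine (compMat_apply (𝟙 (idCorr U)) α i' i₀ j' j₀).trans ?_
  rw [Hom.matrix_id, act_mul_idem, idCorr_act]
  rfl

theorem compFunctor_idCorr : Prod.sectL (Corr U X) (idCorr X) ⋙ compFunctor U X X = 𝟭 (Corr U X) := by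
  refine Corr.functor_ext compObj_idCorr fun {Φ Ψ} α i j i' j' hi hj => ?_
  change Hom.matrix (compHom α (𝟙 (idCorr X))) i j = Hom.matrix α i' j'
  obtain ⟨⟨i₀, i⟩, rfl⟩ := (finProdFinEquiv (m := 1) (n := Ψ.n)).surjective i
  obtain ⟨⟨j₀, j⟩, rfl⟩ := (finProdFinEquiv (m := 1) (n := Φ.n)).surjective j
  obtain rfl : i' = i := Fin.ext (hi.symm.trans (by simp))
  obtain rfl : j' = j := Fin.ext (hj.symm.trans (by simp))
  rw [matrix_compHom]
  refine (compMat_apply α (𝟙 (idCorr X)) i₀ i' j₀ j').trans ?_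
  rw [Hom.matrix_id, ← act_one, idCorr_act]
  change (Ψ.act 1 * Hom.matrix α) i' j' = _
  rw [act_one, Hom.idem_mul_matrix]

theorem additive_sectR (Φ : Corr V U) :
    (Prod.sectR Φ (Corr U X) ⋙ compFunctor V U X).Additive where
  map_add {Φ₂ Φ₂' α β} := by
    apply Hom.matrix_injective
    change Hom.matrix (compHom (𝟙 Φ) (α + β)) =
      Hom.matrix (compHom (𝟙 Φ) α) + Hom.matrix (compHom (𝟙 Φ) β)
    rw [matrix_compHom, matrix_compHom, matrix_compHom]
    exact blockAct_add_left Φ (Hom.matrix α) (Hom.matrix β) _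

theorem additive_sectL (Φ : Corr U X) :
    (Prod.sectL (Corr V U) Φ ⋙ compFunctor V U X).Additive where
  map_add {Φ₂ Φ₂' α β} := by
    apply Hom.matrix_injective
    change Hom.matrix (compHom (α + β) (𝟙 Φ)) =
      Hom.matrix (compHom α (𝟙 Φ)) + Hom.matrix (compHom β (𝟙 Φ))
    rw [matrix_compHom, matrix_compHom, matrix_compHom]
    exact blockAct_add_right Φ₂' _ (Hom.matrix α) (Hom.matrix β)

end Functors

/-! ### Biproducts -/

section FinBlocks

variable {R S γ δ : Type*} {a b c d : ℕ}

/-- Vertical concatenation. -/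
def vcat (A : Matrix (Fin a) γ R) (B : Matrix (Fin b) γ R) : Matrix (Fin (a + b)) γ R :=
  (Matrix.fromRows A B).submatrix finSumFinEquiv.symm id

/-- Horizontal concatenation. -/
def hcat (A : Matrix γ (Fin a) R) (B : Matrix γ (Fin b) R) : Matrix γ (Fin (a + b)) R :=
  (Matrix.fromCols A B).submatrix id finSumFinEquiv.symm

lemma vcat_map (A : Matrix (Fin a) γ R) (B : Matrix (Fin b) γ R) (f : R → S) :
    (vcat A B).map f = vcat (A.map f) (B.map f) := by
  rw [vcat, vcat, ← Matrix.fromRows_map]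
  rfl

lemma hcat_map (A : Matrix γ (Fin a) R) (B : Matrix γ (Fin b) R) (f : R → S) :
    (hcat A B).map f = hcat (A.map f) (B.map f) := by
  rw [hcat, hcat, ← Matrix.fromCols_map]
  rfl

variable [CommRing R]

lemma vcat_mul [Fintype γ] (A : Matrix (Fin a) γ R) (B : Matrix (Fin b) γ R) (C : Matrix γ δ R) :
    vcat A B * C = vcat (A * C) (B * C) := by
  rw [vcat, vcat, ← Matrix.fromRows_mul]
  rfl

lemma mul_hcat [Fintype γ] (C : Matrix δ γ R) (A : Matrix γ (Fin a) R) (B : Matrix γ (Fin b) R) :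
    C * hcat A B = hcat (C * A) (C * B) := by
  rw [hcat, hcat, ← Matrix.mul_fromCols]
  rfl

lemma hcat_mul_vcat (A : Matrix γ (Fin a) R) (B : Matrix γ (Fin b) R) (C : Matrix (Fin a) δ R)
    (D : Matrix (Fin b) δ R) : hcat A B * vcat C D = A * C + B * D := by
  rw [hcat, vcat, Matrix.submatrix_mul_equiv, Matrix.fromCols_mul_fromRows]
  rfl

lemma vcat_add (A A' : Matrix (Fin a) γ R) (B B' : Matrix (Fin b) γ R) :
    vcat A B + vcat A' B' = vcat (A + A') (B + B') := by
  ext i j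
  obtain ⟨i | i, rfl⟩ := finSumFinEquiv.surjective i <;> simp [vcat]

lemma hcat_add (A A' : Matrix γ (Fin a) R) (B B' : Matrix γ (Fin b) R) :
    hcat A B + hcat A' B' = hcat (A + A') (B + B') := by
  ext j i
  obtain ⟨i | i, rfl⟩ := finSumFinEquiv.surjective i <;> simp [hcat]

/-- The block diagonal matrix. -/
def bdiag (A : Matrix (Fin a) (Fin b) R) (B : Matrix (Fin c) (Fin d) R) :
    Matrix (Fin (a + c)) (Fin (b + d)) R :=
  vcat (hcat A 0) (hcat 0 B)

lemma bdiag_add (A A' : Matrix (Fin a) (Fin b) R) (B B' : Matrix (Fin c) (Fin d) R) :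
    bdiag (A + A') (B + B') = bdiag A B + bdiag A' B' := by
  simp only [bdiag, vcat_add, hcat_add, add_zero]

lemma bdiag_mul_vcat (A : Matrix (Fin a) (Fin b) R) (B : Matrix (Fin c) (Fin d) R)
    (C : Matrix (Fin b) γ R) (D : Matrix (Fin d) γ R) :
    bdiag A B * vcat C D = vcat (A * C) (B * D) := by
  simp only [bdiag, vcat_mul, hcat_mul_vcat, Matrix.zero_mul, add_zero, zero_add]

lemma hcat_mul_bdiag [Fintype γ] (A : Matrix (Fin a) (Fin b) R) (B : Matrix (Fin c) (Fin d) R)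
    (C : Matrix γ (Fin a) R) (D : Matrix γ (Fin c) R) :
    hcat C D * bdiag A B = hcat (C * A) (D * B) := by
  simp only [bdiag, hcat_mul_vcat, mul_hcat, hcat_add, Matrix.mul_zero, add_zero, zero_add]

lemma bdiag_mul {e f : ℕ} (A : Matrix (Fin a) (Fin b) R) (B : Matrix (Fin c) (Fin d) R)
    (C : Matrix (Fin b) (Fin e) R) (D : Matrix (Fin d) (Fin f) R) :
    bdiag A B * bdiag C D = bdiag (A * C) (B * D) := by
  conv_lhs => rw [bdiag, vcat_mul, hcat_mul_bdiag, hcat_mul_bdiag]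
  rw [bdiag, Matrix.zero_mul, Matrix.zero_mul]

lemma bdiag_smul (r : R) (A : Matrix (Fin a) (Fin b) R) (B : Matrix (Fin c) (Fin d) R) :
    bdiag (r • A) (r • B) = r • bdiag A B := by
  ext i j
  obtain ⟨i | i, rfl⟩ := finSumFinEquiv.surjective i <;>
  obtain ⟨j | j, rfl⟩ := finSumFinEquiv.surjective j <;> simp [bdiag, vcat, hcat]

lemma bdiag_map [CommRing S] (A : Matrix (Fin a) (Fin b) R) (B : Matrix (Fin c) (Fin d) R)
    (f : R →+* S) : (bdiag A B).map f = bdiag (A.map f) (B.map f) := by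
  simp only [bdiag, vcat_map, hcat_map, Matrix.map_zero f (map_zero f)]

lemma vcat_mul_hcat_add [Fintype γ] [Fintype δ] (A : Matrix (Fin a) γ R) (B : Matrix γ (Fin b) R)
    (C : Matrix (Fin c) δ R) (D : Matrix δ (Fin d) R) :
    vcat A 0 * hcat B 0 + vcat 0 C * hcat 0 D = bdiag (A * B) (C * D) := by
  rw [vcat_mul, vcat_mul, vcat_add, Matrix.zero_mul, Matrix.zero_mul, add_zero, zero_add, mul_hcat,
    mul_hcat, Matrix.mul_zero, Matrix.mul_zero, bdiag]

end FinBlocks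

/-- The direct sum of matrix homomorphisms. -/
def MatHom.dsum {Z U : Scheme.{u}} {p : Z ⟶ U} {n m : ℕ} (χ : MatHom p n) (χ' : MatHom p m) :
    MatHom p (n + m) :=
  MatHom.mk' p (n + m) (fun W f => bdiag (χ.app W f) (χ'.app W f))
    (fun W f g => by rw [map_add, map_add, bdiag_add])
    (fun W f g => by rw [map_mul, map_mul, bdiag_mul])
    (fun W a f => by rw [χ.app_pb_mul, χ'.app_pb_mul, bdiag_smul])
    (fun W W' h f => by rw [χ.app_res, χ'.app_res, bdiag_map])

/-! ### Injections and projections of a direct sum are linear. -/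

section LinDsum

variable {Z U : Scheme.{u}} {p : Z ⟶ U} {n m : ℕ} (χ : MatHom p n) (ω : MatHom p m)

lemma MatHom.dsum_app (W : U.Opens) (f : Γ(Z, p ⁻¹ᵁ W)) :
    (χ.dsum ω).app W f = bdiag (χ.app W f) (ω.app W f) := rfl

lemma MatHom.app_one_mul_self : χ.app ⊤ 1 * χ.app ⊤ 1 = χ.app ⊤ 1 := by
  rw [← map_mul, one_mul]

lemma MatHom.rmap_app_one_mul (W : U.Opens) (f : Γ(Z, p ⁻¹ᵁ W)) :
    rmap (χ.app ⊤ 1) W * χ.app W f = χ.app W f := by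
  have e := χ.app_res (W := ⊤) (le_top : W ≤ ⊤) 1
  rw [map_one] at e
  rw [rmap, ← e, ← map_mul, one_mul]

lemma MatHom.mul_rmap_app_one (W : U.Opens) (f : Γ(Z, p ⁻¹ᵁ W)) :
    χ.app W f * rmap (χ.app ⊤ 1) W = χ.app W f := by
  have e := χ.app_res (W := ⊤) (le_top : W ≤ ⊤) 1
  rw [map_one] at e
  rw [rmap, ← e, ← map_mul, mul_one]

lemma lin_inl : Lin χ (χ.dsum ω) (vcat (χ.app ⊤ 1) 0) := fun W f => by
  rw [rmap, vcat_map, MatHom.dsum_app, vcat_mul, bdiag_mul_vcat, χ.rmap_app_one_mul,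
    χ.mul_rmap_app_one, Matrix.map_zero _ (map_zero _), Matrix.zero_mul, Matrix.mul_zero]

lemma lin_inr : Lin ω (χ.dsum ω) (vcat 0 (ω.app ⊤ 1)) := fun W f => by
  rw [rmap, vcat_map, MatHom.dsum_app, vcat_mul, bdiag_mul_vcat, ω.rmap_app_one_mul,
    ω.mul_rmap_app_one, Matrix.map_zero _ (map_zero _), Matrix.zero_mul, Matrix.mul_zero]

lemma lin_fst : Lin (χ.dsum ω) χ (hcat (χ.app ⊤ 1) 0) := fun W f => by
  rw [rmap, hcat_map, MatHom.dsum_app, mul_hcat, hcat_mul_bdiag, χ.rmap_app_one_mul,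
    χ.mul_rmap_app_one, Matrix.map_zero _ (map_zero _), Matrix.zero_mul, Matrix.mul_zero]

lemma lin_snd : Lin (χ.dsum ω) ω (hcat 0 (ω.app ⊤ 1)) := fun W f => by
  rw [rmap, hcat_map, MatHom.dsum_app, mul_hcat, hcat_mul_bdiag, ω.rmap_app_one_mul,
    ω.mul_rmap_app_one, Matrix.map_zero _ (map_zero _), Matrix.zero_mul, Matrix.mul_zero]

end LinDsum

/-! ### Zero object and biproducts in the categories of correspondences. -/

section Biproducts

variable {k : Type u} [Field k] {U X : Sm k}

open Corr

lemma isSubSch_top : IsSubSch (⊤ : IdealSheafData (prodScheme U X)) :=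
  ⟨⊥, ⟨∅, Set.finite_empty, by simp, by simp⟩, 0, (pow_zero _).symm⟩

/-- The zero object of `𝒜(U, X)`. -/
def zeroCorr (U X : Sm k) : Corr U X :=
  Triple.toCorr (n := 0) ⟨⊤, isSubSch_top, ⟨fun _ => 0, fun _ _ _ => Subsingleton.elim _ _,
    fun _ _ => Subsingleton.elim _ _⟩⟩

instance : HasZeroObject (Corr U X) :=
  ⟨zeroCorr U X, (Limits.IsZero.iff_id_eq_zero _).mpr
    (Hom.matrix_injective (Matrix.ext fun i _ => Fin.elim0 i))⟩

lemma Corr.hasBinaryBiproduct_of_matrix {Φ Ψ Θ : Corr U X} {J : IdealSheafData (prodScheme U X)}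
    {hJ : IsSubSch J} {χ : MatHom (src J) Φ.n} {ω : MatHom (src J) Ψ.n} {θ : MatHom (src J) Θ.n}
    (hχ : Quotient.mk _ ⟨J, hJ, χ⟩ = Φ.cls) (hω : Quotient.mk _ ⟨J, hJ, ω⟩ = Ψ.cls)
    (hθ : Quotient.mk _ ⟨J, hJ, θ⟩ = Θ.cls)
    (A : Matrix (Fin Θ.n) (Fin Φ.n) Γ(U.scheme, ⊤)) (B : Matrix (Fin Θ.n) (Fin Ψ.n) Γ(U.scheme, ⊤))
    (C : Matrix (Fin Φ.n) (Fin Θ.n) Γ(U.scheme, ⊤)) (D : Matrix (Fin Ψ.n) (Fin Θ.n) Γ(U.scheme, ⊤))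
    (lA : Lin χ θ A) (lB : Lin ω θ B) (lC : Lin θ χ C) (lD : Lin θ ω D)
    (A_idem : A * Φ.idem ⊤ = A) (B_idem : B * Ψ.idem ⊤ = B)
    (idem_C : Φ.idem ⊤ * C = C) (idem_D : Ψ.idem ⊤ * D = D)
    (CA : C * A = Φ.idem ⊤) (CB : C * B = 0) (DA : D * A = 0) (DB : D * B = Ψ.idem ⊤)
    (total : A * C + B * D = Θ.idem ⊤) : HasBinaryBiproduct Φ Ψ := by
  -- The four absorption rules involving Θ follow from the total identity and the orthogonality
  -- relations.
  have idem_A : Θ.idem ⊤ * A = A := by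
    rw [← total, Matrix.add_mul, Matrix.mul_assoc, Matrix.mul_assoc, CA, DA, Matrix.mul_zero,
      add_zero, A_idem]
  have idem_B : Θ.idem ⊤ * B = B := by
    rw [← total, Matrix.add_mul, Matrix.mul_assoc, Matrix.mul_assoc, CB, DB, Matrix.mul_zero,
      zero_add, B_idem]
  have C_idem : C * Θ.idem ⊤ = C := by
    rw [← total, Matrix.mul_add, ← Matrix.mul_assoc, ← Matrix.mul_assoc, CA, CB, Matrix.zero_mul,
      add_zero, idem_C]
  have D_idem : D * Θ.idem ⊤ = D := by
    rw [← total, Matrix.mul_add, ← Matrix.mul_assoc, ← Matrix.mul_assoc, DA, DB, Matrix.zero_mul,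
      zero_add, idem_D]
  obtain ⟨a, mA⟩ : ∃ a : Φ ⟶ Θ, Hom.matrix a = A := ⟨_, matrix_homOf A idem_A A_idem
    ⟨J, hJ, χ, θ, hχ, hθ, lA⟩⟩
  obtain ⟨b, mB⟩ : ∃ b : Ψ ⟶ Θ, Hom.matrix b = B := ⟨_, matrix_homOf B idem_B B_idem
    ⟨J, hJ, ω, θ, hω, hθ, lB⟩⟩
  obtain ⟨c, mC⟩ : ∃ c : Θ ⟶ Φ, Hom.matrix c = C := ⟨_, matrix_homOf C idem_C C_idem
    ⟨J, hJ, θ, χ, hθ, hχ, lC⟩⟩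
  obtain ⟨d, mD⟩ : ∃ d : Θ ⟶ Ψ, Hom.matrix d = D := ⟨_, matrix_homOf D idem_D D_idem
    ⟨J, hJ, θ, ω, hθ, hω, lD⟩⟩
  refine hasBinaryBiproduct_of_total
    { pt := Θ, fst := c, snd := d, inl := a, inr := b
      inl_fst := Hom.matrix_injective ?_, inl_snd := Hom.matrix_injective ?_
      inr_fst := Hom.matrix_injective ?_, inr_snd := Hom.matrix_injective ?_ }
    (Hom.matrix_injective ?_)
  · rw [Hom.matrix_comp, Hom.matrix_id, mA, mC, CA]
  · rw [Hom.matrix_comp, Hom.matrix_zero, mA, mD, DA]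
  · rw [Hom.matrix_comp, Hom.matrix_zero, mB, mC, CB]
  · rw [Hom.matrix_comp, Hom.matrix_id, mB, mD, DB]
  · change Hom.matrix (c ≫ a + d ≫ b) = Hom.matrix (𝟙 Θ)
    rw [Hom.matrix_add, Hom.matrix_comp, Hom.matrix_comp, Hom.matrix_id, mA, mB, mC, mD, total]

/-- The biproduct is the block diagonal homomorphism on a common support. Its injections and
projections have p(φ) and p(φ') as blocks instead of identity matrices, because matrices of
morphisms must absorb the idempotents. -/
theorem Corr.hasBinaryBiproduct (Φ Ψ : Corr U X) : HasBinaryBiproduct Φ Ψ := by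
  obtain ⟨J, hJ, χ, ω, h, h'⟩ := exists_common Φ Ψ
  have eχ := χ.app_one_mul_self
  have eω := ω.app_one_mul_self
  refine Corr.hasBinaryBiproduct_of_matrix (Θ := Triple.toCorr ⟨J, hJ, χ.dsum ω⟩) h h' rfl
    _ _ _ _ (lin_inl χ ω) (lin_inr χ ω) (lin_fst χ ω) (lin_snd χ ω) ?_ ?_ ?_ ?_
    ((hcat_mul_vcat _ _ _ _).trans ?_) ((hcat_mul_vcat _ _ _ _).trans ?_)
    ((hcat_mul_vcat _ _ _ _).trans ?_) ((hcat_mul_vcat _ _ _ _).trans ?_)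
    ((vcat_mul_hcat_add _ _ _ _).trans (congr_arg₂ bdiag eχ eω))
  · refine (vcat_mul _ _ _).trans (congr_arg₂ vcat ?_ (Matrix.zero_mul _))
    rw [idem_eq h, eχ]
  · refine (vcat_mul _ _ _).trans (congr_arg₂ vcat (Matrix.zero_mul _) ?_)
    rw [idem_eq h', eω]
  · refine (mul_hcat _ _ _).trans (congr_arg₂ hcat ?_ (Matrix.mul_zero _))
    rw [idem_eq h, eχ]
  · refine (mul_hcat _ _ _).trans (congr_arg₂ hcat (Matrix.mul_zero _) ?_)
    rw [idem_eq h', eω]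
  · rw [eχ, Matrix.zero_mul, add_zero, idem_eq h]
  · rw [Matrix.zero_mul, Matrix.mul_zero, add_zero]
  · rw [Matrix.zero_mul, Matrix.mul_zero, add_zero]
  · rw [eω, Matrix.zero_mul, zero_add, idem_eq h']

theorem Corr.hasFiniteBiproducts (U X : Sm k) : HasFiniteBiproducts (Corr U X) := by
  have : HasBinaryBiproducts (Corr U X) := ⟨Corr.hasBinaryBiproduct⟩
  have : HasFiniteProducts (Corr U X) := hasFiniteProducts_of_has_binary_and_terminal
  exact HasFiniteBiproducts.of_hasFiniteProducts

end Biproducts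

end KMotive

end

theorem mainTheorem8 (k : Type u) [Field k] :
    (∀ V U X : KMotive.Sm k,
      ∃! F : KMotive.Corr V U × KMotive.Corr U X ⥤ KMotive.Corr V X, KMotive.IsPairing F) ∧
    ∃ E : KMotive.AdditiveEnrichment (KMotive.Sm k) (fun U X => KMotive.Corr U X),
      (∀ V U X : KMotive.Sm k, KMotive.IsPairing (E.comp V U X)) ∧
      (∀ X : KMotive.Sm k, KMotive.IsIdentity (E.id X)) :=
  ⟨fun V U X => ⟨KMotive.compFunctor V U X, KMotive.isPairing_compFunctor, fun _ hF => hF.eq_compFunctor⟩,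
    { comp := fun V U X => KMotive.compFunctor V U X
      id := KMotive.idCorr
      hasFiniteBiproducts := KMotive.Corr.hasFiniteBiproducts
      additive_left := fun _ _ _ Φ => KMotive.additive_sectL Φ
      additive_right := fun _ _ _ Φ => KMotive.additive_sectR Φ
      assoc := fun _ _ _ _ => KMotive.compFunctor_assoc
      id_comp := fun _ _ => KMotive.idCorr_compFunctor
      comp_id := fun _ _ => KMotive.compFunctor_idCorr },
    fun _ _ _ => KMotive.isPairing_compFunctor, KMotive.isIdentity_idCorr⟩
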